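/- Let $h\ge 1$. There is a constant $\alpha=\alpha(h)>0$ such that the following holds for every connected planar graph $H$ on the vertex set $\{1,\dots,h\}$ and all integer-valued functions $d(n)$, $D(n)$ with $$\limsup_{n\to\infty} d(n)\le\delta(H)\quad\text{and}\quad \liminf_{n\to\infty}D(n)\ge\max\{\Delta(H),\deg_H(1)+1,3\},$$ where $\delta(H)$ and $\Delta(H)$ denote the minimum and the maximum degree of $H$. Let $\mathcal P(n,d,D)$ be the set of all labelled planar graphs on $\{1,\dots,n\}$ in which every degree lies between $d(n)$ and $D(n)$, inclusive. For all sufficiently large $n$ this set is non-empty, and if $P_{n,d,D}$ denotes a uniformly random element of it, then $$\mathbf P\bigl[f_H(P_{n,d,D})\le\alpha n\bigr]<e^{-\alpha n}.$$ Here, for $G\in\mathcal P(n,d,D)$ and a set $W\subseteq\{1,\dots,n\}$ of $h$ vertices with least element $r_W$, we say that $H$ appears at $W$ in $G$ if (a) the increasing bijection from $\{1,\dots,h\}$ to $W$ is an isomorphism between $H$ and the induced subgraph $G[W]$, and (b) there is exactly one edge of $G$ between $W$ and the rest of $G$, and this edge is of the form $r_Wv_W$ with $v_W\notin W$. The appearance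 is cut-able if $\min\{\deg_G(r_W),\deg_G(v_W)\}>d(n)$, and $f_H(G)$ is the number of sets $W$ at which there is a cut-able appearance of $H$ in $G$. -/

import Mathlib

open Filter

namespace RandomPlanar

noncomputable section

/-- A rotation system on `G`: a permutation of the darts (oriented edges) whose cycles are exactly
the sets of darts leaving a common vertex, i.e. a cyclic order of the edges around each vertex. -/
def IsRotationSystem {V : Type*} (G : SimpleGraph V) (σ : Equiv.Perm G.Dart) : Prop :=
  ∀ a b : G.Dart, σ.SameCycle a b ↔ a.fst = b.fst

/-- The face permutation of a rotation system: reverse the dart, then turn to the next dart around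
the vertex just reached. Its cycles are the facial walks. -/
def facePerm {V : Type*} {G : SimpleGraph V} (σ : Equiv.Perm G.Dart) : Equiv.Perm G.Dart :=
  σ * SimpleGraph.Dart.symm_involutive.toPerm

/-- The number of facial walks with at least one edge. -/
def numFacialWalks {V : Type*} {G : SimpleGraph V} (σ : Equiv.Perm G.Dart) : ℕ :=
  Nat.card (Quotient (Equiv.Perm.SameCycle.setoid (facePerm σ)))

/-- Planarity of a finite graph, through combinatorial embeddings: there is a rotation system for
which every component is embedded in the sphere, i.e. has Euler characteristic `2`. As each
component has Euler characteristic at most `2`, this is the same as saying that the sum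
`|V| - |E| + |faces|` over the components is twice their number; an isolated vertex has one face,
which is bounded by no dart, and so is counted separately. -/
def IsPlanar {V : Type*} (G : SimpleGraph V) : Prop :=
  ∃ σ : Equiv.Perm G.Dart, IsRotationSystem G σ ∧
    Nat.card V + (numFacialWalks σ + {v : V | ∀ w, ¬ G.Adj v w}.ncard) =
      G.edgeSet.ncard + 2 * Nat.card G.ConnectedComponent

open Classical in
/-- The set `𝒫(n, d, D)` of planar graphs on `n` labelled vertices with all degrees between
`d` and `D`, inclusive. (The label `i + 1` is represented by `i : Fin n`.) -/
def planarGraphs (n : ℕ) (d D : ℤ) : Set (SimpleGraph (Fin n)) :=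
  {G | IsPlanar G ∧ ∀ v, d ≤ (G.degree v : ℤ) ∧ (G.degree v : ℤ) ≤ D}

/-- `H` appears at `W` in `G`, with root `r` and associated cut-edge `r v`:
`r` is the least element of `W`, the increasing bijection from the vertex set of `H` to `W` is an
isomorphism of `H` with `G[W]`, and `r v` is the only edge of `G` between `W` and its complement. -/
def AppearsAt {h n : ℕ} (H : SimpleGraph (Fin h)) (G : SimpleGraph (Fin n)) (W : Set (Fin n))
    (r v : Fin n) : Prop :=
  IsLeast W r ∧
  (∃ e : H ↪g G, StrictMono e ∧ Set.range e = W) ∧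
  (v ∉ W ∧ G.Adj r v) ∧
  ∀ x ∈ W, ∀ y ∉ W, G.Adj x y → x = r ∧ y = v

open Classical in
/-- `f_H(G)`: the number of sets `W` at which there is a cut-able appearance of `H` in `G`
(with respect to the lower bound `d` on the degrees). -/
def numCutableAppearances {h n : ℕ} (H : SimpleGraph (Fin h)) (d : ℤ)
    (G : SimpleGraph (Fin n)) : ℕ :=
  {W : Set (Fin n) | ∃ r v, AppearsAt H G W r v ∧
    d < min (G.degree r : ℤ) (G.degree v : ℤ)}.ncard

/-- The probability that `P_{n,d,D}`, uniformly distributed on `𝒫(n, d, D)`, satisfies `A`. -/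
def prob (n : ℕ) (d D : ℤ) (A : SimpleGraph (Fin n) → Prop) : ℝ :=
  ({G ∈ planarGraphs n d D | A G}.ncard : ℝ) / ((planarGraphs n d D).ncard : ℝ)

end

end RandomPlanar

/-! The heart is an insertion argument. A block is a vertex `c` joined to the roots of `s` disjoint
copies of `H`; it has `q = 1 + s * h` vertices. It is inserted into an edge `v w`, which becomes a
path `v c w`, or hung on an isolated vertex. Planarity survives, and so do the degrees of the old
vertices, except that an isolated vertex gets degree 1, which happens only if `d ≤ 0`. With `s = max
1 (deg r - 1)`, where `r` is the root of `H`, the degree of `c` exceeds `d` and is at most `D`. A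
graph on `n` vertices has at least `n / 2` places for a block, and the labels can be distributed in
`(n + q).choose n` ways. Conversely `c` is then an attachment, the outer end of the cut-edge of a
cut-able appearance, of degree at most `s + 2`; so a graph with at most `k + q` attachments arises
from at most `(k + q) * (s + 2) ^ 2` insertions (`mul_ncard_fewAttachments_le`). Attachments are
counted instead of appearances because a block creates at most `q` new ones, whereas distinct
attachments come from distinct appearances.

Start from the graphs with at most `α n` attachments and insert `t = ⌈α n⌉` blocks. The number of
attachments stays below a constant times `α n`, so each step multiplies the number of graphs,
divided by the factorial of the order, by at least a constant times `1 / α`. If the initial graphs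
made up a proportion of at least `exp (-α n)`, then for small `α` there would be more graphs on `n +
t q` vertices than the class contains (`ncard_fewAttachments_lt`).

This needs an upper bound on the growth of the class from order `n` to order `m`, valid for all
admissible `d` and `D` at once although both vary with `n`. Joining two connected graphs by an edge
makes the counting sequence of connected graphs supermultiplicative up to a polynomial factor
(`choose_mul_ncard_connPlanar_le`); splitting off the component of one vertex bounds all graphs by
connected ones (`ncard_boundedPlanar_succ_le`). Both sequences therefore have the same exponential
growth rate (`GrowthPair.exists_rate`). Uniformity in `D` holds because bounds `D ≥ n` are all
equivalent at order `n` (`GrowthPair.eventually_forall_family`). The class is non-empty at all large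
orders because it has connected members of the coprime orders `h` and `1 + deg r * h`.

Finiteness of the rate is the bound `A ^ n * n!` for labelled planar graphs
(`exists_ncard_planarSet_le`): half of the vertices are isolated or can be contracted into a
neighbour so that few choices suffice to undo the contraction.

All planarity facts come from pairs of permutations. `defect` is twice the genus; multiplying by a
transposition changes it in a controlled way. `HasSphereMap` allows superfluous darts, which makes
it easy to pass to subgraphs, contract edges and insert blocks, and it is equivalent to `IsPlanar`
on finite vertex sets. -/

namespace RandomPlanar

open Equiv Equiv.Perm

/-! ### Permutations, their cycles, and the genus of hypermaps. -/

section Hypermap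

variable {X Y : Type*}

/-- The equivalence relation whose only nontrivial class is `{a, b}`. -/
def pairSetoid (a b : X) : Setoid X where
  r x y := x = y ∨ (x = a ∧ y = b) ∨ (x = b ∧ y = a)
  iseqv := by
    refine ⟨fun x => Or.inl rfl, ?_, ?_⟩
    · rintro x y (h | ⟨h, h'⟩ | ⟨h, h'⟩)
      · exact Or.inl h.symm
      · exact Or.inr (Or.inr ⟨h', h⟩)
      · exact Or.inr (Or.inl ⟨h', h⟩)
    · rintro x y z (rfl | ⟨rfl, rfl⟩ | ⟨rfl, rfl⟩) (h | ⟨h1, h2⟩ | ⟨h1, h2⟩) <;> grind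

theorem pairSetoid_le {r : Setoid X} {a b : X} : pairSetoid a b ≤ r ↔ r a b := by
  constructor
  · intro h
    exact h (Or.inr (Or.inl ⟨rfl, rfl⟩))
  · rintro h x y (rfl | ⟨rfl, rfl⟩ | ⟨rfl, rfl⟩)
    · exact r.refl' _
    · exact h
    · exact r.symm' h

theorem sup_pairSetoid_iff {r : Setoid X} {a b x y : X} :
    (r ⊔ pairSetoid a b) x y ↔ r x y ∨ (r x a ∧ r y b) ∨ (r x b ∧ r y a) := by
  constructor
  · let s : Setoid X :=
      { r := fun x y => r x y ∨ (r x a ∧ r y b) ∨ (r x b ∧ r y a)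
        iseqv := by
          refine ⟨fun x => Or.inl (r.refl' x), ?_, ?_⟩
          · rintro x y (h | ⟨h, h'⟩ | ⟨h, h'⟩)
            · exact Or.inl (r.symm' h)
            · exact Or.inr (Or.inr ⟨h', h⟩)
            · exact Or.inr (Or.inl ⟨h', h⟩)
          · have t := @Setoid.trans' X r
            have s := @Setoid.symm' X r
            rintro x y z (h | ⟨h, h'⟩ | ⟨h, h'⟩) (k | ⟨k, k'⟩ | ⟨k, k'⟩)
            · exact Or.inl (t h k)
            · exact Or.inr (Or.inl ⟨t h k, k'⟩)
            · exact Or.inr (Or.inr ⟨t h k, k'⟩)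
            · exact Or.inr (Or.inl ⟨h, t (s k) h'⟩)
            · exact Or.inl (t h (t (s k) (t h' (s k'))))
            · exact Or.inl (t h (s k'))
            · exact Or.inr (Or.inr ⟨h, t (s k) h'⟩)
            · exact Or.inl (t h (s k'))
            · exact Or.inl (t h (t (s k) (t h' (s k')))) }
    have : r ⊔ pairSetoid a b ≤ s := by
      refine sup_le (fun {x y} h => Or.inl h) (pairSetoid_le.2 ?_)
      exact Or.inr (Or.inl ⟨r.refl' a, r.refl' b⟩)
    exact fun h => this h
  · have h1 : r ≤ r ⊔ pairSetoid a b := le_sup_left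
    have h2 : (r ⊔ pairSetoid a b) a b := pairSetoid_le.1 le_sup_right
    rintro (h | ⟨h, h'⟩ | ⟨h, h'⟩)
    · exact h1 h
    · exact Setoid.trans' _ (h1 h) (Setoid.trans' _ h2 (Setoid.symm' _ (h1 h')))
    · exact Setoid.trans' _ (h1 h) (Setoid.trans' _ (Setoid.symm' _ h2) (Setoid.symm' _ (h1 h')))

/-- The number of classes of an equivalence relation. -/
noncomputable def numClasses (r : Setoid X) : ℕ := Nat.card (Quotient r)

/-- The class of `b` is absorbed by that of `a`, so the new classes correspond to the old ones other
than the class of `b`. -/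
theorem numClasses_sup_pairSetoid [Finite X] {r : Setoid X} {a b : X} (h : ¬ r a b) :
    numClasses (r ⊔ pairSetoid a b) + 1 = numClasses r := by
  classical
  have e := Equiv.optionSubtypeNe (⟦b⟧ : Quotient r)
  rw [numClasses, numClasses, ← Nat.card_congr e, Finite.card_option]
  congr 1
  symm
  refine Nat.card_eq_of_bijective
    (fun q : {q : Quotient r // q ≠ ⟦b⟧} => Setoid.map_of_le (le_sup_left : r ≤ r ⊔ pairSetoid a b) q.1)
    ⟨?_, ?_⟩
  · rintro ⟨p, hp⟩ ⟨q, hq⟩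
    induction p using Quotient.inductionOn with | _ x
    induction q using Quotient.inductionOn with | _ y
    intro hxy
    have h0 : (r ⊔ pairSetoid a b) x y := Quotient.exact hxy
    rw [Subtype.mk.injEq]
    rcases sup_pairSetoid_iff.1 h0 with h | ⟨_, h'⟩ | ⟨h', _⟩
    · exact Quotient.sound h
    · exact absurd (Quotient.sound h') hq
    · exact absurd (Quotient.sound h') hp
  · intro p
    induction p using Quotient.inductionOn with | _ x
    by_cases hx : r x b
    · refine ⟨⟨⟦a⟧, fun h' => h (Quotient.exact h')⟩, Quotient.sound ?_⟩
      exact sup_pairSetoid_iff.2 (Or.inr (Or.inl ⟨r.refl' a, hx⟩))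
    · exact ⟨⟨⟦x⟧, fun h' => hx (Quotient.exact h')⟩, rfl⟩

theorem sup_pairSetoid_of_rel {r : Setoid X} {a b : X} (h : r a b) : r ⊔ pairSetoid a b = r :=
  sup_eq_left.2 (pairSetoid_le.2 h)

/-- The partition of `X` into the cycles of `π`. -/
abbrev cyc (π : Perm X) : Setoid X := SameCycle.setoid π

theorem cyc_apply {π : Perm X} {x y : X} : cyc π x y ↔ π.SameCycle x y := Iff.rfl

theorem cyc_le {π : Perm X} {s : Setoid X} : cyc π ≤ s ↔ ∀ x, s x (π x) := by
  constructor
  · intro h x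
    exact h (sameCycle_apply_right.2 (SameCycle.refl π x))
  · rintro h x y ⟨i, rfl⟩
    have key : ∀ (n : ℕ) x, s x ((π ^ n) x) := by
      intro n
      induction n with
      | zero => intro x; exact s.refl' x
      | succ n ih =>
        intro x
        rw [pow_succ', Perm.mul_apply]
        exact s.trans' (ih x) (h _)
    cases i with
    | ofNat n => exact key n x
    | negSucc n =>
      rw [zpow_negSucc]
      have := key (n + 1) ((π ^ (n + 1))⁻¹ x)
      rw [← Perm.mul_apply, mul_inv_cancel, Perm.one_apply] at this
      exact s.symm' this

theorem cyc_inv (π : Perm X) : cyc π⁻¹ = cyc π := by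
  ext x y
  exact sameCycle_inv

theorem cyc_one : cyc (1 : Perm X) = ⊥ := by
  ext x y
  exact sameCycle_one

theorem numClasses_bot : numClasses (⊥ : Setoid X) = Nat.card X :=
  Nat.card_congr (Setoid.quotientBotEquiv)

theorem cyc_mul_le (σ α : Perm X) : cyc (σ * α) ≤ cyc σ ⊔ cyc α := by
  rw [cyc_le]
  intro x
  have h1 : (cyc σ ⊔ cyc α) x (α x) := (cyc_le.1 (le_sup_right : cyc α ≤ _)) x
  have h2 : (cyc σ ⊔ cyc α) (α x) (σ (α x)) := (cyc_le.1 (le_sup_left : cyc σ ≤ _)) (α x)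
  exact Setoid.trans' _ h1 h2

section Swap

variable [DecidableEq X]

theorem cyc_swap_le (a b : X) {s : Setoid X} (h : s a b) : cyc (swap a b) ≤ s := by
  rw [cyc_le]
  intro x
  rcases eq_or_ne x a with rfl | hx
  · rwa [swap_apply_left]
  rcases eq_or_ne x b with rfl | hx'
  · rw [swap_apply_right]; exact s.symm' h
  · rw [swap_apply_of_ne_of_ne hx hx']

theorem cyc_mul_swap_sup (π : Perm X) (a b : X) :
    cyc (π * swap a b) ⊔ pairSetoid a b = cyc π ⊔ pairSetoid a b := by
  have key : ∀ π : Perm X, cyc (π * swap a b) ≤ cyc π ⊔ pairSetoid a b := fun π =>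
    (cyc_mul_le _ _).trans (sup_le le_sup_left
      (cyc_swap_le _ _ (pairSetoid_le.1 le_sup_right)))
  refine le_antisymm (sup_le (key π) le_sup_right) (sup_le ?_ le_sup_right)
  have := key (π * swap a b)
  rwa [mul_assoc, swap_mul_self, mul_one] at this

variable [Finite X]

/-- If `k > 0` is least with `π ^ k a = b`, the new permutation sends `b` to `π a` and then follows
`π` back to `b`; this closes a cycle that avoids `a`. -/
theorem not_sameCycle_mul_swap {π : Perm X} {a b : X} (hab : a ≠ b) (h : π.SameCycle a b) :
    ¬ (π * swap a b).SameCycle a b := by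
  classical
  have hex : ∃ k, 0 < k ∧ (π ^ k) a = b := by
    obtain ⟨k, hk, -, hk'⟩ := h.exists_pow_eq''
    exact ⟨k, hk, hk'⟩
  obtain ⟨hk0, hk⟩ := Nat.find_spec hex
  set k := Nat.find hex with hkdef
  have hmin : ∀ i, 0 < i → i < k → (π ^ i) a ≠ b := fun i hi hik hb =>
    Nat.find_min hex hik ⟨hi, hb⟩
  have hmin' : ∀ i, 0 < i → i < k → (π ^ i) a ≠ a := by
    intro i hi hik ha
    refine hmin (k - i) (by omega) (by omega) ?_
    rw [← hk]
    conv_rhs => rw [show k = (k - i) + i by omega, pow_add, Perm.mul_apply, ha]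
  have key : ∀ m : ℕ, ∃ i, 0 < i ∧ i ≤ k ∧ ((π * swap a b) ^ m) b = (π ^ i) a := by
    intro m
    induction m with
    | zero => exact ⟨k, hk0, le_rfl, by simp [hk]⟩
    | succ m ih =>
      obtain ⟨i, hi, hik, he⟩ := ih
      rw [pow_succ', Perm.mul_apply, he, Perm.mul_apply]
      rcases hik.lt_or_eq with hlt | rfl
      · refine ⟨i + 1, by omega, by omega, ?_⟩
        rw [swap_apply_of_ne_of_ne (hmin' i hi hlt) (hmin i hi hlt), pow_succ', Perm.mul_apply]
      · refine ⟨1, by omega, by omega, ?_⟩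
        rw [hk, swap_apply_right, pow_one]
  intro h'
  obtain ⟨m, hm⟩ := h'.symm.exists_nat_pow_eq
  obtain ⟨i, hi, hik, he⟩ := key m
  rw [hm] at he
  rcases hik.lt_or_eq with hlt | rfl
  · exact hmin' i hi hlt he.symm
  · exact hab (he.trans hk)

/-- From `a` the new permutation jumps to `π b` and then runs through the old cycle of `b` until it
arrives at `b`. -/
theorem sameCycle_mul_swap {π : Perm X} {a b : X} (h : ¬ π.SameCycle a b) :
    (π * swap a b).SameCycle a b := by
  classical
  have hex : ∃ k, 0 < k ∧ (π ^ k) b = b := by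
    obtain ⟨k, hk, -, hk'⟩ := (SameCycle.refl π b).exists_pow_eq''
    exact ⟨k, hk, hk'⟩
  obtain ⟨hk0, hk⟩ := Nat.find_spec hex
  set k := Nat.find hex with hkdef
  have hmin : ∀ i, 0 < i → i < k → (π ^ i) b ≠ b := fun i hi hik hb =>
    Nat.find_min hex hik ⟨hi, hb⟩
  have key : ∀ i, i < k → ((π * swap a b) ^ (i + 1)) a = (π ^ (i + 1)) b := by
    intro i
    induction i with
    | zero => intro _; simp
    | succ i ih =>
      intro hi
      rw [pow_succ', Perm.mul_apply, ih (by omega), Perm.mul_apply, swap_apply_of_ne_of_ne,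
        pow_succ' π (i + 1), Perm.mul_apply]
      · intro he
        exact h (SameCycle.symm ⟨((i + 1 : ℕ) : ℤ), by rw [zpow_natCast]; exact he⟩)
      · exact hmin (i + 1) (by omega) hi
  have := key (k - 1) (by omega)
  rw [show k - 1 + 1 = k by omega, hk] at this
  exact ⟨(k : ℕ), by simpa using this⟩

theorem cyc_mul_swap_of_not {π : Perm X} {a b : X} (h : ¬ π.SameCycle a b) :
    cyc (π * swap a b) = cyc π ⊔ pairSetoid a b := by
  rw [← cyc_mul_swap_sup, sup_pairSetoid_of_rel (sameCycle_mul_swap h)]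

theorem cyc_eq_of_sameCycle {π : Perm X} {a b : X} (h : π.SameCycle a b) :
    cyc π = cyc (π * swap a b) ⊔ pairSetoid a b := by
  rw [cyc_mul_swap_sup, sup_pairSetoid_of_rel h]

theorem numClasses_mul_swap_of_not {π : Perm X} {a b : X} (h : ¬ π.SameCycle a b) :
    numClasses (cyc (π * swap a b)) + 1 = numClasses (cyc π) := by
  rw [cyc_mul_swap_of_not h]
  exact numClasses_sup_pairSetoid h

theorem numClasses_mul_swap_of_sameCycle {π : Perm X} {a b : X} (hab : a ≠ b)
    (h : π.SameCycle a b) :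
    numClasses (cyc (π * swap a b)) = numClasses (cyc π) + 1 := by
  rw [cyc_eq_of_sameCycle h]
  exact (numClasses_sup_pairSetoid (not_sameCycle_mul_swap hab h)).symm

theorem cyc_swap_mul_of_not {π : Perm X} {a b : X} (h : ¬ π.SameCycle a b) :
    cyc (swap a b * π) = cyc π ⊔ pairSetoid a b := by
  rw [← cyc_inv, mul_inv_rev, swap_inv, cyc_mul_swap_of_not (by rwa [sameCycle_inv]), cyc_inv]

theorem cyc_eq_of_sameCycle' {π : Perm X} {a b : X} (h : π.SameCycle a b) :
    cyc π = cyc (swap a b * π) ⊔ pairSetoid a b := by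
  rw [← cyc_inv π, cyc_eq_of_sameCycle (a := a) (b := b) (by rwa [sameCycle_inv]),
    ← cyc_inv (swap a b * π), mul_inv_rev, swap_inv]

theorem numClasses_swap_mul_of_not {π : Perm X} {a b : X} (h : ¬ π.SameCycle a b) :
    numClasses (cyc (swap a b * π)) + 1 = numClasses (cyc π) := by
  rw [cyc_swap_mul_of_not h]
  exact numClasses_sup_pairSetoid h

theorem numClasses_swap_mul_of_sameCycle {π : Perm X} {a b : X} (hab : a ≠ b)
    (h : π.SameCycle a b) :
    numClasses (cyc (swap a b * π)) = numClasses (cyc π) + 1 := by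
  rw [← cyc_inv, mul_inv_rev, swap_inv, numClasses_mul_swap_of_sameCycle hab
    (by rwa [sameCycle_inv]), cyc_inv]

end Swap

/-- Twice the total genus of the hypermap with vertices the cycles of `σ`, hyperedges the cycles of
`α` and faces the cycles of `σ * α`. -/
noncomputable def defect (σ α : Perm X) : ℤ :=
  Nat.card X + 2 * numClasses (cyc σ ⊔ cyc α) - numClasses (cyc σ) - numClasses (cyc α)
    - numClasses (cyc (σ * α))

/-! ### Elementary moves on hypermaps and their effect on the genus. -/

section Moves

variable [DecidableEq X] [Finite X] {σ α : Perm X} {a b : X}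

theorem not_sameCycle_of_not_sup (h : ¬ (cyc σ ⊔ cyc α) a b) :
    ¬ σ.SameCycle a b ∧ ¬ α.SameCycle a b ∧ ¬ (σ * α).SameCycle a b :=
  ⟨fun h' => h ((le_sup_left : cyc σ ≤ _) h'), fun h' => h ((le_sup_right : cyc α ≤ _) h'),
    fun h' => h (cyc_mul_le σ α h')⟩

/-- Linking two components at a vertex loses one component (counted twice), one vertex and one face,
which cancels. -/
theorem defect_swap_mul_of_not (h : ¬ (cyc σ ⊔ cyc α) a b) :
    defect (swap a b * σ) α = defect σ α := by
  obtain ⟨h1, h2, h3⟩ := not_sameCycle_of_not_sup h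
  have e1 := numClasses_swap_mul_of_not h1
  have e2 := numClasses_swap_mul_of_not h3
  have e3 := numClasses_sup_pairSetoid h
  have e4 : cyc (swap a b * σ) ⊔ cyc α = cyc σ ⊔ cyc α ⊔ pairSetoid a b := by
    rw [cyc_swap_mul_of_not h1, sup_right_comm]
  rw [defect, defect, e4, mul_assoc]
  omega

theorem defect_mul_swap_of_not (h : ¬ (cyc σ ⊔ cyc α) a b) :
    defect σ (α * swap a b) = defect σ α := by
  obtain ⟨h1, h2, h3⟩ := not_sameCycle_of_not_sup h
  have e1 := numClasses_mul_swap_of_not h2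
  have e2 := numClasses_mul_swap_of_not h3
  have e3 := numClasses_sup_pairSetoid h
  have e4 : cyc σ ⊔ cyc (α * swap a b) = cyc σ ⊔ cyc α ⊔ pairSetoid a b := by
    rw [cyc_mul_swap_of_not h2, sup_assoc]
  rw [defect, defect, e4, ← mul_assoc]
  omega

theorem sup_cyc_mul_swap (h : α.SameCycle a b) :
    cyc σ ⊔ cyc α = cyc σ ⊔ cyc (α * swap a b) ⊔ pairSetoid a b := by
  rw [sup_assoc, ← cyc_eq_of_sameCycle h]

/-- Splitting a hyperedge does not increase the genus. If it leaves the genus unchanged, then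
either the two parts lie on a common face afterwards, or they are in different components. -/
theorem defect_mul_swap_of_sameCycle (hab : a ≠ b) (h : α.SameCycle a b) :
    defect σ (α * swap a b) ≤ defect σ α ∧
      (defect σ (α * swap a b) = defect σ α → (σ * (α * swap a b)).SameCycle a b ∨
        ¬ (cyc σ ⊔ cyc (α * swap a b)) a b) := by
  have e1 := numClasses_mul_swap_of_sameCycle hab h
  have e4 := sup_cyc_mul_swap (σ := σ) h
  by_cases h' : (σ * α).SameCycle a b
  · have e2 := numClasses_mul_swap_of_sameCycle hab h'
    by_cases h3 : (cyc σ ⊔ cyc (α * swap a b)) a b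
    · rw [sup_pairSetoid_of_rel h3] at e4
      rw [defect, defect, e4, ← mul_assoc]
      exact ⟨by omega, fun h => by omega⟩
    · have e3 := numClasses_sup_pairSetoid h3
      rw [← e4] at e3
      rw [defect, defect, ← mul_assoc]
      exact ⟨by omega, fun _ => Or.inr h3⟩
  · have e2 := numClasses_mul_swap_of_not h'
    have h2 := sameCycle_mul_swap h'
    rw [mul_assoc] at h2
    have h3 : (cyc σ ⊔ cyc (α * swap a b)) a b := cyc_mul_le _ _ h2
    rw [sup_pairSetoid_of_rel h3] at e4
    rw [defect, defect, e4, ← mul_assoc]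
    exact ⟨by omega, fun _ => Or.inl (by rwa [mul_assoc])⟩

/-- Joining within a face costs one hyperedge and splits that face; the components are unchanged. -/
theorem defect_mul_swap_of_sameFace (h1 : ¬ α.SameCycle a b) (h : (σ * α).SameCycle a b) :
    defect σ (α * swap a b) = defect σ α := by
  have hab : a ≠ b := fun h => h1 (h ▸ SameCycle.refl _ _)
  have e1 := numClasses_mul_swap_of_not h1
  have e2 := numClasses_mul_swap_of_sameCycle hab h
  have e4 : cyc σ ⊔ cyc (α * swap a b) = cyc σ ⊔ cyc α := by
    rw [cyc_mul_swap_of_not h1, ← sup_assoc, sup_pairSetoid_of_rel (cyc_mul_le _ _ h)]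
  rw [defect, defect, e4, ← mul_assoc]
  omega

/-- The two transpositions cancel in the product, so the faces stay; two vertices merge while a
hyperedge splits. -/
theorem defect_contract (h1 : ¬ σ.SameCycle a b) (h2 : α.SameCycle a b) :
    defect (σ * swap a b) (swap a b * α) = defect σ α := by
  have hab : a ≠ b := fun h => h1 (h ▸ SameCycle.refl _ _)
  have e1 := numClasses_mul_swap_of_not h1
  have e2 := numClasses_swap_mul_of_sameCycle hab h2
  have e4 : cyc (σ * swap a b) ⊔ cyc (swap a b * α) = cyc σ ⊔ cyc α := by
    rw [cyc_mul_swap_of_not h1, cyc_eq_of_sameCycle' h2, sup_assoc, sup_comm (pairSetoid a b)]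
  have e5 : σ * swap a b * (swap a b * α) = σ * α := by
    rw [mul_assoc, ← mul_assoc (swap a b), swap_mul_self, one_mul]
  rw [defect, defect, e4, e5]
  omega

/-- Cutting a half-edge off its vertex does not increase the genus. -/
theorem defect_detach_le (ha : α a = a) (hσ : σ a ≠ a) :
    defect (swap a (σ a) * σ) α ≤ defect σ α := by
  have h1 : σ.SameCycle a (σ a) := sameCycle_apply_right.2 (SameCycle.refl _ _)
  have h2 : (σ * α).SameCycle a (σ a) := by
    have : σ a = (σ * α) a := by rw [Perm.mul_apply, ha]
    rw [this]
    exact sameCycle_apply_right.2 (SameCycle.refl _ _)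
  have e1 := numClasses_swap_mul_of_sameCycle hσ.symm h1
  have e2 := numClasses_swap_mul_of_sameCycle hσ.symm h2
  have e4 : cyc σ ⊔ cyc α = cyc (swap a (σ a) * σ) ⊔ cyc α ⊔ pairSetoid a (σ a) := by
    rw [sup_right_comm, ← cyc_eq_of_sameCycle' h1]
  by_cases h3 : (cyc (swap a (σ a) * σ) ⊔ cyc α) a (σ a)
  · rw [sup_pairSetoid_of_rel h3] at e4
    rw [defect, defect, e4, mul_assoc]
    omega
  · have e3 := numClasses_sup_pairSetoid h3
    rw [← e4] at e3
    rw [defect, defect, mul_assoc]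
    omega

end Moves

theorem numClasses_le_card [Finite X] (r : Setoid X) : numClasses r ≤ Nat.card X :=
  Nat.card_le_card_of_surjective _ Quotient.mk_surjective

theorem defect_one_right (σ : Perm X) : defect σ 1 = 0 := by
  rw [defect, cyc_one, numClasses_bot, sup_bot_eq, mul_one]
  ring

/-- Splitting hyperedges never increases the defect and ends at `α = 1`, where the defect is zero.
-/
theorem defect_nonneg [Finite X] (σ α : Perm X) : 0 ≤ defect σ α := by
  classical
  induction hn : Nat.card X - numClasses (cyc α) using Nat.strong_induction_on generalizing α with
  | _ n ih =>
    by_cases hα : α = 1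
    · rw [hα, defect_one_right]
    · obtain ⟨a, ha⟩ : ∃ a, α a ≠ a := by
        by_contra! h
        exact hα (Equiv.ext h)
      have h : α.SameCycle a (α a) := sameCycle_apply_right.2 (SameCycle.refl _ _)
      have e1 := numClasses_mul_swap_of_sameCycle ha.symm h
      have e2 := numClasses_le_card (cyc (α * swap a (α a)))
      exact (ih _ (by omega) _ rfl).trans (defect_mul_swap_of_sameCycle ha.symm h).1

/-- Edges are deleted one at a time: each deletion splits a 2-cycle of `α` into two half-edges. -/
theorem defect_le_of_subinvolution [Finite X] (σ : Perm X) {α β : Perm X} (hα : ∀ x, α (α x) = x)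
    (hβ : ∀ x, β (β x) = x) (h : ∀ x, β x = α x ∨ β x = x) : defect σ β ≤ defect σ α := by
  classical
  induction hn : {x | β x ≠ α x}.ncard using Nat.strong_induction_on generalizing α with
  | _ n ih =>
    by_cases hne : ∃ x, β x ≠ α x
    · obtain ⟨x, hx⟩ := hne
      have hβx : β x = x := (h x).resolve_left hx
      have hxy : x ≠ α x := fun he => hx (hβx.trans he)
      have hβy : β (α x) = α x := by
        rcases h (α x) with h1 | h1
        · rw [hα] at h1
          have h2 := hβ (α x)
          rw [h1] at h2
          exact absurd h2 hx
        · exact h1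
      have hsame : α.SameCycle x (α x) := sameCycle_apply_right.2 (SameCycle.refl _ _)
      have hval : ∀ z, (α * swap x (α x)) z = if z = x ∨ z = α x then z else α z := by
        intro z
        rw [Perm.mul_apply]
        split_ifs with hz
        · rcases hz with rfl | rfl
          · rw [swap_apply_left, hα]
          · rw [swap_apply_right]
        · push Not at hz
          rw [swap_apply_of_ne_of_ne hz.1 hz.2]
      refine le_trans (ih _ ?_ (α := α * swap x (α x)) ?_ ?_ rfl)
        (defect_mul_swap_of_sameCycle hxy hsame).1
      · rw [← hn]
        refine Set.ncard_lt_ncard ?_ (Set.toFinite _)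
        refine ⟨fun z hz => ?_, fun hsub => ?_⟩
        · rw [Set.mem_ofPred_eq, hval] at hz
          split_ifs at hz with hz'
          · rcases hz' with rfl | rfl
            · exact hx
            · exact absurd hβy hz
          · exact hz
        · have := hsub (show x ∈ {x | β x ≠ α x} from hx)
          rw [Set.mem_ofPred_eq, hval, if_pos (Or.inl rfl)] at this
          exact this hβx
      · intro z
        rw [hval z]
        split_ifs with hz
        · rw [hval, if_pos hz]
        · rw [hval, if_neg, hα]
          rintro (h1 | h1)
          · exact hz (Or.inr (by rw [← h1, hα]))
          · exact hz (Or.inl (α.injective h1))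
      · intro z
        rw [hval]
        split_ifs with hz
        · rcases hz with rfl | rfl
          · exact Or.inl hβx
          · exact Or.inl hβy
        · exact h z
    · push Not at hne
      rw [Equiv.ext hne]

/-- The unwanted half-edges are cut off their vertices one by one by `defect_detach_le`. Each
becomes a cycle of its own, so the other darts keep their cyclic partition. -/
theorem exists_detach [Finite X] (σ α : Perm X) (N : Set X) (hN : ∀ x ∈ N, α x = x) :
    ∃ τ : Perm X, (∀ x ∈ N, τ x = x) ∧
      (∀ x ∉ N, ∀ y ∉ N, τ.SameCycle x y ↔ σ.SameCycle x y) ∧ defect τ α ≤ defect σ α := by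
  classical
  induction hn : {x ∈ N | σ x ≠ x}.ncard using Nat.strong_induction_on generalizing σ with
  | _ n ih =>
    by_cases hne : ∃ a ∈ N, σ a ≠ a
    · obtain ⟨a, haN, ha⟩ := hne
      have hfix : (swap a (σ a) * σ) a = a := by rw [Perm.mul_apply, swap_apply_right]
      have hlt : {x ∈ N | (swap a (σ a) * σ) x ≠ x}.ncard < n := by
        rw [← hn]
        refine Set.ncard_lt_ncard ?_ (Set.toFinite _)
        refine ⟨fun z hz => ⟨hz.1, fun hz' => hz.2 ?_⟩, fun hsub => ?_⟩
        · have hza : z ≠ a := by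
            rintro rfl
            exact ha hz'
          rw [Perm.mul_apply, hz', swap_apply_of_ne_of_ne hza]
          intro h
          exact hza (σ.injective (hz'.trans h))
        · exact (hsub (show a ∈ {x ∈ N | σ x ≠ x} from ⟨haN, ha⟩)).2 hfix
      obtain ⟨τ, h1, h2, h3⟩ := ih _ hlt (swap a (σ a) * σ) rfl
      refine ⟨τ, h1, fun x hx y hy => ?_, h3.trans (defect_detach_le (hN a haN) ha)⟩
      rw [h2 x hx y hy]
      have hs : σ.SameCycle a (σ a) := sameCycle_apply_right.2 (SameCycle.refl _ _)
      rw [← cyc_apply (π := σ), cyc_eq_of_sameCycle' hs, sup_pairSetoid_iff]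
      constructor
      · exact fun h => Or.inl h
      · have key : ∀ z ∉ N, ¬ (cyc (swap a (σ a) * σ)) z a := by
          intro z hz hza
          exact hz ((SameCycle.eq_of_right hza hfix) ▸ haN)
        rintro (h | ⟨h, -⟩ | ⟨-, h⟩)
        · exact h
        · exact absurd h (key x hx)
        · exact absurd h (key y hy)
    · push Not at hne
      exact ⟨σ, hne, fun _ _ _ _ => Iff.rfl, le_rfl⟩

/-! ### Disjoint unions and transport along bijections. -/

section Sum

/-- The disjoint union of two equivalence relations. -/
def sumSetoid (r : Setoid X) (s : Setoid Y) : Setoid (X ⊕ Y) where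
  r := Sum.LiftRel r s
  iseqv := by
    refine ⟨?_, ?_, ?_⟩
    · rintro (x | x)
      · exact Sum.LiftRel.inl (r.refl' x)
      · exact Sum.LiftRel.inr (s.refl' x)
    · rintro _ _ (h | h)
      · exact Sum.LiftRel.inl (r.symm' h)
      · exact Sum.LiftRel.inr (s.symm' h)
    · rintro _ _ _ (h | h) (h' | h')
      · exact Sum.LiftRel.inl (r.trans' h h')
      · exact Sum.LiftRel.inr (s.trans' h h')

@[simp] theorem sumSetoid_inl_inl {r : Setoid X} {s : Setoid Y} {x y : X} :
    sumSetoid r s (Sum.inl x) (Sum.inl y) ↔ r x y := Sum.liftRel_inl_inl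

@[simp] theorem sumSetoid_inr_inr {r : Setoid X} {s : Setoid Y} {x y : Y} :
    sumSetoid r s (Sum.inr x) (Sum.inr y) ↔ s x y := Sum.liftRel_inr_inr

@[simp] theorem sumSetoid_inl_inr {r : Setoid X} {s : Setoid Y} {x : X} {y : Y} :
    ¬ sumSetoid r s (Sum.inl x) (Sum.inr y) := Sum.not_liftRel_inl_inr

@[simp] theorem sumSetoid_inr_inl {r : Setoid X} {s : Setoid Y} {x : X} {y : Y} :
    ¬ sumSetoid r s (Sum.inr y) (Sum.inl x) := Sum.not_liftRel_inr_inl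

theorem sumSetoid_le {r : Setoid X} {s : Setoid Y} {t : Setoid (X ⊕ Y)} :
    sumSetoid r s ≤ t ↔ r ≤ t.comap Sum.inl ∧ s ≤ t.comap Sum.inr := by
  constructor
  · exact fun h => ⟨fun {x y} hxy => h (sumSetoid_inl_inl.2 hxy),
      fun {x y} hxy => h (sumSetoid_inr_inr.2 hxy)⟩
  · rintro ⟨h1, h2⟩ _ _ (h | h)
    · exact h1 h
    · exact h2 h

theorem sumSetoid_sup (r r' : Setoid X) (s s' : Setoid Y) :
    sumSetoid r s ⊔ sumSetoid r' s' = sumSetoid (r ⊔ r') (s ⊔ s') := by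
  have a1 : sumSetoid r s ≤ sumSetoid r s ⊔ sumSetoid r' s' := le_sup_left
  have a2 : sumSetoid r' s' ≤ sumSetoid r s ⊔ sumSetoid r' s' := le_sup_right
  have b1 : sumSetoid (r ⊔ r') (s ⊔ s') ≤ sumSetoid (r ⊔ r') (s ⊔ s') := le_rfl
  rw [sumSetoid_le] at a1 a2 b1
  exact le_antisymm
    (sup_le (sumSetoid_le.2 ⟨le_sup_left.trans b1.1, le_sup_left.trans b1.2⟩)
      (sumSetoid_le.2 ⟨le_sup_right.trans b1.1, le_sup_right.trans b1.2⟩))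
    (sumSetoid_le.2 ⟨sup_le a1.1 a2.1, sup_le a1.2 a2.2⟩)

theorem numClasses_sumSetoid [Finite X] [Finite Y] (r : Setoid X) (s : Setoid Y) :
    numClasses (sumSetoid r s) = numClasses r + numClasses s := by
  rw [numClasses, numClasses, numClasses, ← Nat.card_sum]
  refine Nat.card_congr ⟨Quotient.lift
    (fun x => Sum.map (Quotient.mk r) (Quotient.mk s) x) ?_, Sum.elim
    (Quotient.map' Sum.inl fun _ _ h => sumSetoid_inl_inl.2 h)
    (Quotient.map' Sum.inr fun _ _ h => sumSetoid_inr_inr.2 h), ?_, ?_⟩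
  · rintro _ _ (h | h)
    · exact congrArg Sum.inl (Quotient.sound h)
    · exact congrArg Sum.inr (Quotient.sound h)
  · intro q
    induction q using Quotient.inductionOn with | _ x
    rcases x with x | x <;> rfl
  · rintro (q | q) <;> induction q using Quotient.inductionOn <;> rfl

theorem cyc_sumCongr (σ : Perm X) (τ : Perm Y) :
    cyc (Perm.sumCongr σ τ) = sumSetoid (cyc σ) (cyc τ) := by
  refine le_antisymm (cyc_le.2 ?_) (sumSetoid_le.2 ⟨cyc_le.2 fun x => ?_, cyc_le.2 fun x => ?_⟩)
  · rintro (x | x)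
    · exact sumSetoid_inl_inl.2 (cyc_le.1 le_rfl x)
    · exact sumSetoid_inr_inr.2 (cyc_le.1 le_rfl x)
  · exact cyc_le.1 (le_refl (cyc (Perm.sumCongr σ τ))) (Sum.inl x)
  · exact cyc_le.1 (le_refl (cyc (Perm.sumCongr σ τ))) (Sum.inr x)

theorem defect_sumCongr [Finite X] [Finite Y] (σ α : Perm X) (τ β : Perm Y) :
    defect (Perm.sumCongr σ τ) (Perm.sumCongr α β) = defect σ α + defect τ β := by
  rw [defect, defect, defect, Perm.sumCongr_mul, cyc_sumCongr, cyc_sumCongr, cyc_sumCongr,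
    sumSetoid_sup]
  simp only [numClasses_sumSetoid, Nat.card_sum]
  push_cast
  ring

theorem numClasses_comap (e : X ≃ Y) (r : Setoid Y) :
    numClasses (r.comap e) = numClasses r :=
  Nat.card_congr (Quotient.congr e fun _ _ => Iff.rfl)

theorem cyc_comap (e : X ≃ Y) {σ : Perm X} {τ : Perm Y} (h : ∀ x, e (σ x) = τ (e x)) :
    cyc σ = (cyc τ).comap e := by
  refine le_antisymm (cyc_le.2 fun x => ?_) fun {x y} hxy => ?_
  · rw [Setoid.comap_rel, h]
    exact cyc_le.1 le_rfl _
  · have : cyc τ ≤ (cyc σ).comap e.symm := cyc_le.2 fun y => by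
      rw [Setoid.comap_rel, show e.symm (τ y) = σ (e.symm y) by
        rw [Equiv.symm_apply_eq, h, Equiv.apply_symm_apply]]
      exact cyc_le.1 le_rfl _
    have h2 := this (show cyc τ (e x) (e y) from hxy)
    rwa [Setoid.comap_rel, e.symm_apply_apply, e.symm_apply_apply] at h2

theorem comap_sup_of_equiv (e : X ≃ Y) (r s : Setoid Y) :
    r.comap e ⊔ s.comap e = (r ⊔ s).comap e := by
  refine le_antisymm (sup_le (fun {x y} h => (le_sup_left : r ≤ r ⊔ s) h)
    (fun {x y} h => (le_sup_right : s ≤ r ⊔ s) h)) fun {x y} h => ?_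
  have : r ⊔ s ≤ (r.comap e ⊔ s.comap e).comap e.symm :=
    sup_le
      (fun {x y} h => (le_sup_left : r.comap e ≤ _)
        (by rwa [Setoid.comap_rel, e.apply_symm_apply, e.apply_symm_apply]))
      (fun {x y} h => (le_sup_right : s.comap e ≤ _)
        (by rwa [Setoid.comap_rel, e.apply_symm_apply, e.apply_symm_apply]))
  have h2 := this (show (r ⊔ s) (e x) (e y) from h)
  rwa [Setoid.comap_rel, e.symm_apply_apply, e.symm_apply_apply] at h2

theorem defect_congr (e : X ≃ Y) {σ α : Perm X} {τ β : Perm Y} (h : ∀ x, e (σ x) = τ (e x))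
    (h' : ∀ x, e (α x) = β (e x)) : defect σ α = defect τ β := by
  have h'' : ∀ x, e ((σ * α) x) = (τ * β) (e x) := fun x => by
    rw [Perm.mul_apply, h, h', Perm.mul_apply]
  rw [defect, defect, cyc_comap e h, cyc_comap e h', cyc_comap e h'', comap_sup_of_equiv]
  simp only [numClasses_comap, Nat.card_congr e]

end Sum

end Hypermap

end RandomPlanar
namespace RandomPlanar

open Equiv Equiv.Perm

/-! ### Spherical maps with spare darts, and graph operations on them. -/

section SphereMap

/-- `σ` and `α` form a map on a disjoint union of spheres in which the edge `u v` of `G` is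
represented by the dart `g u v`. The map may have further darts, vertices and edges. -/
structure IsSphereMap {V X : Type} (G : SimpleGraph V) (σ α : Perm X) (g : V → V → X) : Prop where
  invol : ∀ x, α (α x) = x
  defect_eq : defect σ α = 0
  same : ∀ u v u' v', G.Adj u v → G.Adj u' v' → (σ.SameCycle (g u v) (g u' v') ↔ u = u')
  rev : ∀ u v, G.Adj u v → α (g u v) = g v u

/-- `G` can be drawn as part of a spherical map. -/
def HasSphereMap {V : Type} (G : SimpleGraph V) : Prop :=
  ∃ (X : Type) (_ : Finite X) (σ α : Perm X) (g : V → V → X), IsSphereMap G σ α g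

variable {V U X Y : Type} {G : SimpleGraph V} {J : SimpleGraph U}

/-- No dart has to be removed, since a spherical map may contain superfluous ones; only the dart
assignment `g` is pulled back. -/
theorem HasSphereMap.of_injective {G' : SimpleGraph U} (h : HasSphereMap G) {f : U → V}
    (hf : f.Injective) (hadj : ∀ x y, G'.Adj x y → G.Adj (f x) (f y)) : HasSphereMap G' := by
  obtain ⟨X, hX, σ, α, g, hg⟩ := h
  exact ⟨X, hX, σ, α, fun x y => g (f x) (f y), hg.invol, hg.defect_eq,
    fun u v u' v' h h' => (hg.same _ _ _ _ (hadj _ _ h) (hadj _ _ h')).trans hf.eq_iff,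
    fun u v h => hg.rev _ _ (hadj _ _ h)⟩

theorem HasSphereMap.mono {G' : SimpleGraph V} (h : HasSphereMap G) (hle : G' ≤ G) :
    HasSphereMap G' :=
  h.of_injective Function.injective_id fun _ _ h => hle h

/-- A dart fixed by `α` would also represent the reversed edge, so both ends would coincide. -/
theorem IsSphereMap.ne_of_fixed {σ α : Perm X} {g : V → V → X} (h : IsSphereMap G σ α g)
    {p : X} (hp : α p = p) {u v : V} (huv : G.Adj u v) : g u v ≠ p := by
  rintro rfl
  rw [h.rev u v huv] at hp
  have := (h.same u v v u huv huv.symm).1 (by rw [hp])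
  exact huv.ne this

theorem IsSphereMap.dart_injective {σ α : Perm X} {g : V → V → X} (h : IsSphereMap G σ α g)
    {u v u' v' : V} (h1 : G.Adj u v) (h2 : G.Adj u' v') (he : g u v = g u' v') :
    u = u' ∧ v = v' := by
  refine ⟨(h.same _ _ _ _ h1 h2).1 (by rw [he]), (h.same _ _ _ _ h1.symm h2.symm).1 ?_⟩
  rw [← h.rev _ _ h1, ← h.rev _ _ h2, he]

theorem involutive_mul_swap [DecidableEq X] {α : Perm X} (hα : ∀ x, α (α x) = x) {a b : X}
    (ha : α a = a) (hb : α b = b) (x : X) : (α * swap a b) ((α * swap a b) x) = x := by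
  simp only [Perm.mul_apply]
  rcases eq_or_ne x a with rfl | hxa
  · rw [swap_apply_left, hb, swap_apply_right, ha]
  rcases eq_or_ne x b with rfl | hxb
  · rw [swap_apply_right, ha, swap_apply_left, hb]
  rw [swap_apply_of_ne_of_ne hxa hxb, swap_apply_of_ne_of_ne, hα]
  · intro h
    exact hxa (by rw [← hα x, h, ha])
  · intro h
    exact hxb (by rw [← hα x, h, hb])

theorem defect_unit : defect (1 : Perm Unit) 1 = 0 := defect_one_right 1

section HalfEdge

variable [DecidableEq X] [Finite X] {σ α : Perm X} {g : V → V → X}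

/-- A new half-edge can be inserted next to any dart. -/
theorem IsSphereMap.addHalfEdge (h : IsSphereMap G σ α g) (x : X) :
    ∃ σ' α' : Perm (X ⊕ Unit), IsSphereMap G σ' α' (fun u v => Sum.inl (g u v)) ∧
      (∀ y, α' (Sum.inl y) = Sum.inl (α y)) ∧ α' (Sum.inr ()) = Sum.inr () ∧
      (∀ y z, σ'.SameCycle (Sum.inl y) (Sum.inl z) ↔ σ.SameCycle y z) ∧
      (∀ y, σ'.SameCycle (Sum.inr ()) (Sum.inl y) ↔ σ.SameCycle x y) ∧
      (σ' * α').SameCycle (Sum.inr ()) (Sum.inl x) := by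
  have hsup : ¬ (cyc (Perm.sumCongr σ (1 : Perm Unit)) ⊔ cyc (Perm.sumCongr α (1 : Perm Unit)))
      (Sum.inl x) (Sum.inr ()) := by
    rw [cyc_sumCongr, cyc_sumCongr, sumSetoid_sup]
    simp
  have hns := not_sameCycle_of_not_sup hsup
  have hcyc := cyc_swap_mul_of_not hns.1
  rw [cyc_sumCongr] at hcyc
  have h1 : ∀ y z, (swap (Sum.inl x) (Sum.inr ()) * Perm.sumCongr σ (1 : Perm Unit)).SameCycle
      (Sum.inl y) (Sum.inl z) ↔ σ.SameCycle y z := by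
    intro y z
    rw [← cyc_apply, hcyc, sup_pairSetoid_iff]
    simp [cyc_apply]
  -- The new dart starts as a component of its own, and the transposition inserts it into the vertex
  -- cycle of `x`, hence also into the face cycle of `x`.
  refine ⟨swap (Sum.inl x) (Sum.inr ()) * Perm.sumCongr σ 1, Perm.sumCongr α 1,
    ⟨?_, ?_, ?_, ?_⟩, fun y => rfl, rfl, h1, ?_, ?_⟩
  · rintro (y | y)
    · exact congrArg Sum.inl (h.invol y)
    · rfl
  · rw [defect_swap_mul_of_not hsup, defect_sumCongr, h.defect_eq, defect_unit, add_zero]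
  · intro u v u' v' huv huv'
    rw [h1, h.same _ _ _ _ huv huv']
  · intro u v huv
    exact congrArg Sum.inl (h.rev u v huv)
  · intro y
    rw [← cyc_apply, hcyc, sup_pairSetoid_iff]
    simp only [sumSetoid_inr_inl, sumSetoid_inr_inr, sumSetoid_inl_inl, false_and, false_or,
      cyc_apply]
    simp [SameCycle.refl, sameCycle_comm]
  · rw [mul_assoc, ← cyc_apply, cyc_swap_mul_of_not hns.2.2, sup_pairSetoid_iff]
    exact Or.inr (Or.inr ⟨Setoid.refl' _ _, Setoid.refl' _ _⟩)

end HalfEdge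

/-- Every vertex of a planar graph can be given a new half-edge. -/
theorem HasSphereMap.exists_pointed (h : HasSphereMap G) (a : V) :
    ∃ (X : Type) (_ : Finite X) (σ α : Perm X) (g : V → V → X) (p : X), IsSphereMap G σ α g ∧
      α p = p ∧ ∀ u v, G.Adj u v → (σ.SameCycle p (g u v) ↔ u = a) := by
  classical
  obtain ⟨X, hX, σ, α, g, hg⟩ := h
  by_cases hw : ∃ w, G.Adj a w
  · obtain ⟨w, hw⟩ := hw
    obtain ⟨σ', α', h1, h2, h3, h4, h5, h6⟩ := hg.addHalfEdge (g a w)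
    refine ⟨X ⊕ Unit, inferInstance, σ', α', _, Sum.inr (), h1, h3, fun u v huv => ?_⟩
    rw [h5, hg.same _ _ _ _ hw huv, eq_comm]
  · push Not at hw
    refine ⟨X ⊕ Unit, inferInstance, Perm.sumCongr σ 1, Perm.sumCongr α 1,
      fun u v => Sum.inl (g u v), Sum.inr (), ⟨?_, ?_, ?_, ?_⟩, rfl, ?_⟩
    · rintro (y | y)
      · exact congrArg Sum.inl (hg.invol y)
      · rfl
    · rw [defect_sumCongr, hg.defect_eq, defect_unit, add_zero]
    · intro u v u' v' huv huv'
      rw [← cyc_apply, cyc_sumCongr, sumSetoid_inl_inl]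
      exact hg.same _ _ _ _ huv huv'
    · intro u v huv
      exact congrArg Sum.inl (hg.rev u v huv)
    · intro u v huv
      rw [← cyc_apply, cyc_sumCongr]
      simp only [sumSetoid_inr_inl, false_iff]
      rintro rfl
      exact hw _ huv

/-- Every vertex of a planar graph can be given two new consecutive half-edges. -/
theorem HasSphereMap.exists_pointed₂ (h : HasSphereMap G) (a : V) :
    ∃ (X : Type) (_ : Finite X) (σ α : Perm X) (g : V → V → X) (p q : X), IsSphereMap G σ α g ∧
      α p = p ∧ α q = q ∧ p ≠ q ∧ σ.SameCycle p q ∧ (σ * α).SameCycle p q ∧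
      ∀ u v, G.Adj u v → (σ.SameCycle p (g u v) ↔ u = a) := by
  classical
  obtain ⟨X, hX, σ, α, g, p, hg, hp, hpa⟩ := h.exists_pointed a
  obtain ⟨σ', α', h1, h2, h3, h4, h5, h6⟩ := hg.addHalfEdge p
  refine ⟨X ⊕ Unit, inferInstance, σ', α', _, Sum.inl p, Sum.inr (), h1, by rw [h2, hp], h3,
    Sum.inl_ne_inr, ((h5 p).2 (SameCycle.refl _ _)).symm, h6.symm, fun u v huv => ?_⟩
  rw [h4, hpa u v huv]

/-- The graph obtained from the disjoint union of `G` and `J` by replacing the edge `e = v w` of `G`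
by a path `v c w` through the vertex `c` of `J`. If `e` is a loop at `v`, this is the disjoint union
with the edge `v c` added. -/
def insertBlock (G : SimpleGraph V) (J : SimpleGraph U) (e : Sym2 V) (c : U) :
    SimpleGraph (V ⊕ U) where
  Adj
    | .inl x, .inl y => G.Adj x y ∧ s(x, y) ≠ e
    | .inr x, .inr y => J.Adj x y
    | .inl x, .inr y => x ∈ e ∧ y = c
    | .inr y, .inl x => x ∈ e ∧ y = c
  symm := ⟨by
    rintro (x | x) (y | y) h
    · exact ⟨h.1.symm, by rw [Sym2.eq_swap]; exact h.2⟩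
    · exact h
    · exact h
    · exact SimpleGraph.Adj.symm h⟩
  loopless := ⟨by
    rintro (x | x) h
    · exact G.loopless.irrefl x h.1
    · exact J.loopless.irrefl x h⟩

@[simp] theorem insertBlock_inl_inl {e : Sym2 V} {c : U} {x y : V} :
    (insertBlock G J e c).Adj (Sum.inl x) (Sum.inl y) ↔ G.Adj x y ∧ s(x, y) ≠ e := Iff.rfl

@[simp] theorem insertBlock_inr_inr {e : Sym2 V} {c : U} {x y : U} :
    (insertBlock G J e c).Adj (Sum.inr x) (Sum.inr y) ↔ J.Adj x y := Iff.rfl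

@[simp] theorem insertBlock_inl_inr {e : Sym2 V} {c : U} {x : V} {y : U} :
    (insertBlock G J e c).Adj (Sum.inl x) (Sum.inr y) ↔ x ∈ e ∧ y = c := Iff.rfl

@[simp] theorem insertBlock_inr_inl {e : Sym2 V} {c : U} {x : V} {y : U} :
    (insertBlock G J e c).Adj (Sum.inr y) (Sum.inl x) ↔ x ∈ e ∧ y = c := Iff.rfl

/-- Half-edges added at `v` and at `c` lie in different components of the disjoint union; joining
them to an edge does not change the genus. -/
theorem HasSphereMap.insertBlock_diag (hG : HasSphereMap G) (hJ : HasSphereMap J) (v : V) (c : U) :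
    HasSphereMap (insertBlock G J s(v, v) c) := by
  classical
  obtain ⟨X, hX, σ, α, g, p, hg, hp, hpa⟩ := hG.exists_pointed v
  obtain ⟨Y, hY, τ, β, k, q, hk, hq, hqc⟩ := hJ.exists_pointed c
  have hinv : ∀ x, Perm.sumCongr α β (Perm.sumCongr α β x) = x := by
    rintro (x | x)
    · exact congrArg Sum.inl (hg.invol x)
    · exact congrArg Sum.inr (hk.invol x)
  have hsup : ¬ (cyc (Perm.sumCongr σ τ) ⊔ cyc (Perm.sumCongr α β)) (Sum.inl p) (Sum.inr q) := by
    rw [cyc_sumCongr, cyc_sumCongr, sumSetoid_sup]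
    simp
  refine ⟨X ⊕ Y, inferInstance, Perm.sumCongr σ τ, Perm.sumCongr α β * swap (Sum.inl p) (Sum.inr q),
    fun
      | .inl x, .inl y => Sum.inl (g x y)
      | .inr x, .inr y => Sum.inr (k x y)
      | .inl _, .inr _ => Sum.inl p
      | .inr _, .inl _ => Sum.inr q,
    involutive_mul_swap hinv (congrArg Sum.inl hp) (congrArg Sum.inr hq), ?_, ?_, ?_⟩
  · rw [defect_mul_swap_of_not hsup, defect_sumCongr, hg.defect_eq, hk.defect_eq, add_zero]
  · rw [← forall_congr' fun _ => forall_congr' fun _ => forall_congr' fun _ =>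
      forall_congr' fun _ => by rw [← cyc_apply, cyc_sumCongr]]
    rintro (x | x) (y | y) (x' | x') (y' | y') h h' <;>
      simp only [insertBlock_inl_inl, insertBlock_inl_inr, insertBlock_inr_inl,
        insertBlock_inr_inr, Sym2.mem_iff, or_self] at h h' <;>
      simp only [sumSetoid_inl_inl, sumSetoid_inr_inr, sumSetoid_inl_inr, sumSetoid_inr_inl,
        cyc_apply, Sum.inl.injEq, Sum.inr.injEq, reduceCtorEq]
    · exact hg.same _ _ _ _ h.1 h'.1
    · rw [sameCycle_comm, hpa _ _ h.1, h'.1]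
    · rw [hpa _ _ h'.1, h.1, eq_comm]
    · rw [h.1, h'.1]; simp [SameCycle.refl]
    · rw [h.2, h'.2]; simp [SameCycle.refl]
    · rw [hqc _ _ h', h.2, eq_comm]
    · rw [sameCycle_comm, hqc _ _ h, h'.2]
    · exact hk.same _ _ _ _ h h'
  · rintro (x | x) (y | y) h <;>
      simp only [insertBlock_inl_inl, insertBlock_inl_inr, insertBlock_inr_inl,
        insertBlock_inr_inr, Sym2.mem_iff, or_self] at h <;>
      simp only [Perm.mul_apply, swap_apply_left, swap_apply_right]
    · rw [swap_apply_of_ne_of_ne (fun he => hg.ne_of_fixed hp h.1 (Sum.inl_injective he))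
        Sum.inl_ne_inr]
      exact congrArg Sum.inl (hg.rev _ _ h.1)
    · exact congrArg Sum.inr hq
    · exact congrArg Sum.inl hp
    · rw [swap_apply_of_ne_of_ne Sum.inr_ne_inl
        (fun he => hk.ne_of_fixed hq h (Sum.inr_injective he))]
      exact congrArg Sum.inr (hk.rev _ _ h)

/-- The edge `v w` is cut into half-edges `a`, `b`, which are then joined to two half-edges `p`, `q`
at `c`. Choosing `p` and `q` on a common face is what keeps the second join planar. -/
theorem HasSphereMap.insertBlock_edge (hG : HasSphereMap G) (hJ : HasSphereMap J) {v w : V}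
    (hvw : G.Adj v w) (c : U) : HasSphereMap (insertBlock G J s(v, w) c) := by
  classical
  obtain ⟨X, hX, σ, α, g, hg⟩ := hG
  obtain ⟨Y, hY, τ, β, k, p, q, hk, hp, hq, hpq, hst, hft, hpc⟩ := hJ.exists_pointed₂ c
  set a := g v w with ha
  set b := g w v with hb
  have hαa : α a = b := hg.rev _ _ hvw
  have hαb : α b = a := hg.rev _ _ hvw.symm
  have hab : a ≠ b := fun h => hvw.ne (hg.dart_injective hvw hvw.symm h).1
  have hsab : α.SameCycle a b := hαa ▸ sameCycle_apply_right.2 (SameCycle.refl _ _)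
  obtain ⟨hle, hcase⟩ := defect_mul_swap_of_sameCycle (σ := σ) hab hsab
  set α₁ := α * swap a b with hα₁
  have hd₁ : defect σ α₁ = 0 := le_antisymm (hle.trans_eq hg.defect_eq) (defect_nonneg _ _)
  replace hcase := hcase (by rw [hd₁, hg.defect_eq])
  have h₁a : α₁ a = a := by rw [hα₁, Perm.mul_apply, swap_apply_left, hαb]
  have h₁b : α₁ b = b := by rw [hα₁, Perm.mul_apply, swap_apply_right, hαa]
  have h₁o : ∀ x, x ≠ a → x ≠ b → α₁ x = α x := fun x h1 h2 => by
    rw [hα₁, Perm.mul_apply, swap_apply_of_ne_of_ne h1 h2]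
  have hinv₁ : ∀ x, α₁ (α₁ x) = x := by
    intro x
    rcases eq_or_ne x a with rfl | hxa
    · rw [h₁a, h₁a]
    rcases eq_or_ne x b with rfl | hxb
    · rw [h₁b, h₁b]
    rw [h₁o x hxa hxb, h₁o, hg.invol]
    · intro h
      exact hxb (by rw [← hg.invol x, h, hαa])
    · intro h
      exact hxa (by rw [← hg.invol x, h, hαb])
  set σ₂ := Perm.sumCongr σ τ with hσ₂
  set α₂ := Perm.sumCongr α₁ β with hα₂
  have hinv₂ : ∀ x, α₂ (α₂ x) = x := by
    rintro (x | x)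
    · exact congrArg Sum.inl (hinv₁ x)
    · exact congrArg Sum.inr (hk.invol x)
  have hd₂ : defect σ₂ α₂ = 0 := by rw [hσ₂, hα₂, defect_sumCongr, hd₁, hk.defect_eq, add_zero]
  have horb₂ : cyc σ₂ ⊔ cyc α₂ = sumSetoid (cyc σ ⊔ cyc α₁) (cyc τ ⊔ cyc β) := by
    rw [hσ₂, hα₂, cyc_sumCongr, cyc_sumCongr, sumSetoid_sup]
  have hface₂ : cyc (σ₂ * α₂) = sumSetoid (cyc (σ * α₁)) (cyc (τ * β)) := by
    rw [hσ₂, hα₂, Perm.sumCongr_mul, cyc_sumCongr]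
  have hsup₂ : ¬ (cyc σ₂ ⊔ cyc α₂) (Sum.inl a) (Sum.inr p) := by
    rw [horb₂]; simp
  have hns := not_sameCycle_of_not_sup hsup₂
  set α₃ := α₂ * swap (Sum.inl a) (Sum.inr p) with hα₃
  have hd₃ : defect σ₂ α₃ = 0 := by rw [hα₃, defect_mul_swap_of_not hsup₂, hd₂]
  have h₂a : α₂ (Sum.inl a) = Sum.inl a := congrArg Sum.inl h₁a
  have h₂b : α₂ (Sum.inl b) = Sum.inl b := congrArg Sum.inl h₁b
  have h₂p : α₂ (Sum.inr p) = Sum.inr p := congrArg Sum.inr hp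
  have h₂q : α₂ (Sum.inr q) = Sum.inr q := congrArg Sum.inr hq
  have hinv₃ := involutive_mul_swap hinv₂ h₂a h₂p
  have h₃o : ∀ x, x ≠ Sum.inl a → x ≠ Sum.inr p → α₃ x = α₂ x := fun x h1 h2 => by
    rw [hα₃, Perm.mul_apply, swap_apply_of_ne_of_ne h1 h2]
  have h₃b : α₃ (Sum.inl b) = Sum.inl b := by
    rw [h₃o _ (fun h => hab (Sum.inl_injective h).symm) Sum.inl_ne_inr, h₂b]
  have h₃q : α₃ (Sum.inr q) = Sum.inr q := by
    rw [h₃o _ Sum.inr_ne_inl (fun h => hpq (Sum.inr_injective h).symm), h₂q]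
  have h₃a : α₃ (Sum.inl a) = Sum.inr p := by
    rw [hα₃, Perm.mul_apply, swap_apply_left, h₂p]
  have h₃p : α₃ (Sum.inr p) = Sum.inl a := by
    rw [hα₃, Perm.mul_apply, swap_apply_right, h₂a]
  -- If cutting the edge left `a` and `b` on one face, the first join merged that face with the face
  -- of `p` and `q`, so the second join runs inside a face. Otherwise the cut separated `a` from
  -- `b`, and the second join links two components.
  have hd₄ : defect σ₂ (α₃ * swap (Sum.inl b) (Sum.inr q)) = 0 := by
    rcases hcase with hface | hcomp
    · rw [defect_mul_swap_of_sameFace, hd₃]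
      · intro h
        exact absurd (SameCycle.eq_of_left h h₃b) Sum.inl_ne_inr
      · rw [hα₃, ← mul_assoc, ← cyc_apply, cyc_mul_swap_of_not hns.2.2, sup_pairSetoid_iff, hface₂]
        exact Or.inr (Or.inl ⟨sumSetoid_inl_inl.2 hface.symm, sumSetoid_inr_inr.2 hft.symm⟩)
    · rw [defect_mul_swap_of_not, hd₃]
      rw [hα₃, cyc_mul_swap_of_not hns.2.1, ← sup_assoc, horb₂, sup_pairSetoid_iff]
      simp only [sumSetoid_inl_inr, false_or, sumSetoid_inl_inl, false_and, or_false, not_and]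
      exact fun h => absurd (Setoid.symm' _ h) hcomp
  refine ⟨X ⊕ Y, inferInstance, σ₂, α₃ * swap (Sum.inl b) (Sum.inr q),
    fun
      | .inl x, .inl y => Sum.inl (g x y)
      | .inr x, .inr y => Sum.inr (k x y)
      | .inl x, .inr _ => if x = v then Sum.inl a else Sum.inl b
      | .inr _, .inl x => if x = v then Sum.inr p else Sum.inr q,
    involutive_mul_swap hinv₃ h₃b h₃q, hd₄, ?_, ?_⟩
  · have hlab : ∀ x : V, x = v ∨ x = w → ∀ x' y', G.Adj x' y' →
        (σ.SameCycle (if x = v then a else b) (g x' y') ↔ x = x') := by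
      rintro x hx x' y' h
      split_ifs with hxv
      · rw [hg.same _ _ _ _ hvw h, hxv]
      · rw [hg.same _ _ _ _ hvw.symm h, hx.resolve_left hxv]
    have hlab' : ∀ x : V, x = v ∨ x = w → ∀ x', x' = v ∨ x' = w →
        (σ.SameCycle (if x = v then a else b) (if x' = v then a else b) ↔ x = x') := by
      rintro x hx x' hx'
      split_ifs with h1 h2 h2
      · rw [h1, h2]; simp [SameCycle.refl]
      · rw [hg.same _ _ _ _ hvw hvw.symm, h1, hx'.resolve_left h2]
      · rw [hg.same _ _ _ _ hvw.symm hvw, h2, hx.resolve_left h1]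
      · rw [hx.resolve_left h1, hx'.resolve_left h2]; simp [SameCycle.refl]
    have hlabq : ∀ x : V, ∀ u u' : U, J.Adj u u' →
        (τ.SameCycle (if x = v then p else q) (k u u') ↔ u = c) := by
      intro x u u' h
      split_ifs
      · exact hpc _ _ h
      · rw [← hpc _ _ h]
        exact ⟨hst.trans, hst.symm.trans⟩
    have hlabq' : ∀ x x' : V, τ.SameCycle (if x = v then p else q) (if x' = v then p else q) := by
      intro x x'
      split_ifs
      · exact SameCycle.refl _ _
      · exact hst
      · exact hst.symm
      · exact SameCycle.refl _ _
    rw [← forall_congr' fun _ => forall_congr' fun _ => forall_congr' fun _ =>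
      forall_congr' fun _ => by rw [← cyc_apply, hσ₂, cyc_sumCongr]]
    rintro (x | x) (y | y) (x' | x') (y' | y') h h' <;>
      simp only [insertBlock_inl_inl, insertBlock_inl_inr, insertBlock_inr_inl,
        insertBlock_inr_inr, Sym2.mem_iff] at h h' <;>
      simp only [← apply_ite (Sum.inl (β := Y)), ← apply_ite (Sum.inr (α := X)),
        sumSetoid_inl_inl, sumSetoid_inr_inr, sumSetoid_inl_inr, sumSetoid_inr_inl,
        cyc_apply, Sum.inl.injEq, Sum.inr.injEq, reduceCtorEq]
    · exact hg.same _ _ _ _ h.1 h'.1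
    · rw [sameCycle_comm, hlab _ h'.1 _ _ h.1, eq_comm]
    · exact hlab _ h.1 _ _ h'.1
    · exact hlab' _ h.1 _ h'.1
    · rw [h.2, h'.2]; simp [hlabq']
    · rw [hlabq _ _ _ h', h.2, eq_comm]
    · rw [sameCycle_comm, hlabq _ _ _ h, h'.2]
    · exact hk.same _ _ _ _ h h'
  · have hne : ∀ x y, G.Adj x y → s(x, y) ≠ s(v, w) → g x y ≠ a ∧ g x y ≠ b := by
      intro x y h he
      constructor
      · intro h'
        obtain ⟨rfl, rfl⟩ := hg.dart_injective h hvw h'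
        exact he rfl
      · intro h'
        obtain ⟨rfl, rfl⟩ := hg.dart_injective h hvw.symm h'
        exact he Sym2.eq_swap
    rintro (x | x) (y | y) h <;>
      simp only [insertBlock_inl_inl, insertBlock_inl_inr, insertBlock_inr_inl,
        insertBlock_inr_inr, Sym2.mem_iff] at h <;>
      simp only [Perm.mul_apply]
    · obtain ⟨h1, h2⟩ := hne x y h.1 h.2
      rw [swap_apply_of_ne_of_ne (fun he => h2 (Sum.inl_injective he)) Sum.inl_ne_inr,
        h₃o _ (fun he => h1 (Sum.inl_injective he)) Sum.inl_ne_inr]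
      refine congrArg Sum.inl ?_
      rw [h₁o _ h1 h2, hg.rev _ _ h.1]
    · split_ifs
      · rw [swap_apply_of_ne_of_ne (fun he => hab (Sum.inl_injective he)) Sum.inl_ne_inr, h₃a]
      · rw [swap_apply_left, h₃q]
    · split_ifs
      · rw [swap_apply_of_ne_of_ne Sum.inr_ne_inl (fun he => hpq (Sum.inr_injective he)), h₃p]
      · rw [swap_apply_right, h₃b]
    · rw [swap_apply_of_ne_of_ne Sum.inr_ne_inl (fun he => hk.ne_of_fixed hq h (Sum.inr_injective he)),
        h₃o _ Sum.inr_ne_inl (fun he => hk.ne_of_fixed hp h (Sum.inr_injective he))]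
      exact congrArg Sum.inr (hk.rev _ _ h)

/-- The graph obtained by contracting `v` into `u`; the vertex `v` stays as an isolated vertex. -/
def contract (G : SimpleGraph V) (v u : V) : SimpleGraph V where
  Adj x y := x ≠ y ∧ x ≠ v ∧ y ≠ v ∧ (G.Adj x y ∨ (x = u ∧ G.Adj v y) ∨ (y = u ∧ G.Adj v x))
  symm := ⟨by
    rintro x y ⟨h1, h2, h3, h⟩
    exact ⟨h1.symm, h3, h2, by rwa [G.adj_comm, or_comm (a := y = u ∧ _)]⟩⟩
  loopless := ⟨fun x h => h.1 rfl⟩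

/-- `defect_contract` merges the cycles of the two ends. Parallel edges may result; one
representative is selected for each adjacent pair and the others remain as spare darts. -/
theorem HasSphereMap.contract (hG : HasSphereMap G) {v u : V} (h : G.Adj v u) :
    HasSphereMap (contract G v u) := by
  classical
  obtain ⟨X, hX, σ, α, g, hg⟩ := hG
  set a := g u v with ha
  set b := g v u with hb
  have hαa : α a = b := hg.rev _ _ h.symm
  have hαb : α b = a := hg.rev _ _ h
  have hns : ¬ σ.SameCycle a b := by
    rw [hg.same _ _ _ _ h.symm h]
    exact h.ne'
  have hsab : α.SameCycle a b := hαa ▸ sameCycle_apply_right.2 (SameCycle.refl _ _)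
  -- An old edge `x y` keeps its dart; only an edge created by the contraction borrows a dart of an
  -- edge at `v`. The choice is symmetric in `x` and `y`, so reversal is respected.
  let g' : V → V → X := fun x y => if G.Adj x y then g x y else if x = u then g v y else g x v
  have hval : ∀ x, (swap a b * α) x = if x = a ∨ x = b then x else α x := by
    intro x
    rw [Perm.mul_apply]
    split_ifs with hx
    · rcases hx with rfl | rfl
      · rw [hαa, swap_apply_right]
      · rw [hαb, swap_apply_left]
    · push Not at hx
      refine swap_apply_of_ne_of_ne (fun h' => hx.2 ?_) (fun h' => hx.1 ?_)
      · rw [← hg.invol x, h', hαa]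
      · rw [← hg.invol x, h', hαb]
  have hspec : ∀ x y, (RandomPlanar.contract G v u).Adj x y → ∃ x' y', G.Adj x' y' ∧
      g' x y = g x' y' ∧ g' y x = g y' x' ∧ (x' = x ∨ x' = v ∧ x = u) ∧
      (y' = y ∨ y' = v ∧ y = u) := by
    rintro x y ⟨hxy, hxv, hyv, h1⟩
    by_cases hadj : G.Adj x y
    · exact ⟨x, y, hadj, if_pos hadj, if_pos hadj.symm, Or.inl rfl, Or.inl rfl⟩
    · rcases h1 with h1 | ⟨rfl, h1⟩ | ⟨rfl, h1⟩
      · exact absurd h1 hadj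
      · refine ⟨v, y, h1, ?_, ?_, Or.inr ⟨rfl, rfl⟩, Or.inl rfl⟩
        · simp only [g', if_neg hadj, if_pos]
        · simp only [g', if_neg (fun h' => hadj (SimpleGraph.Adj.symm h')), if_neg hxy.symm]
      · refine ⟨x, v, h1.symm, ?_, ?_, Or.inl rfl, Or.inr ⟨rfl, rfl⟩⟩
        · simp only [g', if_neg hadj, if_neg hxy]
        · simp only [g', if_neg (fun h' => hadj (SimpleGraph.Adj.symm h')), if_pos]
  have hσ' : ∀ x y z w, G.Adj x y → G.Adj z w → ((σ * swap a b).SameCycle (g x y) (g z w) ↔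
      x = z ∨ (x = u ∧ z = v) ∨ (x = v ∧ z = u)) := by
    intro x y z w hxy hzw
    rw [← cyc_apply, cyc_mul_swap_of_not hns, sup_pairSetoid_iff]
    simp only [cyc_apply]
    rw [hg.same _ _ _ _ hxy hzw, hg.same _ _ _ _ hxy h.symm, hg.same _ _ _ _ hzw h,
      hg.same _ _ _ _ hxy h, hg.same _ _ _ _ hzw h.symm]
  refine ⟨X, hX, σ * swap a b, swap a b * α, g', ?_, ?_, ?_, ?_⟩
  · intro x
    rw [hval x]
    split_ifs with hx
    · rw [hval, if_pos hx]
    · rw [hval, if_neg, hg.invol]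
      push Not at hx
      rintro (h' | h')
      · exact hx.2 (by rw [← hg.invol x, h', hαa])
      · exact hx.1 (by rw [← hg.invol x, h', hαb])
  · rw [defect_contract hns hsab, hg.defect_eq]
  · intro x y z w hxy hzw
    obtain ⟨x', y', h1, h2, -, h3, -⟩ := hspec x y hxy
    obtain ⟨z', w', k1, k2, -, k3, -⟩ := hspec z w hzw
    rw [h2, k2, hσ' _ _ _ _ h1 k1]
    have := hxy.2.1
    have := hzw.2.1
    have := h.ne
    grind
  · intro x y hxy
    obtain ⟨x', y', h1, h2, h2', h3, h4⟩ := hspec x y hxy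
    rw [h2, h2', hval, if_neg, hg.rev _ _ h1]
    have := hxy.1
    have := hxy.2.1
    have := hxy.2.2.1
    rintro (h' | h')
    · obtain ⟨e1, e2⟩ := hg.dart_injective h1 h.symm h'
      grind
    · obtain ⟨e1, e2⟩ := hg.dart_injective h1 h h'
      grind

end SphereMap

end RandomPlanar
namespace RandomPlanar

open Equiv Equiv.Perm

/-! ### Equivalence of planarity with spherical maps. -/

section Darts

variable {V : Type} {G : SimpleGraph V}

/-- The permutation of the darts of `G` that reverses every dart. -/
def dartRev (G : SimpleGraph V) : Perm G.Dart := SimpleGraph.Dart.symm_involutive.toPerm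

@[simp] theorem dartRev_apply (a : G.Dart) : dartRev G a = a.symm := rfl

theorem sameCycle_dartRev {a b : G.Dart} : (dartRev G).SameCycle a b ↔ a.edge = b.edge := by
  rw [SimpleGraph.dart_edge_eq_iff]
  constructor
  · intro h
    have : cyc (dartRev G) ≤ Setoid.ker SimpleGraph.Dart.edge :=
      cyc_le.2 fun x => (SimpleGraph.dart_edge_eq_iff _ _).2 (Or.inr (by simp))
    exact (SimpleGraph.dart_edge_eq_iff _ _).1 (this h)
  · rintro (rfl | rfl)
    · exact SameCycle.refl _ _
    · exact (sameCycle_apply_right (f := dartRev G)).2 (SameCycle.refl _ _) |>.symm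

variable [Finite V]

instance : Finite G.Dart := Finite.of_injective _ (SimpleGraph.Dart.toProd_injective)

theorem numClasses_dartRev : numClasses (cyc (dartRev G)) = G.edgeSet.ncard := by
  have h : cyc (dartRev G) = Setoid.ker fun a : G.Dart => (⟨a.edge, a.edge_mem⟩ : G.edgeSet) := by
    ext a b
    rw [cyc_apply, sameCycle_dartRev, Setoid.ker_def, Subtype.mk.injEq]
  rw [h, numClasses, ← Nat.card_coe_set_eq]
  refine Nat.card_congr (Setoid.quotientKerEquivOfSurjective _ ?_)
  rintro ⟨e, he⟩
  induction e using Sym2.ind with | _ u v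
  exact ⟨⟨(u, v), he⟩, rfl⟩

theorem card_dart : Nat.card G.Dart = 2 * G.edgeSet.ncard := by
  classical
  have := Fintype.ofFinite V
  rw [Nat.card_eq_fintype_card, SimpleGraph.dart_card_eq_twice_card_edges,
    Set.ncard_eq_toFinset_card', SimpleGraph.edgeFinset]

theorem numClasses_rotation {σ : Perm G.Dart} (hσ : IsRotationSystem G σ) :
    numClasses (cyc σ) + {v : V | ∀ w, ¬ G.Adj v w}.ncard = Nat.card V := by
  have h : cyc σ = Setoid.ker fun a : G.Dart =>
      (⟨a.fst, ⟨a.snd, a.adj⟩⟩ : {v : V | ∃ w, G.Adj v w}) := by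
    ext a b
    rw [cyc_apply, hσ, Setoid.ker_def, Subtype.mk.injEq]
  have h2 : {v : V | ∀ w, ¬ G.Adj v w} = {v : V | ∃ w, G.Adj v w}ᶜ := by
    ext v; simp
  rw [h, numClasses, h2, ← Set.ncard_add_ncard_compl {v : V | ∃ w, G.Adj v w},
    ← Nat.card_coe_set_eq {v : V | ∃ w, G.Adj v w}]
  congr 1
  refine Nat.card_congr (Setoid.quotientKerEquivOfSurjective _ ?_)
  rintro ⟨v, w, hvw⟩
  exact ⟨⟨(v, w), hvw⟩, rfl⟩

theorem sup_rel_iff_reachable {σ : Perm G.Dart} (hσ : IsRotationSystem G σ) {a b : G.Dart} :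
    (cyc σ ⊔ cyc (dartRev G)) a b ↔ G.Reachable a.fst b.fst := by
  constructor
  · intro h
    have : cyc σ ⊔ cyc (dartRev G) ≤
        Setoid.ker fun a : G.Dart => G.connectedComponentMk a.fst := by
      refine sup_le (fun {x y} hxy => ?_) (cyc_le.2 fun x => ?_)
      · rw [Setoid.ker_def, (hσ x y).1 hxy]
      · rw [Setoid.ker_def]
        exact SimpleGraph.ConnectedComponent.sound x.adj.reachable
    exact SimpleGraph.ConnectedComponent.exact (this h)
  · rintro ⟨p⟩
    have key : ∀ (u v : V) (p : G.Walk u v) (a b : G.Dart), a.fst = u → b.fst = v →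
        (cyc σ ⊔ cyc (dartRev G)) a b := by
      intro u v p
      induction p with
      | nil =>
        intro a b ha hb
        exact (le_sup_left : cyc σ ≤ _) ((hσ a b).2 (ha.trans hb.symm))
      | @cons u w v h p ih =>
        intro a b ha hb
        have h1 : (cyc σ ⊔ cyc (dartRev G)) a ⟨(u, w), h⟩ :=
          (le_sup_left : cyc σ ≤ _) ((hσ a ⟨(u, w), h⟩).2 ha)
        have h2 : (cyc σ ⊔ cyc (dartRev G)) ⟨(u, w), h⟩ ⟨(w, u), h.symm⟩ :=
          (le_sup_right : cyc (dartRev G) ≤ _) (cyc_le.1 (le_refl (cyc (dartRev G))) _)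
        exact Setoid.trans' _ h1 (Setoid.trans' _ h2 (ih _ b rfl hb))
    exact key _ _ p a b rfl rfl

theorem numClasses_sup_rotation {σ : Perm G.Dart} (hσ : IsRotationSystem G σ) :
    numClasses (cyc σ ⊔ cyc (dartRev G)) + {v : V | ∀ w, ¬ G.Adj v w}.ncard =
      Nat.card G.ConnectedComponent := by
  have h : cyc σ ⊔ cyc (dartRev G) = Setoid.ker
      (Set.rangeFactorization fun a : G.Dart => G.connectedComponentMk a.fst) := by
    ext a b
    rw [sup_rel_iff_reachable hσ, Setoid.ker_def, Subtype.ext_iff,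
      Set.rangeFactorization_coe, Set.rangeFactorization_coe, SimpleGraph.ConnectedComponent.eq]
  have h2 : (Set.range fun a : G.Dart => G.connectedComponentMk a.fst)ᶜ =
      G.connectedComponentMk '' {v : V | ∀ w, ¬ G.Adj v w} := by
    ext c
    induction c using SimpleGraph.ConnectedComponent.ind with | _ v
    simp only [Set.mem_compl_iff, Set.mem_range, not_exists, Set.mem_image, Set.mem_ofPred_eq]
    constructor
    · exact fun h => ⟨v, fun w hw => h ⟨(v, w), hw⟩ rfl, rfl⟩
    · rintro ⟨u, hu, huv⟩ ⟨⟨x, y⟩, hxy⟩ hx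
      obtain ⟨p⟩ := SimpleGraph.ConnectedComponent.exact (huv.trans hx.symm)
      cases p with
      | nil => exact hu _ hxy
      | cons h _ => exact hu _ h
  have h3 : {v : V | ∀ w, ¬ G.Adj v w}.ncard =
      (Set.range fun a : G.Dart => G.connectedComponentMk a.fst)ᶜ.ncard := by
    rw [h2, Set.InjOn.ncard_image]
    intro u hu v hv huv
    obtain ⟨p⟩ := SimpleGraph.ConnectedComponent.exact huv
    cases p with
    | nil => rfl
    | cons h _ => exact absurd h (hu _)
  rw [h3, h, numClasses, ← Set.ncard_add_ncard_compl
    (Set.range fun a : G.Dart => G.connectedComponentMk a.fst), ← Nat.card_coe_set_eq (Set.range _)]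
  congr 1
  refine Nat.card_congr (Setoid.quotientKerEquivOfSurjective _ Set.rangeFactorization_surjective)

/-- Isolated vertices carry no dart, so they are missing both from the cycles of `σ` and from the
orbits. Since orbits count twice, one copy remains as the extra face of each isolated vertex. -/
theorem defect_rotation {σ : Perm G.Dart} (hσ : IsRotationSystem G σ) :
    defect σ (dartRev G) + (Nat.card V + (numFacialWalks σ + {v : V | ∀ w, ¬ G.Adj v w}.ncard) : ℕ) =
      (G.edgeSet.ncard + 2 * Nat.card G.ConnectedComponent : ℕ) := by
  have h1 := numClasses_sup_rotation hσ
  have h2 := numClasses_rotation hσ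
  have h3 := numClasses_dartRev (G := G)
  have h4 := card_dart (G := G)
  have h5 : numFacialWalks σ = numClasses (cyc (σ * dartRev G)) := rfl
  rw [defect]
  omega

theorem isPlanar_iff_exists_defect_eq_zero :
    IsPlanar G ↔ ∃ σ : Perm G.Dart, IsRotationSystem G σ ∧ defect σ (dartRev G) = 0 := by
  refine exists_congr fun σ => and_congr_right fun hσ => ?_
  have := defect_rotation hσ
  omega

theorem IsPlanar.hasSphereMap (h : IsPlanar G) : HasSphereMap G := by
  classical
  obtain ⟨σ, hσ, hd⟩ := isPlanar_iff_exists_defect_eq_zero.1 h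
  -- The additional fixed dart is only a default value of `g` on non-adjacent pairs.
  refine ⟨G.Dart ⊕ Unit, inferInstance, Perm.sumCongr σ 1, Perm.sumCongr (dartRev G) 1,
    fun u v => if h : G.Adj u v then Sum.inl ⟨(u, v), h⟩ else Sum.inr (), ⟨?_, ?_, ?_, ?_⟩⟩
  · rintro (x | x)
    · exact congrArg Sum.inl (by simp)
    · rfl
  · rw [defect_sumCongr, hd, defect_unit, add_zero]
  · intro u v u' v' h h'
    rw [dif_pos h, dif_pos h', ← cyc_apply, cyc_sumCongr, sumSetoid_inl_inl, cyc_apply, hσ]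
  · intro u v h
    rw [dif_pos h, dif_pos h.symm]
    rfl

/-- First the edges not used by `g` are dissolved into half-edges, then these are detached from the
vertices. Neither step raises the defect, and the used darts then form a rotation system whose
defect is at most, hence equal to, zero. -/
theorem HasSphereMap.isPlanar (h : HasSphereMap G) : IsPlanar G := by
  classical
  obtain ⟨X, hX, σ, α, g, hg⟩ := h
  set γ : G.Dart → X := fun a => g a.fst a.snd with hγ
  have hinj : γ.Injective := by
    intro a b hab
    obtain ⟨h1, h2⟩ := hg.dart_injective a.adj b.adj hab
    exact SimpleGraph.Dart.ext _ _ (Prod.ext h1 h2)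
  have hγs : ∀ a, α (γ a) = γ a.symm := fun a => hg.rev _ _ a.adj
  have hinv : Function.Involutive fun x => if x ∈ Set.range γ then α x else x := by
    intro x
    by_cases hx : x ∈ Set.range γ
    · obtain ⟨a, rfl⟩ := hx
      simp [hγs]
    · simp only [if_neg hx]
  set β : Perm X := hinv.toPerm with hβ
  have hβval : ∀ x, β x = if x ∈ Set.range γ then α x else x := fun x => rfl
  have hdβ : defect σ β ≤ 0 := by
    rw [← hg.defect_eq]
    refine defect_le_of_subinvolution σ hg.invol hinv fun x => ?_
    rw [hβval]
    split_ifs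
    · exact Or.inl rfl
    · exact Or.inr rfl
  obtain ⟨τ, hτ1, hτ2, hτ3⟩ := exists_detach σ β (Set.range γ)ᶜ
    (fun x hx => by rw [hβval, if_neg hx])
  have hτr : ∀ x, τ x ∈ Set.range γ ↔ x ∈ Set.range γ := by
    intro x
    by_contra hne
    by_cases hx : x ∈ Set.range γ
    · have h1 : τ x ∉ Set.range γ := fun h => hne (iff_of_true h hx)
      have h2 := τ.injective (hτ1 _ h1)
      exact h1 (by rwa [h2])
    · have h2 := hτ1 _ hx
      rw [h2] at hne
      exact hne Iff.rfl
  let e₀ := Equiv.ofInjective γ hinj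
  let ρ : Perm G.Dart := e₀.symm.permCongr (τ.subtypePerm hτr)
  have hρ : ∀ a, γ (ρ a) = τ (γ a) := by
    intro a
    have : ((e₀ (ρ a) : Set.range γ) : X) = τ (γ a) := by
      simp [ρ, e₀]
    exact this
  let e : G.Dart ⊕ ↑(Set.range γ)ᶜ ≃ X :=
    (Equiv.sumCongr e₀ (Equiv.refl _)).trans (Equiv.Set.sumCompl (Set.range γ))
  have el : ∀ a, e (Sum.inl a) = γ a := fun a => rfl
  have er : ∀ n : ↑(Set.range γ)ᶜ, e (Sum.inr n) = n := fun n => rfl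
  have hc1 : ∀ x, e (Perm.sumCongr ρ 1 x) = τ (e x) := by
    rintro (a | n)
    · exact hρ a
    · exact (hτ1 _ n.2).symm
  have hc2 : ∀ x, e (Perm.sumCongr (dartRev G) 1 x) = β (e x) := by
    rintro (a | n)
    · rw [el, hβval, if_pos ⟨a, rfl⟩, hγs]
      rfl
    · rw [er, hβval, if_neg n.2]
      rfl
  have hd := defect_congr e hc1 hc2
  rw [defect_sumCongr, defect_one_right, add_zero] at hd
  refine isPlanar_iff_exists_defect_eq_zero.2 ⟨ρ, fun a b => ?_, ?_⟩
  · have h1 := cyc_comap e hc1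
    rw [cyc_sumCongr] at h1
    have h2 : cyc ρ a b ↔ cyc τ (γ a) (γ b) := by
      rw [← sumSetoid_inl_inl (r := cyc ρ) (s := cyc (1 : Perm ↑(Set.range γ)ᶜ)), h1]
      rfl
    rw [← cyc_apply, h2, cyc_apply, hτ2 _ (by simp) _ (by simp), hg.same _ _ _ _ a.adj b.adj]
  · exact le_antisymm (hd.trans_le (hτ3.trans hdβ)) (defect_nonneg _ _)

end Darts

end RandomPlanar
namespace RandomPlanar

open Equiv Equiv.Perm

/-! ### Linear bounds on the number of edges. -/

section EdgeBounds

theorem mul_numClasses_le {X : Type*} [Finite X] (r : Setoid X) (B : Set X) (g m : ℕ)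
    (h : ∀ a, g ≤ 2 * {b | r a b}.ncard + m * {b ∈ B | r a b}.ncard) :
    g * numClasses r ≤ 2 * Nat.card X + m * B.ncard := by
  classical
  have := Fintype.ofFinite X
  have hs : ∀ C : Finset X, C.card = ∑ q : Quotient r, (C.filter fun b => ⟦b⟧ = q).card :=
    fun C => Finset.card_eq_sum_card_fiberwise fun _ _ => Finset.mem_coe.2 (Finset.mem_univ _)
  rw [numClasses, Nat.card_eq_fintype_card, Nat.card_eq_fintype_card, ← Finset.card_univ (α := X),
    Set.ncard_eq_toFinset_card', hs Finset.univ, hs B.toFinset, Finset.mul_sum, Finset.mul_sum,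
    ← Finset.sum_add_distrib, ← Finset.card_univ, mul_comm, ← smul_eq_mul]
  refine Finset.card_nsmul_le_sum _ _ _ fun q _ => ?_
  induction q using Quotient.inductionOn with | _ a
  refine (h a).trans (le_of_eq ?_)
  rw [Set.ncard_eq_toFinset_card', Set.ncard_eq_toFinset_card']
  congr 3
  · ext b
    simp only [Set.mem_toFinset, Set.mem_ofPred_eq, Finset.mem_filter, Finset.mem_univ, true_and]
    rw [Quotient.eq]
    exact r.comm'
  · ext b
    simp only [Set.mem_toFinset, Set.mem_ofPred_eq, Finset.mem_filter]
    rw [Quotient.eq]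
    exact and_congr_right fun _ => r.comm'

variable {V : Type} [Finite V] {G : SimpleGraph V}

theorem fst_face {σ : Perm G.Dart} (hσ : IsRotationSystem G σ) (a : G.Dart) :
    ((σ * dartRev G) a).fst = a.snd :=
  ((hσ (dartRev G a) _).1 (sameCycle_apply_right.2 (SameCycle.refl _ _))).symm

/-- If all facial walks of length greater than two have length at least `g`. -/
theorem edge_bound_of_face_length (g : ℕ) (hg : 2 ≤ g) {σ : Perm G.Dart}
    (hσ : IsRotationSystem G σ) (hd : defect σ (dartRev G) = 0)
    (hface : ∀ a, (σ * dartRev G) ((σ * dartRev G) a) ≠ a →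
      g ≤ {b | (σ * dartRev G).SameCycle a b}.ncard) :
    (2 * g - 4) * G.edgeSet.ncard ≤ (3 * g - 2) * Nat.card V := by
  set φ := σ * dartRev G with hφ
  have hfst : ∀ a, (φ a).fst = a.snd := fst_face hσ
  have hne : ∀ a, φ a ≠ a := fun a h => a.adj.ne (by rw [← hfst a, h])
  -- On a facial walk of length two each dart is the only one at its tail, so there are at most as
  -- many such darts as vertices.
  have hBσ : ∀ a, φ (φ a) = a → σ a = a := by
    intro a ha
    have h1 : φ a = a.symm := by
      refine SimpleGraph.Dart.ext _ _ (Prod.ext (hfst a) ?_)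
      have := hfst (φ a)
      rw [ha] at this
      exact this.symm
    have h2 : φ a.symm = σ a := by rw [hφ, Perm.mul_apply, dartRev_apply, SimpleGraph.Dart.symm_symm]
    rw [← h2, ← h1, ha]
  have hB : {a | φ (φ a) = a}.ncard ≤ Nat.card V := by
    rw [← Set.ncard_univ]
    refine Set.ncard_le_ncard_of_injOn (fun a : G.Dart => a.fst) (fun _ _ => Set.mem_univ _) ?_
    intro a ha b hb hab
    exact SameCycle.eq_of_left ((hσ a b).2 hab) (hBσ a ha)
  -- A face of length two receives `2 * 2 + (g - 2) * 2 = 2 * g`, the same lower bound as a face of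
  -- length at least `g`.
  have hcount := mul_numClasses_le (cyc φ) {a | φ (φ a) = a} (2 * g) (g - 2) (fun a => by
    by_cases ha : φ (φ a) = a
    · have h1 : ({a, φ a} : Set G.Dart) ⊆ {b ∈ {a | φ (φ a) = a} | cyc φ a b} := by
        rintro b (rfl | rfl)
        · exact ⟨ha, SameCycle.refl _ _⟩
        · exact ⟨by rw [Set.mem_ofPred_eq, ha], sameCycle_apply_right.2 (SameCycle.refl _ _)⟩
      have h2 := Set.ncard_le_ncard h1 (Set.toFinite _)
      rw [Set.ncard_pair (hne a).symm] at h2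
      have h3 : 2 ≤ {b | cyc φ a b}.ncard :=
        h2.trans (Set.ncard_le_ncard (fun b hb => hb.2) (Set.toFinite _))
      have h4 := Nat.mul_le_mul_left (g - 2) h2
      omega
    · have h1 := hface a ha
      exact (Nat.mul_le_mul_left 2 h1).trans (Nat.le_add_right _ _))
  have h1 := numClasses_sup_rotation hσ
  have h2 := defect_rotation hσ
  rw [hd] at h2
  have h3 : numFacialWalks σ = numClasses (cyc φ) := rfl
  rw [card_dart] at hcount
  have h4 := Nat.mul_le_mul_left (g - 2) hB
  obtain ⟨k, rfl⟩ := Nat.exists_eq_add_of_le hg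
  rw [show 2 + k - 2 = k by omega] at hcount h4
  rw [show 2 * (2 + k) - 4 = 2 * k by omega, show 3 * (2 + k) - 2 = 4 + 3 * k by omega]
  rw [h3] at h2
  set F := numClasses (cyc φ)
  set E := G.edgeSet.ncard
  set n := Nat.card V
  set iso := {v : V | ∀ w, ¬ G.Adj v w}.ncard
  set C := Nat.card G.ConnectedComponent
  have h5 : n + F + iso = E + 2 * C := by omega
  have h6 : iso ≤ C := by omega
  -- Euler's formula is scaled by `g = 2 + k`; each isolated vertex is a component, so the isolated
  -- vertices are outweighed by the term `2 * C`.
  have h7 : (2 + k) * (n + F + iso) = (2 + k) * (E + 2 * C) := by rw [h5]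
  have h8 : (2 + k) * iso ≤ (2 + k) * C := Nat.mul_le_mul_left _ h6
  have h9 : 0 ≤ (2 + k) * C := Nat.zero_le _
  nlinarith

theorem IsPlanar.two_mul_edges_le (h : IsPlanar G) : 2 * G.edgeSet.ncard ≤ 7 * Nat.card V := by
  obtain ⟨σ, hσ, hd⟩ := isPlanar_iff_exists_defect_eq_zero.1 h
  refine edge_bound_of_face_length 3 (by norm_num) hσ hd fun a ha => ?_
  set φ := σ * dartRev G with hφ
  have hfst : ∀ a, (φ a).fst = a.snd := fst_face hσ
  have hne : ∀ a, φ a ≠ a := fun a h => a.adj.ne (by rw [← hfst a, h])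
  have h1 : ({a, φ a, φ (φ a)} : Set G.Dart) ⊆ {b | φ.SameCycle a b} := by
    rintro b (rfl | rfl | rfl) <;>
      simp only [Set.mem_ofPred_eq, sameCycle_apply_right, SameCycle.refl]
  refine le_trans (le_of_eq ?_) (Set.ncard_le_ncard h1 (Set.toFinite _))
  rw [Set.ncard_eq_three.2 ⟨a, φ a, φ (φ a), (hne a).symm, Ne.symm ha, (hne _).symm, rfl⟩]

/-- Facial walks alternate between the two sides, so none has length three and those longer than two
have length at least four. -/
theorem IsPlanar.two_mul_edges_le_of_bipartite (h : IsPlanar G) (A : Set V)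
    (hA : ∀ u v, G.Adj u v → (u ∈ A ↔ v ∉ A)) : 2 * G.edgeSet.ncard ≤ 5 * Nat.card V := by
  classical
  obtain ⟨σ, hσ, hd⟩ := isPlanar_iff_exists_defect_eq_zero.1 h
  have := edge_bound_of_face_length 4 (by norm_num) hσ hd fun a ha => ?_
  · omega
  set φ := σ * dartRev G with hφ
  have hfst : ∀ a, (φ a).fst = a.snd := fst_face hσ
  have hne : ∀ a, φ a ≠ a := fun a h => a.adj.ne (by rw [← hfst a, h])
  have hcol : ∀ a, (φ a).fst ∈ A ↔ a.fst ∉ A := fun a => by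
    rw [hfst, hA _ _ a.adj, not_not]
  have hne3 : ∀ a, φ (φ (φ a)) ≠ a := fun a h => by
    have h1 := hcol (φ (φ a))
    rw [h, hcol, hcol] at h1
    tauto
  have h1 : (({a, φ a, φ (φ a), φ (φ (φ a))} : Finset G.Dart) : Set G.Dart) ⊆
      {b | φ.SameCycle a b} := by
    intro b hb
    simp only [Finset.coe_insert, Finset.coe_singleton, Set.mem_insert_iff,
      Set.mem_singleton_iff] at hb
    rcases hb with rfl | rfl | rfl | rfl <;>
      simp only [Set.mem_ofPred_eq, sameCycle_apply_right, SameCycle.refl]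
  refine le_trans (le_of_eq ?_) (Set.ncard_le_ncard h1 (Set.toFinite _))
  rw [Set.ncard_coe_finset]
  have h2 : φ (φ (φ a)) ≠ φ a := fun h => ha (φ.injective h)
  rw [Finset.card_insert_of_notMem, Finset.card_insert_of_notMem, Finset.card_pair (hne _).symm]
  · simp [(hne (φ a)).symm, h2.symm]
  · simp [(hne a).symm, Ne.symm ha, (hne3 a).symm]

end EdgeBounds

end RandomPlanar
namespace RandomPlanar

/-! ### An exponential bound for labelled planar graphs, by contraction. -/

section ExponentialBound

open Classical in
-- A vertex that is not good has degree at least 84 (set `B`), or degree at least 3 and all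
-- neighbours in `B` (set `I`). The edge bound gives `84 |B| ≤ 7 |V|`. The bipartite bound between
-- `I` and `B` gives `6 |I| ≤ 5 (|I| + |B|)`, so `|I| ≤ 5 |B|`. Together these are at most `6 |B| ≤
-- |V| / 2` vertices.
theorem IsPlanar.card_good_vertices {V : Type} [Fintype V] {G : SimpleGraph V} (h : IsPlanar G) :
    Fintype.card V ≤ 2 * (Finset.univ.filter fun v => (∀ u, ¬ G.Adj v u) ∨
      ∃ u, G.Adj v u ∧ (G.degree v ≤ 2 ∨ (G.degree v ≤ 83 ∧ G.degree u ≤ 83))).card := by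
  set Gd := Finset.univ.filter fun v => (∀ u, ¬ G.Adj v u) ∨
      ∃ u, G.Adj v u ∧ (G.degree v ≤ 2 ∨ (G.degree v ≤ 83 ∧ G.degree u ≤ 83)) with hGd
  set B := Finset.univ.filter fun v => 83 < G.degree v with hB
  set I := Finset.univ.filter fun v => 3 ≤ G.degree v ∧ v ∉ B ∧ ∀ u, G.Adj v u → u ∈ B with hI
  have hcover : (Finset.univ : Finset V) ⊆ Gd ∪ (B ∪ I) := by
    intro v _
    by_contra hv
    simp only [hGd, hB, hI, Finset.mem_union, Finset.mem_filter, Finset.mem_univ, true_and,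
      not_or, not_and, not_forall, not_not, not_exists, not_lt] at hv
    obtain ⟨⟨⟨u, hu⟩, h1⟩, h2, h3⟩ := hv
    have h4 : 3 ≤ G.degree v := by
      have := (h1 u hu).1
      omega
    obtain ⟨w, hw, h5⟩ := h3 h4 (by omega)
    have h6 := (h1 w hw).2 (by omega)
    omega
  have hE := h.two_mul_edges_le
  rw [Set.ncard_eq_toFinset_card', Nat.card_eq_fintype_card] at hE
  have hsum : ∑ v, G.degree v = 2 * G.edgeSet.toFinset.card := G.sum_degrees_eq_twice_card_edges
  have hBcard : 84 * B.card ≤ 7 * Fintype.card V := by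
    refine le_trans ?_ hE
    rw [← hsum, mul_comm, ← smul_eq_mul]
    refine le_trans (Finset.card_nsmul_le_sum B (fun v => G.degree v) 84 fun v hv => ?_)
      (Finset.sum_le_sum_of_subset (Finset.subset_univ B))
    rw [hB, Finset.mem_filter] at hv
    exact hv.2
  have hdisj : ∀ v ∈ I, v ∉ B := fun v hv => by
    simp only [hI, Finset.mem_filter, Finset.mem_univ, true_and] at hv
    exact hv.2.1
  let W := {v : V // v ∈ I ∪ B}
  let H : SimpleGraph W :=
    { Adj := fun x y => G.Adj x y ∧ (x.1 ∈ I ↔ y.1 ∉ I)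
      symm := ⟨fun x y hxy => ⟨hxy.1.symm, by have := hxy.2; tauto⟩⟩
      loopless := ⟨fun x hx => hx.1.ne rfl⟩ }
  have hHadj : ∀ x y : W, H.Adj x y ↔ G.Adj x y ∧ (x.1 ∈ I ↔ y.1 ∉ I) := fun _ _ => Iff.rfl
  have hHp : IsPlanar H := (h.hasSphereMap.of_injective (f := Subtype.val) Subtype.val_injective
    (fun x y hxy => ((hHadj x y).1 hxy).1)).isPlanar
  have hHE := hHp.two_mul_edges_le_of_bipartite {x : W | x.1 ∈ I} (fun x y hxy => hxy.2)
  rw [Set.ncard_eq_toFinset_card', Nat.card_eq_fintype_card] at hHE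
  have hWcard : Fintype.card W = I.card + B.card := by
    rw [Fintype.card_coe, Finset.card_union_of_disjoint (Finset.disjoint_left.2 hdisj)]
  let s : Finset W := Finset.univ.filter fun x => x.1 ∈ I
  have hbip : H.IsBipartiteWith (s : Set W) ((sᶜ : Finset W) : Set W) := by
    refine ⟨by rw [Finset.coe_compl]; exact disjoint_compl_right, fun x y hxy => ?_⟩
    have := hxy.2
    simp only [s, Finset.coe_filter, Finset.mem_univ, true_and, Set.mem_ofPred_eq,
      Finset.coe_compl, Set.mem_compl_iff]
    tauto
  have hsdeg := SimpleGraph.isBipartiteWith_sum_degrees_eq_card_edges hbip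
  have hscard : s.card = I.card := by
    refine Finset.card_bij (fun x _ => x.1) (fun x hx => (Finset.mem_filter.1 hx).2)
      (fun x _ y _ hxy => Subtype.ext hxy)
      (fun v hv => ⟨⟨v, Finset.mem_union_left _ hv⟩, Finset.mem_filter.2 ⟨Finset.mem_univ _, hv⟩, rfl⟩)
  have hIE : 3 * I.card ≤ H.edgeFinset.card := by
    rw [← hsdeg, ← hscard, mul_comm, ← smul_eq_mul]
    refine Finset.card_nsmul_le_sum s _ 3 fun x hx => ?_
    have hxI : x.1 ∈ I := (Finset.mem_filter.1 hx).2
    have hx' := hxI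
    simp only [hI, Finset.mem_filter, Finset.mem_univ, true_and] at hx'
    refine hx'.1.trans ?_
    rw [← SimpleGraph.card_neighborFinset_eq_degree, ← SimpleGraph.card_neighborFinset_eq_degree,
      ← Finset.card_image_of_injective (H.neighborFinset x) Subtype.val_injective]
    refine Finset.card_le_card fun u hu => ?_
    rw [SimpleGraph.mem_neighborFinset] at hu
    have huB : u ∈ B := hx'.2.2 u hu
    refine Finset.mem_image.2 ⟨⟨u, Finset.mem_union_right _ huB⟩, ?_, rfl⟩
    rw [SimpleGraph.mem_neighborFinset]
    exact ⟨hu, iff_of_true hxI fun huI => hdisj u huI huB⟩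
  have hIE' : 3 * I.card ≤ H.edgeSet.toFinset.card := hIE
  have h1 := Finset.card_le_card hcover
  have h2 := Finset.card_union_le Gd (B ∪ I)
  have h3 := Finset.card_union_le B I
  rw [Finset.card_univ] at h1
  omega

/-- The planar graphs on `Fin n`. -/
def planarSet (n : ℕ) : Set (SimpleGraph (Fin n)) := {G | IsPlanar G}

theorem ncard_planarSet_zero : (planarSet 0).ncard ≤ 1 :=
  (Set.ncard_le_ncard (Set.subset_univ _)).trans (by
    rw [Set.ncard_univ, Nat.card_eq_fintype_card, Fintype.card_le_one_iff_subsingleton]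
    exact ⟨fun G H => by ext x; exact x.elim0⟩)

section Reconstruction

variable {n : ℕ}

open Classical in
/-- The finite set of neighbours of `u`. -/
noncomputable def nbrs {V : Type} [Fintype V] (G : SimpleGraph V) (u : V) : Finset V :=
  Finset.univ.filter fun w => G.Adj u w

theorem mem_nbrs {V : Type} [Fintype V] {G : SimpleGraph V} {u w : V} :
    w ∈ nbrs G u ↔ G.Adj u w := by
  simp [nbrs]

open Classical in
/-- The possible pairs of neighbourhoods (outside each other) of the two ends of an edge whose
contraction yields a vertex with neighbourhood `N`. -/
def neighborhoodPairs (N : Finset (Fin n)) : Finset (Finset (Fin n) × Finset (Fin n)) :=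
  (N.powerset ×ˢ N.powerset).filter fun p => N ⊆ p.1 ∪ p.2 ∧ (p.2.card ≤ 1 ∨ N.card ≤ 166)

/-- For `|N| ≤ 166` all pairs of subsets are counted. Otherwise the second set is empty or a single
`b`, and the first one is then `N` or `N` without `b`, which leaves linearly many pairs. -/
theorem card_neighborhoodPairs_le (N : Finset (Fin n)) :
    (neighborhoodPairs N).card ≤ (2 ^ 332 + 2) * (N.card + 1) := by
  classical
  by_cases hN : N.card ≤ 166
  · calc (neighborhoodPairs N).card ≤ (N.powerset ×ˢ N.powerset).card := Finset.card_filter_le _ _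
      _ = 2 ^ (N.card + N.card) := by
        rw [Finset.card_product, Finset.card_powerset, pow_add]
      _ ≤ 2 ^ 332 := Nat.pow_le_pow_right (by norm_num) (by omega)
      _ ≤ (2 ^ 332 + 2) * (N.card + 1) := by
        generalize 2 ^ 332 = M
        nlinarith [Nat.zero_le (M * N.card)]
  · have hsub : neighborhoodPairs N ⊆ insert (N, ∅)
        ((N.image fun b => (N, {b})) ∪ N.image fun b => (N.erase b, {b})) := by
      rintro ⟨Q, R⟩ h
      simp only [neighborhoodPairs, Finset.mem_filter, Finset.mem_product, Finset.mem_powerset,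
        hN, or_false] at h
      obtain ⟨⟨hQ, hR⟩, hQR, hc⟩ := h
      simp only [Finset.mem_insert, Finset.mem_union, Finset.mem_image, Prod.mk.injEq]
      rcases Finset.eq_empty_or_nonempty R with rfl | hne
      · left
        rw [Finset.union_empty] at hQR
        exact ⟨hQ.antisymm hQR, rfl⟩
      · obtain ⟨b, rfl⟩ := Finset.card_eq_one.1 (le_antisymm hc hne.card_pos)
        have hb : b ∈ N := hR (Finset.mem_singleton_self b)
        right
        by_cases hbQ : b ∈ Q
        · left
          refine ⟨b, hb, (Finset.Subset.antisymm hQ fun x hx => ?_).symm, rfl⟩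
          rcases Finset.mem_union.1 (hQR hx) with h1 | h1
          · exact h1
          · rwa [Finset.mem_singleton.1 h1]
        · right
          refine ⟨b, hb, (Finset.Subset.antisymm (fun x hx => ?_) fun x hx => ?_).symm, rfl⟩
          · exact Finset.mem_erase.2 ⟨fun h1 => hbQ (h1 ▸ hx), hQ hx⟩
          · rcases Finset.mem_union.1 (hQR (Finset.mem_of_mem_erase hx)) with h1 | h1
            · exact h1
            · exact absurd (Finset.mem_singleton.1 h1) (Finset.ne_of_mem_erase hx)
    refine (Finset.card_le_card hsub).trans ((Finset.card_insert_le _ _).trans ?_)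
    have h1 := Finset.card_union_le (N.image fun b => (N, ({b} : Finset (Fin n))))
      (N.image fun b => (N.erase b, {b}))
    have h2 := Finset.card_image_le (s := N) (f := fun b => (N, ({b} : Finset (Fin n))))
    have h3 := Finset.card_image_le (s := N) (f := fun b => (N.erase b, ({b} : Finset (Fin n))))
    generalize 2 ^ 332 = M
    nlinarith [Nat.zero_le (M * N.card)]

open Classical in
theorem card_planar_isolated_le (v : Fin (n + 1)) :
    {G : SimpleGraph (Fin (n + 1)) | IsPlanar G ∧ ∀ u, ¬ G.Adj v u}.ncard ≤
      (planarSet n).ncard := by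
  refine Set.ncard_le_ncard_of_injOn (fun G => G.comap v.succAbove) ?_ ?_ (Set.toFinite _)
  · rintro G ⟨hG, -⟩
    exact (hG.hasSphereMap.of_injective Fin.succAbove_right_injective fun _ _ h => h).isPlanar
  · rintro G ⟨-, hG⟩ H ⟨-, hH⟩ hGH
    ext x y
    rcases Fin.eq_self_or_eq_succAbove v x with rfl | ⟨x, rfl⟩
    · exact iff_of_false (hG y) (hH y)
    rcases Fin.eq_self_or_eq_succAbove v y with rfl | ⟨y, rfl⟩
    · exact iff_of_false (fun h => hG _ h.symm) (fun h => hH _ h.symm)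
    have : (G.comap v.succAbove).Adj x y ↔ (H.comap v.succAbove).Adj x y := by
      simp only at hGH
      rw [hGH]
    exact this

open Classical in
-- A graph is recovered from the contracted graph, the vertex `u` and the two neighbourhoods `Q`,
-- `R`. Summing the number of pairs over `u` costs a constant times `∑ (deg + 1) ≤ 7 n + n`, by the
-- edge bound.
theorem card_planar_contractible_le (v : Fin (n + 1)) :
    {G : SimpleGraph (Fin (n + 1)) | IsPlanar G ∧ ∃ u, G.Adj v u ∧
      (G.degree v ≤ 2 ∨ (G.degree v ≤ 83 ∧ G.degree u ≤ 83))}.ncard ≤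
      8 * (2 ^ 332 + 2) * n * (planarSet n).ncard := by
  rcases n.eq_zero_or_pos with rfl | hn
  · refine ((Set.ncard_eq_zero (Set.toFinite _)).2 ?_).trans_le (Nat.zero_le _)
    · refine Set.eq_empty_of_forall_notMem ?_
      rintro G ⟨-, u, hu, -⟩
      exact hu.ne (by omega)
  have : Nonempty (Fin n) := ⟨⟨0, hn⟩⟩
  set f := v.succAbove with hf
  have hfinj : Function.Injective f := Fin.succAbove_right_injective
  have hfv : ∀ x, f x ≠ v := Fin.succAbove_ne v
  set S := {G : SimpleGraph (Fin (n + 1)) | IsPlanar G ∧ ∃ u, G.Adj v u ∧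
      (G.degree v ≤ 2 ∨ (G.degree v ≤ 83 ∧ G.degree u ≤ 83))} with hS
  have hex : ∀ G ∈ S, ∃ u : Fin n, G.Adj v (f u) ∧
      (G.degree v ≤ 2 ∨ (G.degree v ≤ 83 ∧ G.degree (f u) ≤ 83)) := by
    rintro G ⟨-, u, hu, h⟩
    obtain ⟨w, rfl⟩ := Fin.exists_succAbove_eq hu.ne'
    exact ⟨w, hu, h⟩
  choose! u hu using hex
  let G' : SimpleGraph (Fin (n + 1)) → SimpleGraph (Fin n) := fun G =>
    (contract G v (f (u G))).comap f
  let Q : SimpleGraph (Fin (n + 1)) → Finset (Fin n) := fun G =>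
    Finset.univ.filter fun y => G.Adj (f (u G)) (f y)
  let R : SimpleGraph (Fin (n + 1)) → Finset (Fin n) := fun G =>
    Finset.univ.filter fun y => y ≠ u G ∧ G.Adj v (f y)
  have hG' : ∀ G x y, (G' G).Adj x y ↔ x ≠ y ∧ (G.Adj (f x) (f y) ∨ (x = u G ∧ G.Adj v (f y)) ∨
      (y = u G ∧ G.Adj v (f x))) := by
    intro G x y
    change (f x ≠ f y ∧ f x ≠ v ∧ f y ≠ v ∧ _) ↔ _
    rw [hfinj.ne_iff, hfinj.eq_iff, hfinj.eq_iff]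
    simp [hfv]
  let PG : Finset (SimpleGraph (Fin n)) := (Set.toFinite (planarSet n)).toFinset
  let T : Finset (Σ _ : SimpleGraph (Fin n) × Fin n, Finset (Fin n) × Finset (Fin n)) :=
    (PG ×ˢ Finset.univ).sigma fun p => neighborhoodPairs (nbrs p.1 p.2)
  have hT : T.card ≤ 8 * (2 ^ 332 + 2) * n * (planarSet n).ncard := by
    rw [Finset.card_sigma, Finset.sum_product, Set.ncard_eq_toFinset_card (planarSet n), mul_comm,
      ← smul_eq_mul]
    refine Finset.sum_le_card_nsmul _ _ _ fun H hH => ?_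
    have hHp : IsPlanar H := (Set.Finite.mem_toFinset (Set.toFinite (planarSet _))).1 hH
    have hE := hHp.two_mul_edges_le
    have hsum : ∑ v, H.degree v = 2 * H.edgeSet.toFinset.card := H.sum_degrees_eq_twice_card_edges
    rw [Set.ncard_eq_toFinset_card', Nat.card_eq_fintype_card, Fintype.card_fin, ← hsum] at hE
    calc ∑ w, (neighborhoodPairs (nbrs H w)).card
        ≤ ∑ w, (2 ^ 332 + 2) * (H.degree w + 1) := Finset.sum_le_sum fun w _ => by
          rw [← SimpleGraph.card_neighborFinset_eq_degree, show H.neighborFinset w = nbrs H w by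
            ext; rw [SimpleGraph.mem_neighborFinset, mem_nbrs]]
          exact card_neighborhoodPairs_le _
      _ = (2 ^ 332 + 2) * (∑ w, H.degree w + n) := by
        rw [← Finset.mul_sum, Finset.sum_add_distrib]
        simp
      _ ≤ (2 ^ 332 + 2) * (7 * n + n) := Nat.mul_le_mul_left _ (by omega)
      _ = 8 * (2 ^ 332 + 2) * n := by ring
  refine le_trans ?_ hT
  rw [← Set.ncard_coe_finset]
  refine Set.ncard_le_ncard_of_injOn (fun G => ⟨(G' G, u G), (Q G, R G)⟩) ?_ ?_ (Set.toFinite _)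
  · intro G hG
    obtain ⟨hadj, hdeg⟩ := hu G hG
    have hplanar : IsPlanar (G' G) := ((hG.1.hasSphereMap.contract hadj).of_injective hfinj
      fun _ _ h => h).isPlanar
    have hQN : Q G ⊆ nbrs (G' G) (u G) := by
      intro y hy
      rw [mem_nbrs, hG']
      have hy' := (Finset.mem_filter.1 hy).2
      exact ⟨fun h => hy'.ne (by rw [h]), Or.inl hy'⟩
    have hRN : R G ⊆ nbrs (G' G) (u G) := by
      intro y hy
      rw [mem_nbrs, hG']
      have hy' := (Finset.mem_filter.1 hy).2
      exact ⟨hy'.1.symm, Or.inr (Or.inl ⟨rfl, hy'.2⟩)⟩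
    have hNQR : nbrs (G' G) (u G) ⊆ Q G ∪ R G := by
      intro y hy
      rw [mem_nbrs, hG'] at hy
      rw [Finset.mem_union, Finset.mem_filter, Finset.mem_filter]
      obtain ⟨h1, h2 | ⟨-, h2⟩ | ⟨h2, -⟩⟩ := hy
      · exact Or.inl ⟨Finset.mem_univ _, h2⟩
      · exact Or.inr ⟨Finset.mem_univ _, h1.symm, h2⟩
      · exact absurd h2.symm h1
    have hRc : (R G).card + 1 ≤ G.degree v := by
      rw [← SimpleGraph.card_neighborFinset_eq_degree, ← Finset.card_image_of_injective _ hfinj,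
        ← Finset.card_insert_of_notMem (a := f (u G))]
      · refine Finset.card_le_card fun y hy => ?_
        rw [SimpleGraph.mem_neighborFinset]
        rcases Finset.mem_insert.1 hy with rfl | hy
        · exact hadj
        · obtain ⟨z, hz, rfl⟩ := Finset.mem_image.1 hy
          exact (Finset.mem_filter.1 hz).2.2
      · intro h
        obtain ⟨z, hz, hz'⟩ := Finset.mem_image.1 h
        exact (Finset.mem_filter.1 hz).2.1 (hfinj hz')
    have hQc : (Q G).card ≤ G.degree (f (u G)) := by
      rw [← SimpleGraph.card_neighborFinset_eq_degree, ← Finset.card_image_of_injective _ hfinj]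
      refine Finset.card_le_card fun y hy => ?_
      rw [SimpleGraph.mem_neighborFinset]
      obtain ⟨z, hz, rfl⟩ := Finset.mem_image.1 hy
      exact (Finset.mem_filter.1 hz).2
    have hNc := (Finset.card_le_card hNQR).trans (Finset.card_union_le _ _)
    simp only [T, Finset.coe_sigma, Set.mem_sigma_iff, Finset.mem_coe, Finset.mem_product,
      Finset.mem_univ, and_true]
    refine ⟨(Set.Finite.mem_toFinset _).2 hplanar, ?_⟩
    simp only [neighborhoodPairs, Finset.mem_filter, Finset.mem_product, Finset.mem_powerset]
    exact ⟨⟨hQN, hRN⟩, hNQR, by omega⟩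
  · intro G hG H hH hGH
    simp only [Sigma.mk.injEq, Prod.mk.injEq, heq_eq_eq] at hGH
    obtain ⟨⟨h1, h2⟩, h3, h4⟩ := hGH
    have hQ : ∀ y, G.Adj (f (u G)) (f y) ↔ H.Adj (f (u G)) (f y) := by
      intro y
      have h5 : y ∈ Q G ↔ y ∈ Q H := by rw [h3]
      simp only [Q, Finset.mem_filter, Finset.mem_univ, true_and] at h5
      rwa [← h2] at h5
    have hR : ∀ y, G.Adj v (f y) ↔ H.Adj v (f y) := by
      intro y
      by_cases hy : y = u G
      · rw [hy]
        refine iff_of_true (hu G hG).1 ?_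
        rw [h2]
        exact (hu H hH).1
      · have h5 : y ∈ R G ↔ y ∈ R H := by rw [h4]
        simp only [R, Finset.mem_filter, Finset.mem_univ, true_and] at h5
        rw [← h2] at h5
        tauto
    ext x y
    rcases Fin.eq_self_or_eq_succAbove v x with rfl | ⟨x, rfl⟩
    · rcases Fin.eq_self_or_eq_succAbove x y with rfl | ⟨y, rfl⟩
      · exact iff_of_false (G.loopless.irrefl _) (H.loopless.irrefl _)
      · exact hR y
    rcases Fin.eq_self_or_eq_succAbove v y with rfl | ⟨y, rfl⟩
    · rw [G.adj_comm, H.adj_comm]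
      exact hR x
    by_cases hx : x = u G
    · rw [hx]; exact hQ y
    by_cases hy : y = u G
    · rw [hy, G.adj_comm, H.adj_comm]; exact hQ x
    have h5 : (G' G).Adj x y ↔ (G' H).Adj x y := by rw [h1]
    rw [hG', hG', ← h2] at h5
    by_cases hxy : x = y
    · rw [hxy]
      exact iff_of_false (G.loopless.irrefl _) (H.loopless.irrefl _)
    · simpa [hx, hy, hxy] using h5

end Reconstruction

open Classical in
-- Pairs of a planar graph and a good vertex are counted twice: each graph has at least `(n + 1) /
-- 2` of them, and for a fixed vertex the two preceding lemmas bound the number of graphs.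
theorem ncard_planarSet_succ_le (n : ℕ) : (planarSet (n + 1)).ncard ≤
    16 * (2 ^ 332 + 2) * (n + 1) * (planarSet n).ncard := by
  let good : SimpleGraph (Fin (n + 1)) → Fin (n + 1) → Prop := fun G v => (∀ u, ¬ G.Adj v u) ∨
      ∃ u, G.Adj v u ∧ (G.degree v ≤ 2 ∨ (G.degree v ≤ 83 ∧ G.degree u ≤ 83))
  let PG : Finset (SimpleGraph (Fin (n + 1))) := (Set.toFinite (planarSet (n + 1))).toFinset
  have hPG : PG.card = (planarSet (n + 1)).ncard := (Set.ncard_eq_toFinset_card _).symm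
  have h1 : (n + 1) * PG.card ≤ 2 * ∑ G ∈ PG, (Finset.univ.filter (good G)).card := by
    rw [Finset.mul_sum, mul_comm, ← smul_eq_mul]
    refine Finset.card_nsmul_le_sum _ _ _ fun G hG => ?_
    have hGp : IsPlanar G := (Set.Finite.mem_toFinset (Set.toFinite (planarSet _))).1 hG
    have := hGp.card_good_vertices
    rw [Fintype.card_fin] at this
    exact this.trans (Nat.mul_le_mul_left 2 (le_of_eq (by congr)))
  have h2 : ∑ G ∈ PG, (Finset.univ.filter (good G)).card =
      ∑ v, (PG.filter fun G => good G v).card :=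
    Finset.sum_card_bipartiteAbove_eq_sum_card_bipartiteBelow good
  have h3 : ∀ v, (PG.filter fun G => good G v).card ≤
      (8 * (2 ^ 332 + 2) * n + 1) * (planarSet n).ncard := by
    intro v
    rw [← Set.ncard_coe_finset]
    have hsub : ((PG.filter fun G => good G v : Finset _) : Set (SimpleGraph (Fin (n + 1)))) ⊆
        {G | IsPlanar G ∧ ∀ u, ¬ G.Adj v u} ∪ {G | IsPlanar G ∧ ∃ u, G.Adj v u ∧
      (G.degree v ≤ 2 ∨ (G.degree v ≤ 83 ∧ G.degree u ≤ 83))} := by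
      intro G hG
      rw [Finset.mem_coe, Finset.mem_filter] at hG
      have hGp : IsPlanar G := (Set.Finite.mem_toFinset (Set.toFinite (planarSet _))).1 hG.1
      rcases hG.2 with h | h
      · exact Or.inl ⟨hGp, h⟩
      · exact Or.inr ⟨hGp, h⟩
    refine (Set.ncard_le_ncard hsub (Set.toFinite _)).trans ((Set.ncard_union_le _ _).trans ?_)
    have h4 := card_planar_isolated_le v
    have h5 := card_planar_contractible_le v
    rw [add_mul, one_mul, add_comm]
    exact Nat.add_le_add h5 h4
  have h4 : ∑ v, (PG.filter fun G => good G v).card ≤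
      (n + 1) * ((8 * (2 ^ 332 + 2) * n + 1) * (planarSet n).ncard) := by
    refine (Finset.sum_le_card_nsmul _ _ _ fun v _ => h3 v).trans ?_
    rw [Finset.card_univ, Fintype.card_fin, smul_eq_mul]
  rw [h2] at h1
  have h5 : (n + 1) * PG.card ≤
      (n + 1) * (2 * ((8 * (2 ^ 332 + 2) * n + 1) * (planarSet n).ncard)) := by
    calc _ ≤ _ := h1
      _ ≤ _ := Nat.mul_le_mul_left 2 h4
      _ = _ := by ring
  rw [← hPG]
  refine (Nat.le_of_mul_le_mul_left h5 (Nat.succ_pos n)).trans ?_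
  generalize (2 : ℕ) ^ 332 = M
  generalize (planarSet n).ncard = k
  nlinarith [Nat.zero_le (M * k)]

/-- The number of labelled planar graphs grows at most like `A ^ n n!`. -/
theorem exists_ncard_planarSet_le : ∃ A : ℕ, 1 ≤ A ∧
    ∀ n, (planarSet n).ncard ≤ A ^ n * n.factorial := by
  refine ⟨16 * (2 ^ 332 + 2), Nat.succ_le_of_lt (by positivity), fun n => ?_⟩
  induction n with
  | zero => simpa using ncard_planarSet_zero
  | succ n ih =>
    refine (ncard_planarSet_succ_le n).trans ((Nat.mul_le_mul_left _ ih).trans (le_of_eq ?_))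
    rw [Nat.factorial_succ, pow_succ]
    ring

end ExponentialBound

end RandomPlanar
namespace RandomPlanar

/-! ### Classes of planar graphs with bounded degrees. -/

section Classes

variable {V U W : Type}

/-- The degree of a vertex, without decidability assumptions. -/
noncomputable def ndeg (G : SimpleGraph V) (v : V) : ℕ := (G.neighborSet v).ncard

theorem ndeg_eq_degree (G : SimpleGraph V) (v : V) [Fintype (G.neighborSet v)] :
    ndeg G v = G.degree v := Set.ncard_eq_toFinset_card' _

theorem sum_ndeg [Fintype V] (G : SimpleGraph V) : ∑ v, ndeg G v = 2 * G.edgeSet.ncard := by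
  classical
  rw [Set.ncard_eq_toFinset_card', Finset.sum_congr rfl fun v _ => ndeg_eq_degree G v]
  exact G.sum_degrees_eq_twice_card_edges

theorem ndeg_lt_card [Finite V] (G : SimpleGraph V) (v : V) : ndeg G v < Nat.card V := by
  rw [ndeg, ← Set.ncard_univ]
  exact Set.ncard_lt_ncard ⟨Set.subset_univ _, fun h => G.loopless.irrefl v (h (Set.mem_univ v))⟩
    (Set.toFinite _)

theorem ndeg_comap_equiv (e : V ≃ W) (G : SimpleGraph W) (v : V) :
    ndeg (G.comap e) v = ndeg G (e v) := by
  rw [ndeg, ndeg, ← Set.ncard_image_of_injective _ e.injective]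
  congr 1
  ext w
  constructor
  · rintro ⟨x, hx, rfl⟩
    exact hx
  · intro hw
    exact ⟨e.symm w, by simpa using hw, by simp⟩

/-- The planar graphs on `V` with all degrees between `d` and `D`. -/
def boundedPlanar (V : Type) (d D : ℤ) : Set (SimpleGraph V) :=
  {G | IsPlanar G ∧ ∀ v, d ≤ (ndeg G v : ℤ) ∧ (ndeg G v : ℤ) ≤ D}

/-- The connected planar graphs on `V` with all degrees between `d` and `D`. -/
def connPlanar (V : Type) (d D : ℤ) : Set (SimpleGraph V) :=
  {G | G ∈ boundedPlanar V d D ∧ G.Connected}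

theorem planarGraphs_eq (n : ℕ) (d D : ℤ) : planarGraphs n d D = boundedPlanar (Fin n) d D := by
  ext G
  simp only [planarGraphs, boundedPlanar, Set.mem_ofPred_eq, ← ndeg_eq_degree]

theorem IsPlanar.comap [Finite V] [Finite W] {G : SimpleGraph W} (h : IsPlanar G) {f : V → W}
    (hf : f.Injective) : IsPlanar (G.comap f) :=
  (h.hasSphereMap.of_injective hf fun _ _ h => h).isPlanar

theorem IsPlanar.mono [Finite V] {G G' : SimpleGraph V} (h : IsPlanar G) (hle : G' ≤ G) :
    IsPlanar G' := (h.hasSphereMap.mono hle).isPlanar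

theorem comap_mem_boundedPlanar [Finite V] [Finite W] (e : V ≃ W) {d D : ℤ} {G : SimpleGraph W}
    (h : G ∈ boundedPlanar W d D) : G.comap e ∈ boundedPlanar V d D :=
  ⟨h.1.comap e.injective, fun v => by rw [ndeg_comap_equiv]; exact h.2 (e v)⟩

theorem comap_mem_connPlanar [Finite V] [Finite W] (e : V ≃ W) {d D : ℤ} {G : SimpleGraph W}
    (h : G ∈ connPlanar W d D) : G.comap e ∈ connPlanar V d D :=
  ⟨comap_mem_boundedPlanar e h.1, (SimpleGraph.Iso.comap e G).connected_iff.2 h.2⟩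

theorem comap_equiv_injective (e : V ≃ W) :
    Function.Injective fun G : SimpleGraph W => G.comap e := by
  intro G H h
  ext x y
  have : (G.comap e).Adj (e.symm x) (e.symm y) ↔ (H.comap e).Adj (e.symm x) (e.symm y) := by
    simp only at h
    rw [h]
  simpa using this

theorem ncard_boundedPlanar_congr [Finite V] [Finite W] (e : V ≃ W) (d D : ℤ) :
    (boundedPlanar V d D).ncard = (boundedPlanar W d D).ncard :=
  le_antisymm
    (Set.ncard_le_ncard_of_injOn _ (fun _ h => comap_mem_boundedPlanar e.symm h)
      (comap_equiv_injective e.symm).injOn (Set.toFinite _))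
    (Set.ncard_le_ncard_of_injOn _ (fun _ h => comap_mem_boundedPlanar e h)
      (comap_equiv_injective e).injOn (Set.toFinite _))

theorem ncard_connPlanar_congr [Finite V] [Finite W] (e : V ≃ W) (d D : ℤ) :
    (connPlanar V d D).ncard = (connPlanar W d D).ncard :=
  le_antisymm
    (Set.ncard_le_ncard_of_injOn _ (fun _ h => comap_mem_connPlanar e.symm h)
      (comap_equiv_injective e.symm).injOn (Set.toFinite _))
    (Set.ncard_le_ncard_of_injOn _ (fun _ h => comap_mem_connPlanar e h)
      (comap_equiv_injective e).injOn (Set.toFinite _))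

theorem boundedPlanar_mono {d D D' : ℤ} (h : D ≤ D') :
    boundedPlanar V d D ⊆ boundedPlanar V d D' :=
  fun _ hG => ⟨hG.1, fun v => ⟨(hG.2 v).1, (hG.2 v).2.trans h⟩⟩

theorem connPlanar_mono {d D D' : ℤ} (h : D ≤ D') : connPlanar V d D ⊆ connPlanar V d D' :=
  fun _ hG => ⟨boundedPlanar_mono h hG.1, hG.2⟩

theorem boundedPlanar_eq_of_card_le [Finite V] {d D D' : ℤ} (h : (Nat.card V : ℤ) ≤ D)
    (h' : (Nat.card V : ℤ) ≤ D') : boundedPlanar V d D = boundedPlanar V d D' := by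
  have key : ∀ {D D' : ℤ}, (Nat.card V : ℤ) ≤ D' → boundedPlanar V d D ⊆ boundedPlanar V d D' :=
    fun h G hG => ⟨hG.1, fun v => ⟨(hG.2 v).1, by have := ndeg_lt_card G v; omega⟩⟩
  exact (key h').antisymm (key h)

theorem connPlanar_eq_of_card_le [Finite V] {d D D' : ℤ} (h : (Nat.card V : ℤ) ≤ D)
    (h' : (Nat.card V : ℤ) ≤ D') : connPlanar V d D = connPlanar V d D' := by
  rw [connPlanar, connPlanar, boundedPlanar_eq_of_card_le h h']

end Classes

/-! ### Degrees, planarity and recognition of an inserted block. -/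

section InsertBlock

variable {V U W : Type} {G : SimpleGraph V} {J : SimpleGraph U} {e : Sym2 V} {c : U}

theorem ndeg_insertBlock_inl_of_notMem {v : V} (hv : v ∉ e) :
    ndeg (insertBlock G J e c) (Sum.inl v) = ndeg G v := by
  rw [ndeg, ndeg, ← Set.ncard_image_of_injective (G.neighborSet v) (Sum.inl_injective (β := U))]
  congr 1
  ext (x | x)
  · simp only [SimpleGraph.mem_neighborSet, insertBlock_inl_inl, Set.mem_image, Sum.inl.injEq,
      exists_eq_right, and_iff_left_iff_imp]
    rintro - rfl
    exact hv (Sym2.mem_mk_left _ _)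
  · simp [hv]

theorem ndeg_insertBlock_inl_diag [Finite V] [Finite U] {v : V} :
    ndeg (insertBlock G J s(v, v) c) (Sum.inl v) = ndeg G v + 1 := by
  rw [ndeg, ndeg, ← Set.ncard_image_of_injective (G.neighborSet v) (Sum.inl_injective (β := U)),
    ← Set.ncard_insert_of_notMem (a := Sum.inr c) (by simp) (Set.toFinite _)]
  congr 1
  ext (x | x)
  · simp only [SimpleGraph.mem_neighborSet, insertBlock_inl_inl, Set.mem_insert_iff, reduceCtorEq,
      Set.mem_image, Sum.inl.injEq, exists_eq_right, false_or, and_iff_left_iff_imp]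
    intro h h'
    exact h.ne (by simpa using h'.symm)
  · simp

theorem ndeg_insertBlock_inl_edge [Finite V] [Finite U] {v w : V} (h : G.Adj v w) :
    ndeg (insertBlock G J s(v, w) c) (Sum.inl v) = ndeg G v := by
  have h1 : (G.neighborSet v \ {w}).ncard + 1 = ndeg G v :=
    Set.ncard_sdiff_singleton_add_one h (Set.toFinite _)
  rw [ndeg, ← h1, ← Set.ncard_image_of_injective (G.neighborSet v \ {w}) (Sum.inl_injective (β := U)),
    ← Set.ncard_insert_of_notMem (a := Sum.inr c) (by simp) (Set.toFinite _)]
  congr 1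
  ext (x | x)
  · simp only [SimpleGraph.mem_neighborSet, insertBlock_inl_inl, ne_eq, Sym2.eq_iff,
      Set.mem_insert_iff, reduceCtorEq, Set.mem_image, Set.mem_sdiff, Set.mem_singleton_iff,
      Sum.inl.injEq, exists_eq_right, false_or, and_congr_right_iff]
    grind
  · simp

theorem ndeg_insertBlock_inl [Finite V] [Finite U] (he : e ∈ G.edgeSet ∨ e.IsDiag) (v : V) :
    ndeg (insertBlock G J e c) (Sum.inl v) = ndeg G v ∨
      (e = s(v, v) ∧ ndeg (insertBlock G J e c) (Sum.inl v) = ndeg G v + 1) := by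
  by_cases hv : v ∈ e
  · obtain ⟨w, rfl⟩ := hv
    rcases he with he | he
    · exact Or.inl (ndeg_insertBlock_inl_edge he)
    · obtain rfl : v = w := he
      exact Or.inr ⟨rfl, ndeg_insertBlock_inl_diag⟩
  · exact Or.inl (ndeg_insertBlock_inl_of_notMem hv)

theorem ndeg_insertBlock_inr_of_ne {u : U} (hu : u ≠ c) :
    ndeg (insertBlock G J e c) (Sum.inr u) = ndeg J u := by
  rw [ndeg, ndeg, ← Set.ncard_image_of_injective (J.neighborSet u) (Sum.inr_injective (α := V))]
  congr 1
  ext (x | x)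
  · simp [hu]
  · simp

theorem ndeg_insertBlock_center [Finite V] [Finite U] :
    ndeg (insertBlock G J e c) (Sum.inr c) = ndeg J c + {v | v ∈ e}.ncard := by
  rw [ndeg, ndeg, ← Set.ncard_image_of_injective (J.neighborSet c) (Sum.inr_injective (α := V)),
    ← Set.ncard_image_of_injective {v | v ∈ e} (Sum.inl_injective (β := U)),
    ← Set.ncard_union_eq]
  · congr 1
    ext (x | x)
    · simp
    · simp
  · rw [Set.disjoint_left]
    rintro _ ⟨x, -, rfl⟩ ⟨y, -, h⟩
    cases h

theorem ncard_mem_sym2 (e : Sym2 V) : 1 ≤ {v | v ∈ e}.ncard ∧ {v | v ∈ e}.ncard ≤ 2 := by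
  induction e using Sym2.ind with | _ v w
  have : {x | x ∈ s(v, w)} = ({v, w} : Set V) := by
    ext x; simp
  rw [this]
  exact ⟨Nat.succ_le_of_lt ((Set.ncard_pos (Set.toFinite _)).2 ⟨v, by simp⟩),
    (Set.ncard_insert_le _ _).trans (by rw [Set.ncard_singleton])⟩

theorem IsPlanar.insertBlock [Finite V] [Finite U] (hG : IsPlanar G) (hJ : IsPlanar J)
    (he : e ∈ G.edgeSet ∨ e.IsDiag) : IsPlanar (insertBlock G J e c) := by
  induction e using Sym2.ind with | _ v w
  rcases he with he | he
  · exact (hG.hasSphereMap.insertBlock_edge hJ.hasSphereMap he c).isPlanar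
  · obtain rfl : v = w := he
    exact (hG.hasSphereMap.insertBlock_diag hJ.hasSphereMap v c).isPlanar

theorem insertBlock_diag_connected (hG : G.Connected) (hJ : J.Connected) (v : V) :
    (insertBlock G J s(v, v) c).Connected := by
  have h1 : ∀ x, (insertBlock G J s(v, v) c).Reachable (Sum.inl v) (Sum.inl x) := by
    intro x
    have := SimpleGraph.reachable_iff_reflTransGen _ _ |>.1 (hG.preconnected v x)
    rw [SimpleGraph.reachable_iff_reflTransGen]
    refine this.lift Sum.inl fun a b hab => ⟨hab, ?_⟩
    intro h
    rw [Sym2.eq_iff] at h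
    have := hab.ne
    grind
  have h2 : ∀ x, (insertBlock G J s(v, v) c).Reachable (Sum.inr c) (Sum.inr x) := by
    intro x
    have := SimpleGraph.reachable_iff_reflTransGen _ _ |>.1 (hJ.preconnected c x)
    rw [SimpleGraph.reachable_iff_reflTransGen]
    exact this.lift Sum.inr fun a b hab => hab
  have h3 : (insertBlock G J s(v, v) c).Adj (Sum.inl v) (Sum.inr c) := by simp
  rw [SimpleGraph.connected_iff_exists_forall_reachable]
  refine ⟨Sum.inl v, ?_⟩
  rintro (x | x)
  · exact h1 x
  · exact h3.reachable.trans (h2 x)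

/-- `S` is connected, contains `x`, and the edges of `H` leaving `S` end in `K`. -/
structure IsBlock (H : SimpleGraph W) (S : Set W) (x : W) (K : Set W) : Prop where
  mem : x ∈ S
  conn : ∀ z ∈ S, Relation.ReflTransGen (fun u w => H.Adj u w ∧ w ∈ S) x z
  out : ∀ u ∈ S, ∀ w ∉ S, H.Adj u w → w ∈ K
  disj : ∀ k ∈ K, k ∉ S

/-- A walk in `S` from `x` can leave `S'` only into `K`, which `S` avoids. Hence a block can be
recovered from its root and its outer neighbours. -/
theorem IsBlock.subset {H : SimpleGraph W} {S S' : Set W} {x : W} {K : Set W}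
    (h : IsBlock H S x K) (h' : IsBlock H S' x K) : S ⊆ S' := by
  have key : ∀ z, Relation.ReflTransGen (fun u w => H.Adj u w ∧ w ∈ S) x z → z ∈ S' := by
    intro z hz
    induction hz with
    | refl => exact h'.mem
    | tail _ h2 ih =>
      by_contra hw
      exact h.disj _ (h'.out _ ih _ hw h2.1) h2.2
  exact fun z hz => key z (h.conn z hz)

theorem IsBlock.unique {H : SimpleGraph W} {S S' : Set W} {x : W} {K : Set W}
    (h : IsBlock H S x K) (h' : IsBlock H S' x K) : S = S' :=
  (h.subset h').antisymm (h'.subset h)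

theorem isBlock_insertBlock (hJ : J.Connected) (ψ : V ⊕ U ≃ W) :
    IsBlock ((insertBlock G J e c).comap ψ.symm) (Set.range fun u => ψ (Sum.inr u))
      (ψ (Sum.inr c)) ((fun v => ψ (Sum.inl v)) '' {v | v ∈ e}) where
  mem := ⟨c, rfl⟩
  conn := by
    rintro _ ⟨u, rfl⟩
    have := SimpleGraph.reachable_iff_reflTransGen _ _ |>.1 (hJ.preconnected c u)
    refine this.lift (fun u => ψ (Sum.inr u)) fun a b hab => ⟨?_, ⟨b, rfl⟩⟩
    simpa using hab
  out := by
    rintro _ ⟨u, rfl⟩ w hw h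
    obtain ⟨(v | v), rfl⟩ := ψ.surjective w
    · simp only [SimpleGraph.comap_adj, Equiv.symm_apply_apply, insertBlock_inr_inl] at h
      exact ⟨v, h.1, rfl⟩
    · exact absurd ⟨v, rfl⟩ hw
  disj := by
    rintro _ ⟨v, -, rfl⟩ ⟨u, hu⟩
    exact absurd (ψ.injective hu) Sum.inr_ne_inl

end InsertBlock

/-! ### Supermultiplicativity for connected graphs. -/

section Join

/-- Only graphs that are regular of degree `D` have no room for another edge. As `D ≥ 3` they are
not trees, so some edge is not a bridge and can be deleted; `d < D` leaves the degrees admissible.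
The case `u = w` encodes that nothing was deleted. -/
theorem exists_spot {V : Type} [Finite V] {d D : ℤ} (hd : d < D) (hD : 3 ≤ D) (G : SimpleGraph V)
    (hG : G ∈ connPlanar V d D) : ∃ (G₀ : SimpleGraph V) (a u w : V), G₀ ∈ connPlanar V d D ∧
      (ndeg G₀ a : ℤ) < D ∧ G = G₀ ⊔ SimpleGraph.edge u w := by
  have := Fintype.ofFinite V
  by_cases h : ∃ a, (ndeg G a : ℤ) < D
  · obtain ⟨a, ha⟩ := h
    exact ⟨G, a, a, a, hG, ha, by simp⟩
  · push Not at h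
    have hdeg : ∀ v, (ndeg G v : ℤ) = D := fun v => le_antisymm (hG.1.2 v).2 (h v)
    have hnb : ∃ u w, G.Adj u w ∧ ¬ G.IsBridge s(u, w) := by
      by_contra! hb
      have hac : G.IsAcyclic := SimpleGraph.isAcyclic_iff_forall_isBridge.2 fun e he => by
        induction e using Sym2.ind with | _ u w
        exact hb u w he
      have htree := (SimpleGraph.isTree_iff_connected_and_card.1 ⟨hG.2, hac⟩).2
      rw [Nat.card_coe_set_eq] at htree
      have hsum := sum_ndeg G
      have h3 : 3 * Fintype.card V ≤ ∑ v, ndeg G v := by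
        rw [mul_comm, ← smul_eq_mul, ← Finset.card_univ]
        refine Finset.card_nsmul_le_sum _ _ _ fun v _ => ?_
        have := hdeg v
        omega
      rw [Nat.card_eq_fintype_card] at htree
      omega
    obtain ⟨u, w, huw, hbr⟩ := hnb
    have hadj : ∀ x y, (G.deleteEdges {s(u, w)}).Adj x y ↔ G.Adj x y ∧ s(x, y) ≠ s(u, w) := by
      intro x y
      simp [SimpleGraph.deleteEdges_adj]
    have hle : ∀ v, ndeg (G.deleteEdges {s(u, w)}) v ≤ ndeg G v := fun v =>
      Set.ncard_le_ncard (fun x hx => ((hadj v x).1 hx).1) (Set.toFinite _)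
    have hge : ∀ v, ndeg G v ≤ ndeg (G.deleteEdges {s(u, w)}) v + 1 := by
      intro v
      classical
      have hsub : G.neighborSet v ⊆ insert (if v = u then w else u)
          ((G.deleteEdges {s(u, w)}).neighborSet v) := by
        intro x hx
        by_cases hx' : s(v, x) = s(u, w)
        · left
          rw [Sym2.eq_iff] at hx'
          have := huw.ne
          split_ifs <;> grind
        · exact Or.inr ((hadj v x).2 ⟨hx, hx'⟩)
      exact (Set.ncard_le_ncard hsub (Set.toFinite _)).trans (Set.ncard_insert_le _ _)
    refine ⟨G.deleteEdges {s(u, w)}, u, u, w,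
      ⟨⟨hG.1.1.mono (G.deleteEdges_le _), fun v => ?_⟩,
        hG.2.connected_delete_edge_of_not_isBridge hbr⟩, ?_, ?_⟩
    · have h1 := hle v
      have h2 := hge v
      have h3 := hdeg v
      omega
    · have : ndeg (G.deleteEdges {s(u, w)}) u < ndeg G u := by
        refine Set.ncard_lt_ncard ⟨fun x hx => ((hadj u x).1 hx).1, fun hsub => ?_⟩ (Set.toFinite _)
        exact ((hadj u w).1 (hsub huw)).2 rfl
      have h3 := hdeg u
      omega
    · ext x y
      rw [SimpleGraph.sup_adj, hadj, SimpleGraph.edge_adj, Ne, Sym2.eq_iff]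
      constructor
      · intro hxy
        have := hxy.ne
        tauto
      · rintro (h | ⟨⟨rfl, rfl⟩ | ⟨rfl, rfl⟩, -⟩)
        · exact h.1
        · exact huw
        · exact huw.symm

variable {m n : ℕ}

theorem card_compl_of_card (S : {S : Finset (Fin (m + n)) // S.card = m}) : S.1ᶜ.card = n := by
  rw [Finset.card_compl, S.2, Fintype.card_fin]
  omega

/-- The order-preserving identification of `Fin m ⊕ Fin n` with a set `S` and its complement. -/
def splitEquiv (S : {S : Finset (Fin (m + n)) // S.card = m}) : Fin m ⊕ Fin n ≃ Fin (m + n) :=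
  finSumEquivOfFinset S.2 (card_compl_of_card S)

theorem range_splitEquiv_inr (S : {S : Finset (Fin (m + n)) // S.card = m}) :
    (Set.range fun u => splitEquiv S (Sum.inr u)) = ((S.1ᶜ : Finset _) : Set (Fin (m + n))) :=
  Finset.range_orderEmbOfFin _ (card_compl_of_card S)

theorem splitEquiv_inl_strictMono (S : {S : Finset (Fin (m + n)) // S.card = m}) :
    StrictMono fun u => splitEquiv S (Sum.inl u) :=
  (Finset.orderEmbOfFin _ S.2).strictMono

theorem splitEquiv_inr_strictMono (S : {S : Finset (Fin (m + n)) // S.card = m}) :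
    StrictMono fun u => splitEquiv S (Sum.inr u) :=
  (Finset.orderEmbOfFin _ (card_compl_of_card S)).strictMono

theorem join_mem_connPlanar {V U : Type} [Finite V] [Finite U] {d D : ℤ} {G : SimpleGraph V}
    {J : SimpleGraph U} (hG : G ∈ connPlanar V d D) (hJ : J ∈ connPlanar U d D) {a : V} {c : U}
    (ha : (ndeg G a : ℤ) < D) (hc : (ndeg J c : ℤ) < D) :
    insertBlock G J s(a, a) c ∈ connPlanar (V ⊕ U) d D := by
  refine ⟨⟨hG.1.1.insertBlock hJ.1.1 (Or.inr rfl), ?_⟩, insertBlock_diag_connected hG.2 hJ.2 a⟩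
  rintro (v | u)
  · have h1 := hG.1.2 v
    rcases ndeg_insertBlock_inl (G := G) (J := J) (c := c) (e := s(a, a)) (Or.inr rfl) v with h | ⟨h, h'⟩
    · rw [h]; exact h1
    · obtain rfl : a = v := by simpa using h
      rw [h']
      push_cast
      omega
  · have h1 := hJ.1.2 u
    by_cases hu : u = c
    · rw [hu, ndeg_insertBlock_center]
      have h2 : {v | v ∈ s(a, a)}.ncard = 1 := by
        rw [Set.ncard_eq_one]
        exact ⟨a, by ext; simp⟩
      rw [h2]
      rw [hu] at h1
      push_cast
      omega
    · rw [ndeg_insertBlock_inr_of_ne hu]; exact h1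

/-- Connected graphs can be joined by an edge. -/
theorem choose_mul_ncard_connPlanar_le (m n : ℕ) {d D : ℤ} (hd : d < D) (hD : 3 ≤ D) :
    (m + n).choose m * (connPlanar (Fin m) d D).ncard * (connPlanar (Fin n) d D).ncard ≤
      (m + n) ^ 6 * (connPlanar (Fin (m + n)) d D).ncard := by
  choose g₁ a₁ u₁ w₁ hg₁ ha₁ he₁ using exists_spot (V := Fin m) hd hD
  choose g₂ a₂ u₂ w₂ hg₂ ha₂ he₂ using exists_spot (V := Fin n) hd hD
  let Obj := {S : Finset (Fin (m + n)) // S.card = m} × connPlanar (Fin m) d D ×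
    connPlanar (Fin n) d D
  -- Besides the joined graph, the code records the ends of the joining edge and the edge deleted on
  -- each side: six vertices, hence the factor `(m + n) ^ 6`.
  let F : Obj → connPlanar (Fin (m + n)) d D × (Fin (m + n) × Fin (m + n)) × (Fin m × Fin m) ×
      (Fin n × Fin n) := fun o =>
    (⟨(insertBlock (g₁ _ o.2.1.2) (g₂ _ o.2.2.2) s(a₁ _ o.2.1.2, a₁ _ o.2.1.2)
      (a₂ _ o.2.2.2)).comap (splitEquiv o.1).symm, comap_mem_connPlanar _
        (join_mem_connPlanar (hg₁ _ _) (hg₂ _ _) (ha₁ _ _) (ha₂ _ _))⟩,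
      (splitEquiv o.1 (Sum.inl (a₁ _ o.2.1.2)), splitEquiv o.1 (Sum.inr (a₂ _ o.2.2.2))),
      (u₁ _ o.2.1.2, w₁ _ o.2.1.2), (u₂ _ o.2.2.2, w₂ _ o.2.2.2))
  have hF : Function.Injective F := by
    rintro ⟨S, ⟨G, hG⟩, ⟨J, hJ⟩⟩ ⟨S', ⟨G', hG'⟩, ⟨J', hJ'⟩⟩ h
    simp only [F, Prod.mk.injEq, Subtype.mk.injEq] at h
    obtain ⟨h1, ⟨h2, h3⟩, ⟨h4, h5⟩, h6, h7⟩ := h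
    have b1 := isBlock_insertBlock (G := g₁ G hG) (e := s(a₁ G hG, a₁ G hG)) (c := a₂ J hJ)
      (hg₂ J hJ).2 (splitEquiv S)
    have b2 := isBlock_insertBlock (G := g₁ G' hG') (e := s(a₁ G' hG', a₁ G' hG')) (c := a₂ J' hJ')
      (hg₂ J' hJ').2 (splitEquiv S')
    have hK : ∀ (S : {S : Finset (Fin (m + n)) // S.card = m}) (a : Fin m),
        (fun v => splitEquiv S (Sum.inl v)) '' {v | v ∈ s(a, a)} = {splitEquiv S (Sum.inl a)} := by
      intro S a
      have : {v | v ∈ s(a, a)} = {a} := by ext; simp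
      rw [this, Set.image_singleton]
    rw [hK, h1, h2, h3] at b1
    rw [hK] at b2
    have hS := b1.unique b2
    rw [range_splitEquiv_inr, range_splitEquiv_inr, Finset.coe_inj, compl_inj_iff] at hS
    obtain rfl : S = S' := Subtype.ext hS
    have h8 := comap_equiv_injective _ h1
    have h2' : a₁ G hG = a₁ G' hG' := Sum.inl_injective ((splitEquiv S).injective h2)
    have h9 : g₁ G hG = g₁ G' hG' := by
      ext x y
      have h9 : (insertBlock (g₁ G hG) (g₂ J hJ) s(a₁ G hG, a₁ G hG) (a₂ J hJ)).Adj (Sum.inl x)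
          (Sum.inl y) ↔ (insertBlock (g₁ G' hG') (g₂ J' hJ') s(a₁ G' hG', a₁ G' hG')
            (a₂ J' hJ')).Adj (Sum.inl x) (Sum.inl y) := by rw [h8]
      rw [insertBlock_inl_inl, insertBlock_inl_inl, ← h2'] at h9
      by_cases hxy : x = y
      · rw [hxy]
        exact iff_of_false ((g₁ G hG).loopless.irrefl _) ((g₁ G' hG').loopless.irrefl _)
      · have : s(x, y) ≠ s(a₁ G hG, a₁ G hG) := by
          intro h
          rw [Sym2.eq_iff] at h
          grind
        simpa [this] using h9
    have h10 : g₂ J hJ = g₂ J' hJ' := by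
      ext x y
      have h9 : (insertBlock (g₁ G hG) (g₂ J hJ) s(a₁ G hG, a₁ G hG) (a₂ J hJ)).Adj (Sum.inr x)
          (Sum.inr y) ↔ (insertBlock (g₁ G' hG') (g₂ J' hJ') s(a₁ G' hG', a₁ G' hG')
            (a₂ J' hJ')).Adj (Sum.inr x) (Sum.inr y) := by rw [h8]
      simpa using h9
    have h11 : G = G' := by rw [he₁ G hG, he₁ G' hG', h9, h4, h5]
    have h12 : J = J' := by rw [he₂ J hJ, he₂ J' hJ', h10, h6, h7]
    subst h11 h12
    rfl
  have hcard := Nat.card_le_card_of_injective F hF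
  simp only [Obj, Nat.card_prod, Nat.card_coe_set_eq, Nat.card_eq_fintype_card (α := Fin _),
    Fintype.card_fin] at hcard
  rw [Nat.card_eq_fintype_card, Fintype.card_finset_len, Fintype.card_fin] at hcard
  calc _ = (m + n).choose m * ((connPlanar (Fin m) d D).ncard * (connPlanar (Fin n) d D).ncard) := by
        ring
    _ ≤ _ := hcard
    _ ≤ (connPlanar (Fin (m + n)) d D).ncard * ((m + n) * (m + n) *
        ((m + n) * (m + n) * ((m + n) * (m + n)))) := by gcongr <;> omega
    _ = _ := by ring

end Join

/-! ### Decomposition by the component of a vertex. -/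

section Components

theorem induce_mem_boundedPlanar {V : Type} [Finite V] {d D : ℤ} {G : SimpleGraph V}
    (hG : G ∈ boundedPlanar V d D) (p : V → Prop) (hp : ∀ v w, G.Adj v w → p v → p w) :
    G.comap (Subtype.val : {v // p v} → V) ∈ boundedPlanar {v // p v} d D := by
  refine ⟨hG.1.comap Subtype.val_injective, fun v => ?_⟩
  have : ndeg (G.comap (Subtype.val : {v // p v} → V)) v = ndeg G v := by
    rw [ndeg, ndeg, ← Set.ncard_image_of_injective _ Subtype.val_injective]
    congr 1
    ext w
    constructor
    · rintro ⟨x, hx, rfl⟩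
      exact hx
    · intro hw
      exact ⟨⟨w, hp _ _ hw v.2⟩, hw, rfl⟩
  rw [this]
  exact hG.2 v

theorem ncard_boundedPlanar_component_le {n : ℕ} (d D : ℤ) (S : Finset (Fin (n + 1)))
    (h0 : 0 ∈ S) : {G ∈ boundedPlanar (Fin (n + 1)) d D | ∀ z, z ∈ S ↔ G.Reachable 0 z}.ncard ≤
      (connPlanar (Fin S.card) d D).ncard * (boundedPlanar (Fin (n + 1 - S.card)) d D).ncard := by
  have e1 : {v // v ∈ S} ≃ Fin S.card := S.equivFin
  have e2 : {v // v ∉ S} ≃ Fin (n + 1 - S.card) :=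
    Fintype.equivFinOfCardEq (by rw [Fintype.card_subtype_compl, Fintype.card_coe, Fintype.card_fin])
  rw [← ncard_connPlanar_congr e1, ← ncard_boundedPlanar_congr e2, ← Set.ncard_prod]
  refine Set.ncard_le_ncard_of_injOn
    (fun G => (G.comap Subtype.val, G.comap Subtype.val)) ?_ ?_ (Set.toFinite _)
  · rintro G ⟨hG, hS⟩
    have hcl : ∀ v w, G.Adj v w → v ∈ S → w ∈ S := fun v w hvw hv =>
      (hS w).2 (((hS v).1 hv).trans hvw.reachable)
    refine ⟨⟨induce_mem_boundedPlanar hG _ hcl, ?_⟩,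
      induce_mem_boundedPlanar hG (fun v => v ∉ S) fun v w hvw hv hw => hv (hcl w v hvw.symm hw)⟩
    rw [SimpleGraph.connected_iff_exists_forall_reachable]
    refine ⟨⟨0, h0⟩, ?_⟩
    have key : ∀ z, Relation.ReflTransGen G.Adj 0 z → ∀ hz : z ∈ S,
        (G.comap (Subtype.val : {v // v ∈ S} → _)).Reachable ⟨0, h0⟩ ⟨z, hz⟩ := by
      intro z h
      induction h with
      | refl => exact fun _ => SimpleGraph.Reachable.refl _
      | @tail b c _ hbc ih =>
        intro hz
        have hb := hcl _ _ hbc.symm hz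
        have hadj : (G.comap (Subtype.val : {v // v ∈ S} → _)).Adj ⟨b, hb⟩ ⟨c, hz⟩ := hbc
        exact (ih hb).trans hadj.reachable
    rintro ⟨z, hz⟩
    exact key z ((SimpleGraph.reachable_iff_reflTransGen _ _).1 ((hS z).1 hz)) hz
  · rintro G ⟨hG, hS⟩ H ⟨hH, hS'⟩ h
    simp only [Prod.mk.injEq] at h
    have hcl : ∀ v w, G.Adj v w → v ∈ S → w ∈ S := fun v w hvw hv =>
      (hS w).2 (((hS v).1 hv).trans hvw.reachable)
    have hcl' : ∀ v w, H.Adj v w → v ∈ S → w ∈ S := fun v w hvw hv =>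
      (hS' w).2 (((hS' v).1 hv).trans hvw.reachable)
    ext x y
    by_cases hx : x ∈ S <;> by_cases hy : y ∈ S
    · have : (G.comap (Subtype.val : {v // v ∈ S} → _)).Adj ⟨x, hx⟩ ⟨y, hy⟩ ↔
        (H.comap (Subtype.val : {v // v ∈ S} → _)).Adj ⟨x, hx⟩ ⟨y, hy⟩ := by rw [h.1]
      exact this
    · exact iff_of_false (fun h => hy (hcl _ _ h hx)) (fun h => hy (hcl' _ _ h hx))
    · exact iff_of_false (fun h => hx (hcl _ _ h.symm hy)) (fun h => hx (hcl' _ _ h.symm hy))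
    · have : (G.comap (Subtype.val : {v // v ∉ S} → _)).Adj ⟨x, hx⟩ ⟨y, hy⟩ ↔
        (H.comap (Subtype.val : {v // v ∉ S} → _)).Adj ⟨x, hx⟩ ⟨y, hy⟩ := by rw [h.2]
      exact this

/-- Recursion on the component of the first vertex. -/
theorem ncard_boundedPlanar_succ_le (n : ℕ) (d D : ℤ) :
    (boundedPlanar (Fin (n + 1)) d D).ncard ≤ ∑ j ∈ Finset.range (n + 1),
      n.choose j * ((connPlanar (Fin (j + 1)) d D).ncard * (boundedPlanar (Fin (n - j)) d D).ncard) := by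
  classical
  let f : ℕ → ℕ := fun j =>
    (connPlanar (Fin (j + 1)) d D).ncard * (boundedPlanar (Fin (n - j)) d D).ncard
  let x : Finset (Fin (n + 1)) := Finset.univ.erase 0
  have hx : x.card = n := by simp [x]
  have h1 : boundedPlanar (Fin (n + 1)) d D ⊆ ⋃ T ∈ x.powerset,
      {G ∈ boundedPlanar (Fin (n + 1)) d D | ∀ z, z ∈ insert 0 T ↔ G.Reachable 0 z} := by
    intro G hG
    simp only [Set.mem_iUnion]
    refine ⟨(Finset.univ.filter fun z => G.Reachable 0 z).erase 0, ?_, hG, fun z => ?_⟩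
    · rw [Finset.mem_powerset]
      exact Finset.erase_subset_erase _ (Finset.subset_univ _)
    · rw [Finset.insert_erase]
      · simp
      · simp
  refine (Set.ncard_le_ncard h1 (Set.toFinite _)).trans ?_
  refine (Finset.set_ncard_biUnion_le _ _).trans ?_
  have h2 := Finset.sum_powerset_apply_card f (x := x)
  rw [hx] at h2
  simp only [smul_eq_mul] at h2
  rw [← h2]
  refine Finset.sum_le_sum fun T hT => ?_
  have h0 : (0 : Fin (n + 1)) ∉ T := fun h => by
    have := Finset.mem_powerset.1 hT h
    simp [x] at this
  have := ncard_boundedPlanar_component_le d D (insert 0 T) (Finset.mem_insert_self _ _)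
  rw [Finset.card_insert_of_notMem h0, Nat.add_sub_add_right] at this
  simpa [f] using this

end Components

end RandomPlanar
namespace RandomPlanar

/-! ### The blocks: a centre with pendant copies of `H`. -/

section Spider

variable {h : ℕ} [NeZero h]

/-- There is a planar graph consisting of a vertex `c` joined to the first vertices of `s` disjoint
copies of `H`. One of the copies is singled out by `ε`. -/
theorem exists_spider {H : SimpleGraph (Fin h)} (hc : H.Connected) (hp : IsPlanar H) (s : ℕ) :
    ∃ (J : SimpleGraph (Fin (1 + s * h))) (c : Fin (1 + s * h)), IsPlanar J ∧ J.Connected ∧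
      ndeg J c = s ∧ (∀ u, u ≠ c → (∃ i, ndeg J u = ndeg H i) ∨ ndeg J u = ndeg H 0 + 1) ∧
      (0 < s → ∃ ε : Fin h → Fin (1 + s * h), StrictMono ε ∧ (∀ i, ε i ≠ c) ∧
        (∀ i j, J.Adj (ε i) (ε j) ↔ H.Adj i j) ∧
        (∀ i u, u ∉ Set.range ε → (J.Adj (ε i) u ↔ i = 0 ∧ u = c)) ∧
        ndeg J (ε 0) = ndeg H 0 + 1) := by
  induction s with
  | zero =>
    have hsub : Subsingleton (Fin (1 + 0 * h)) := by
      rw [zero_mul]; exact inferInstanceAs (Subsingleton (Fin 1))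
    have hnon : Nonempty (Fin (1 + 0 * h)) := ⟨⟨0, by omega⟩⟩
    refine ⟨⊥, ⟨0, by omega⟩, ?_, ?_, ?_, ?_, ?_⟩
    · refine HasSphereMap.isPlanar ⟨Unit, inferInstance, 1, 1, fun _ _ => (), fun _ => rfl,
        defect_unit, fun _ _ _ _ h => absurd h ?_, fun _ _ h => absurd h ?_⟩ <;> simp
    · exact { preconnected := fun u v => by rw [Subsingleton.elim u v] }
    · rw [ndeg, Set.ncard_eq_zero]
      ext; simp
    · intro u hu
      exact absurd (Subsingleton.elim _ _) hu
    · intro h0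
      exact absurd h0 (lt_irrefl 0)
  | succ s ih =>
    obtain ⟨J, c, hJp, hJc, hJd, hJu, -⟩ := ih
    let ψ : Fin (1 + s * h) ⊕ Fin h ≃ Fin (1 + (s + 1) * h) :=
      finSumFinEquiv.trans (finCongr (by ring))
    have hψ : ∀ i : Fin h, (ψ (Sum.inr i) : ℕ) = 1 + s * h + i := fun i => by simp [ψ]
    have hdeg : ∀ x, ndeg ((insertBlock J H s(c, c) 0).comap ψ.symm) (ψ x) =
        ndeg (insertBlock J H s(c, c) 0) x := fun x => by
      rw [ndeg_comap_equiv, Equiv.symm_apply_apply]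
    have hcc : {v | v ∈ s(c, c)}.ncard = 1 := by
      rw [Set.ncard_eq_one]
      exact ⟨c, by ext; simp⟩
    have hroot : ndeg (insertBlock J H s(c, c) 0) (Sum.inr 0) = ndeg H 0 + 1 := by
      rw [ndeg_insertBlock_center, hcc]
    refine ⟨(insertBlock J H s(c, c) 0).comap ψ.symm, ψ (Sum.inl c),
      (IsPlanar.insertBlock (e := s(c, c)) hJp hp (Or.inr rfl)).comap ψ.symm.injective,
      (SimpleGraph.Iso.comap ψ.symm _).connected_iff.2 (insertBlock_diag_connected hJc hc c), ?_, ?_,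
      fun _ => ⟨fun i => ψ (Sum.inr i), ?_, ?_, ?_, ?_, ?_⟩⟩
    · rw [hdeg, ndeg_insertBlock_inl_diag, hJd]
    · intro u hu
      obtain ⟨(v | v), rfl⟩ := ψ.surjective u
      · rw [hdeg, ndeg_insertBlock_inl_of_notMem]
        · exact hJu v fun h => hu (by rw [h])
        · rw [Sym2.mem_iff, or_self]
          exact fun h => hu (by rw [h])
      · rw [hdeg]
        by_cases hv : v = 0
        · rw [hv]; exact Or.inr hroot
        · exact Or.inl ⟨v, ndeg_insertBlock_inr_of_ne hv⟩
    · intro i j hij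
      rw [Fin.lt_def, hψ, hψ]
      exact Nat.add_lt_add_left hij _
    · intro i hi
      exact absurd (ψ.injective hi) Sum.inr_ne_inl
    · intro i j
      simp
    · intro i u hu
      obtain ⟨(v | v), rfl⟩ := ψ.surjective u
      · simp only [SimpleGraph.comap_adj, Equiv.symm_apply_apply, insertBlock_inr_inl,
          Sym2.mem_iff, or_self, EmbeddingLike.apply_eq_iff_eq, Sum.inl.injEq]
        exact and_comm
      · exact absurd ⟨v, rfl⟩ hu
    · rw [hdeg, hroot]

/-- With `ndeg H 0` copies the centre has the same degree as the root of `H`, hence an admissible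
one. The order is coprime to `h`, which is what `eventually_pos_of_coprime` needs. -/
theorem spider_mem_connPlanar {H : SimpleGraph (Fin h)} (hc : H.Connected) (hp : IsPlanar H)
    {d D : ℤ} (hd : ∀ i, d ≤ ndeg H i) (hD : ∀ i, (ndeg H i : ℤ) ≤ D)
    (hD0 : (ndeg H 0 : ℤ) + 1 ≤ D) : (connPlanar (Fin (1 + ndeg H 0 * h)) d D).Nonempty := by
  obtain ⟨J, c, h1, h2, h3, h4, -⟩ := exists_spider hc hp (ndeg H 0)
  refine ⟨J, ⟨h1, fun u => ?_⟩, h2⟩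
  have := hd 0
  by_cases hu : u = c
  · rw [hu, h3]
    omega
  · rcases h4 u hu with ⟨i, hi⟩ | hi
    · rw [hi]; exact ⟨hd i, hD i⟩
    · rw [hi]; push_cast; omega

end Spider

/-! ### Double counting and the places for insertion. -/

section Counting

variable {α β : Type} [Finite α] [Finite β]

theorem ncard_dependent_pairs (A : Set α) (B : α → Set β) :
    {p : α × β | p.1 ∈ A ∧ p.2 ∈ B p.1}.ncard = ∑ᶠ a : A, (B a).ncard := by
  classical
  have := Fintype.ofFinite A
  rw [finsum_eq_sum_of_fintype, ← Nat.card_coe_set_eq]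
  rw [show (∑ a : A, (B a).ncard) = Nat.card (Σ a : A, B a) by
    rw [Nat.card_sigma]; rfl]
  exact Nat.card_congr
    ⟨fun p => ⟨⟨p.1.1, p.2.1⟩, ⟨p.1.2, p.2.2⟩⟩, fun q => ⟨(q.1.1, q.2.1), q.1.2, q.2.2⟩,
      fun _ => rfl, fun _ => rfl⟩

theorem ncard_dependent_pairs_le (A : Set α) (B : α → Set β) (b : ℕ)
    (h : ∀ a ∈ A, (B a).ncard ≤ b) : {p : α × β | p.1 ∈ A ∧ p.2 ∈ B p.1}.ncard ≤ A.ncard * b := by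
  classical
  have := Fintype.ofFinite A
  rw [ncard_dependent_pairs, finsum_eq_sum_of_fintype, ← Nat.card_coe_set_eq,
    Nat.card_eq_fintype_card, ← Finset.card_univ, ← smul_eq_mul]
  exact Finset.sum_le_card_nsmul _ _ _ fun a _ => h a a.2

theorem le_ncard_dependent_pairs (A : Set α) (B : α → Set β) (b m : ℕ)
    (h : ∀ a ∈ A, b ≤ m * (B a).ncard) :
    A.ncard * b ≤ m * {p : α × β | p.1 ∈ A ∧ p.2 ∈ B p.1}.ncard := by
  classical
  have := Fintype.ofFinite A
  rw [ncard_dependent_pairs, finsum_eq_sum_of_fintype, ← Nat.card_coe_set_eq,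
    Nat.card_eq_fintype_card, ← Finset.card_univ, ← smul_eq_mul, Finset.mul_sum]
  exact Finset.card_nsmul_le_sum _ _ _ fun a _ => h a a.2

end Counting

section Spots

variable {V : Type}

/-- The places where a block can be inserted: the edges, and the isolated vertices (as loops). -/
def spots (G : SimpleGraph V) : Set (Sym2 V) :=
  {e | e ∈ G.edgeSet ∨ ∃ v, (∀ w, ¬ G.Adj v w) ∧ e = s(v, v)}

/-- Every vertex lies on a spot, and a spot contains at most two vertices. -/
theorem card_le_two_mul_ncard_spots [Finite V] (G : SimpleGraph V) :
    Nat.card V ≤ 2 * (spots G).ncard := by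
  classical
  have := Fintype.ofFinite V
  have hex : ∀ v, ∃ e ∈ spots G, v ∈ e := by
    intro v
    by_cases hv : ∃ w, G.Adj v w
    · obtain ⟨w, hw⟩ := hv
      exact ⟨s(v, w), Or.inl hw, Sym2.mem_mk_left _ _⟩
    · push Not at hv
      exact ⟨s(v, v), Or.inr ⟨v, hv, rfl⟩, Sym2.mem_mk_left _ _⟩
  choose f hf hvf using hex
  rw [Nat.card_eq_fintype_card, ← Finset.card_univ]
  refine (Finset.card_le_mul_card_image (f := f) Finset.univ 2 fun e _ => ?_).trans
    (Nat.mul_le_mul_left 2 ?_)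
  · refine le_trans ?_ (ncard_mem_sym2 e).2
    rw [← Set.ncard_coe_finset]
    refine Set.ncard_le_ncard (fun v hv => ?_) (Set.toFinite _)
    rw [Finset.mem_coe, Finset.mem_filter] at hv
    exact hv.2 ▸ hvf v
  · rw [← Set.ncard_coe_finset]
    refine Set.ncard_le_ncard (fun e he => ?_) (Set.toFinite _)
    obtain ⟨v, -, rfl⟩ := Finset.mem_image.1 (Finset.mem_coe.1 he)
    exact hf v

theorem mem_spots_cases {G : SimpleGraph V} {e : Sym2 V} (he : e ∈ spots G) :
    e ∈ G.edgeSet ∨ e.IsDiag := by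
  rcases he with he | ⟨v, -, rfl⟩
  · exact Or.inl he
  · exact Or.inr rfl

end Spots

/-! ### Insertion of blocks and the number of attachments. -/

section BlockAddition

variable {h n : ℕ}

/-- The vertices outside `W` of the cut-edges of the cut-able appearances of `H` at sets `W`. -/
def attachments (H : SimpleGraph (Fin h)) (d : ℤ) (G : SimpleGraph (Fin n)) : Set (Fin n) :=
  {v | ∃ W r, AppearsAt H G W r v ∧ d < ndeg G r ∧ d < ndeg G v}

theorem AppearsAt.eq_of_eq {H : SimpleGraph (Fin h)} {G : SimpleGraph (Fin n)} {W : Set (Fin n)}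
    {r r' v v' : Fin n} (h1 : AppearsAt H G W r v) (h2 : AppearsAt H G W r' v') : v = v' :=
  (h2.2.2.2 r h1.1.1 v h1.2.2.1.1 h1.2.2.1.2).2

/-- A set `W` determines the outer end of its cut-edge, so attachments inject into appearances. -/
theorem ncard_attachments_le (H : SimpleGraph (Fin h)) (d : ℤ) (G : SimpleGraph (Fin n)) :
    (attachments H d G).ncard ≤ numCutableAppearances H d G := by
  have hex : ∀ v ∈ attachments H d G, ∃ W r, AppearsAt H G W r v ∧ d < ndeg G r ∧ d < ndeg G v :=
    fun v hv => hv
  choose! W r hW using hex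
  refine Set.ncard_le_ncard_of_injOn W (fun v hv => ?_) (fun v hv v' hv' hvv' => ?_) (Set.toFinite _)
  · refine ⟨r v, v, (hW v hv).1, ?_⟩
    rw [← ndeg_eq_degree, ← ndeg_eq_degree]
    exact lt_min (hW v hv).2.1 (hW v hv).2.2
  · have h1 := (hW v hv).1
    have h2 := (hW v' hv').1
    rw [hvv'] at h1
    exact h1.eq_of_eq h2

/-- The graphs of the class with few attachment vertices. -/
def fewAttachments (H : SimpleGraph (Fin h)) (d D : ℤ) (n k : ℕ) : Set (SimpleGraph (Fin n)) :=
  {G ∈ boundedPlanar (Fin n) d D | (attachments H d G).ncard ≤ k}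

variable {q s : ℕ} {H : SimpleGraph (Fin h)} {J : SimpleGraph (Fin q)} {c : Fin q} {d D : ℤ}
  {G : SimpleGraph (Fin n)} {e : Sym2 (Fin n)}

/-- The graph obtained from `G` by inserting the block `J` at `e`, with the vertices of `G`
relabelled increasingly by `S` and those of `J` by the complement. -/
def addBlock (J : SimpleGraph (Fin q)) (c : Fin q) (S : {S : Finset (Fin (n + q)) // S.card = n})
    (G : SimpleGraph (Fin n)) (e : Sym2 (Fin n)) : SimpleGraph (Fin (n + q)) :=
  (insertBlock G J e c).comap (splitEquiv S).symm

variable (S : {S : Finset (Fin (n + q)) // S.card = n})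

theorem addBlock_adj (x y : Fin n ⊕ Fin q) : (addBlock J c S G e).Adj (splitEquiv S x)
    (splitEquiv S y) ↔ (insertBlock G J e c).Adj x y := by
  simp [addBlock]

theorem ndeg_addBlock (x : Fin n ⊕ Fin q) :
    ndeg (addBlock J c S G e) (splitEquiv S x) = ndeg (insertBlock G J e c) x := by
  rw [addBlock, ndeg_comap_equiv, Equiv.symm_apply_apply]

/-- Suppose an appearance at `W` has its outer end outside the block. If `W` met the block it would
swallow it by connectedness, but `q > h`. So `W` avoids the block, and also `e`, since otherwise an
edge would leave `W` towards `c`. Hence the appearance and its cut-ability were already present in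
`G`. -/
theorem attachments_addBlock_subset (hJ : J.Connected) (hq : h < q) (he : e ∈ spots G) :
    attachments H d (addBlock J c S G e) ⊆
      (fun v => splitEquiv S (Sum.inl v)) '' attachments H d G ∪
        Set.range fun u => splitEquiv S (Sum.inr u) := by
  intro x hx
  obtain ⟨(v₀ | u), rfl⟩ := (splitEquiv S).surjective x
  swap
  · exact Or.inr ⟨u, rfl⟩
  refine Or.inl ⟨v₀, ?_, rfl⟩
  obtain ⟨W, r, ⟨hleast, ⟨f, hf, hfW⟩, ⟨hv₀W, hrv₀⟩, hout⟩, hdr, hdv⟩ := hx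
  have hnoblock : ∀ u, splitEquiv S (Sum.inr u) ∉ W := by
    intro u hu
    have hall : ∀ u', splitEquiv S (Sum.inr u') ∈ W := by
      intro u'
      induction (SimpleGraph.reachable_iff_reflTransGen _ _).1 (hJ.preconnected u u') with
      | refl => exact hu
      | @tail a b _ hab ih =>
        by_contra hb
        have h1 := (hout _ ih _ hb ((addBlock_adj S _ _).2 hab)).2
        exact absurd ((splitEquiv S).injective h1) Sum.inr_ne_inl
    have h1 : (Set.range fun u => splitEquiv S (Sum.inr u)).ncard ≤ W.ncard :=
      Set.ncard_le_ncard (by rintro _ ⟨u, rfl⟩; exact hall u) (Set.toFinite _)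
    have h2 : (Set.range fun u => splitEquiv S (Sum.inr u)).ncard = q := by
      rw [← Set.image_univ, Set.ncard_image_of_injective _
        (show Function.Injective fun u => splitEquiv S (Sum.inr u) from
          (splitEquiv S).injective.comp Sum.inr_injective), Set.ncard_univ, Nat.card_eq_fintype_card,
        Fintype.card_fin]
    have h3 : W.ncard = h := by
      rw [← hfW, ← Set.image_univ, Set.ncard_image_of_injective _ f.injective, Set.ncard_univ,
        Nat.card_eq_fintype_card, Fintype.card_fin]
    omega
  have hold : ∀ x ∈ W, ∃ v, splitEquiv S (Sum.inl v) = x := by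
    intro x hx
    obtain ⟨(v | u), rfl⟩ := (splitEquiv S).surjective x
    · exact ⟨v, rfl⟩
    · exact absurd hx (hnoblock u)
  have hspot : ∀ v, splitEquiv S (Sum.inl v) ∈ W → v ∉ e := by
    intro v hv hve
    have h1 := (hout _ hv _ (hnoblock c) ((addBlock_adj S (Sum.inl v) (Sum.inr c)).2 ⟨hve, rfl⟩)).2
    exact absurd ((splitEquiv S).injective h1) Sum.inr_ne_inl
  have hne : ∀ v w, splitEquiv S (Sum.inl v) ∈ W → s(v, w) ≠ e := by
    rintro v w hv rfl
    exact hspot v hv (Sym2.mem_mk_left _ _)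
  have hmono := splitEquiv_inl_strictMono S
  obtain ⟨r₀, rfl⟩ := hold r hleast.1
  have hf' : ∀ i, ∃ v, splitEquiv S (Sum.inl v) = f i := fun i => hold _ (hfW ▸ ⟨i, rfl⟩)
  choose f' hf' using hf'
  have hf'W : ∀ i, splitEquiv S (Sum.inl (f' i)) ∈ W := fun i => by
    rw [hf', ← hfW]; exact ⟨i, rfl⟩
  have hradj : G.Adj r₀ v₀ := ((addBlock_adj S (Sum.inl r₀) (Sum.inl v₀)).1 hrv₀).1
  have hf'm : StrictMono f' := fun i j hij => by
    rw [← hmono.lt_iff_lt]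
    simp only [hf']
    exact hf hij
  refine ⟨{v | splitEquiv S (Sum.inl v) ∈ W}, r₀, ⟨⟨hleast.1, fun v hv => ?_⟩,
    ⟨⟨⟨f', hf'm.injective⟩, ?_⟩, hf'm, ?_⟩, ⟨hv₀W, hradj⟩, ?_⟩, ?_, ?_⟩
  · exact hmono.le_iff_le.1 (hleast.2 hv)
  · intro i j
    have h1 := addBlock_adj (J := J) (c := c) (G := G) (e := e) S (Sum.inl (f' i)) (Sum.inl (f' j))
    rw [hf', hf', f.map_adj_iff, insertBlock_inl_inl, and_iff_left (hne _ _ (hf'W i))] at h1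
    exact h1.symm
  · ext v
    constructor
    · rintro ⟨i, rfl⟩
      exact hf'W i
    · intro hv
      have : splitEquiv S (Sum.inl v) ∈ Set.range f := by rw [hfW]; exact hv
      obtain ⟨i, hi⟩ := this
      refine ⟨i, Sum.inl_injective ((splitEquiv S).injective ?_)⟩
      exact (hf' i).trans hi
  · intro x hx y hy hxy
    obtain ⟨h1, h2⟩ := hout _ hx _ hy
      ((addBlock_adj S (Sum.inl x) (Sum.inl y)).2 ⟨hxy, hne _ _ hx⟩)
    exact ⟨Sum.inl_injective ((splitEquiv S).injective h1),
      Sum.inl_injective ((splitEquiv S).injective h2)⟩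
  · rwa [ndeg_addBlock, ndeg_insertBlock_inl_of_notMem (hspot _ hleast.1)] at hdr
  · rw [ndeg_addBlock] at hdv
    rcases ndeg_insertBlock_inl (J := J) (c := c) (mem_spots_cases he) v₀ with h1 | ⟨h1, -⟩
    · rwa [h1] at hdv
    · rcases he with he | ⟨w, hw, he⟩
      · rw [h1] at he
        exact absurd rfl (SimpleGraph.Adj.ne he)
      · rw [h1] at he
        obtain rfl : v₀ = w := by simpa using he
        exact absurd hradj.symm (hw _)

/-- The distinguished copy of `H` in the block hangs on `c` by its root alone, and its labels are
increasing both in the block and after relabelling. -/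
theorem center_mem_attachments [NeZero h] {ε : Fin h → Fin q} (hε : StrictMono ε)
    (hεc : ∀ i, ε i ≠ c) (hεJ : ∀ i j, J.Adj (ε i) (ε j) ↔ H.Adj i j)
    (hεo : ∀ i u, u ∉ Set.range ε → (J.Adj (ε i) u ↔ i = 0 ∧ u = c))
    (hd0 : d < ndeg J (ε 0)) (hdc : d < ndeg (insertBlock G J e c) (Sum.inr c)) :
    splitEquiv S (Sum.inr c) ∈ attachments H d (addBlock J c S G e) := by
  have hmono := splitEquiv_inr_strictMono S
  have hcr : c ∉ Set.range ε := by
    rintro ⟨i, hi⟩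
    exact hεc i hi
  have hεinj : ∀ u, splitEquiv S (Sum.inr u) ∈ Set.range (fun i => splitEquiv S (Sum.inr (ε i))) →
      u ∈ Set.range ε := by
    rintro u ⟨i, hi⟩
    exact ⟨i, Sum.inr_injective ((splitEquiv S).injective hi)⟩
  refine ⟨Set.range fun i => splitEquiv S (Sum.inr (ε i)), splitEquiv S (Sum.inr (ε 0)),
    ⟨⟨⟨0, rfl⟩, ?_⟩, ⟨⟨⟨fun i => splitEquiv S (Sum.inr (ε i)), (hmono.comp hε).injective⟩, ?_⟩,
      hmono.comp hε, rfl⟩, ⟨fun h' => hcr (hεinj c h'), ?_⟩, ?_⟩, ?_, ?_⟩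
  · rintro _ ⟨i, rfl⟩
    exact (hmono.comp hε).monotone (Fin.zero_le i)
  · intro i j
    exact (addBlock_adj S (Sum.inr (ε i)) (Sum.inr (ε j))).trans (hεJ i j)
  · exact (addBlock_adj S (Sum.inr (ε 0)) (Sum.inr c)).2 ((hεo 0 c hcr).2 ⟨rfl, rfl⟩)
  · rintro _ ⟨i, rfl⟩ y hy hadj
    obtain ⟨(v | u), rfl⟩ := (splitEquiv S).surjective y
    · have h1 := (addBlock_adj S (Sum.inr (ε i)) (Sum.inl v)).1 hadj
      exact absurd h1.2 (hεc i)
    · have h1 := (addBlock_adj S (Sum.inr (ε i)) (Sum.inr u)).1 hadj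
      have hu : u ∉ Set.range ε := by
        rintro ⟨j, rfl⟩
        exact hy ⟨j, rfl⟩
      obtain ⟨rfl, rfl⟩ := (hεo i u hu).1 h1
      exact ⟨rfl, rfl⟩
  · rw [ndeg_addBlock, ndeg_insertBlock_inr_of_ne (hεc 0)]
    exact hd0
  · rw [ndeg_addBlock]
    exact hdc

/-- The centre and the ends of `e` determine the vertex set of the block by `IsBlock.unique`, and
with it `S` and `e`. Restoring the edge `e`, unless it is a loop, gives back `G`. -/
theorem addBlock_injective (hJ : J.Connected) {S S' : {S : Finset (Fin (n + q)) // S.card = n}}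
    {G G' : SimpleGraph (Fin n)} {e e' : Sym2 (Fin n)} (he : e ∈ spots G) (he' : e' ∈ spots G')
    (h1 : addBlock J c S G e = addBlock J c S' G' e')
    (h2 : splitEquiv S (Sum.inr c) = splitEquiv S' (Sum.inr c))
    (h3 : splitEquiv S (Sum.inl (Quot.out e).1) = splitEquiv S' (Sum.inl (Quot.out e').1))
    (h4 : splitEquiv S (Sum.inl (Quot.out e).2) = splitEquiv S' (Sum.inl (Quot.out e').2)) :
    S = S' ∧ G = G' ∧ e = e' := by
  have hout : ∀ e : Sym2 (Fin n), s((Quot.out e).1, (Quot.out e).2) = e := fun e => Quot.out_eq e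
  have hK : ∀ (S : {S : Finset (Fin (n + q)) // S.card = n}) (e : Sym2 (Fin n)),
      (fun v => splitEquiv S (Sum.inl v)) '' {v | v ∈ e} =
        {splitEquiv S (Sum.inl (Quot.out e).1), splitEquiv S (Sum.inl (Quot.out e).2)} := by
    intro S e
    have : {v | v ∈ e} = {(Quot.out e).1, (Quot.out e).2} := by
      ext v
      conv_lhs => rw [← hout e]
      simp
    rw [this, Set.image_pair]
  have b1 := isBlock_insertBlock (G := G) (e := e) (c := c) hJ (splitEquiv S)
  have b2 := isBlock_insertBlock (G := G') (e := e') (c := c) hJ (splitEquiv S')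
  change IsBlock (addBlock J c S G e) _ _ _ at b1
  change IsBlock (addBlock J c S' G' e') _ _ _ at b2
  rw [hK, h1, h2, h3, h4] at b1
  rw [hK] at b2
  have hS := b1.unique b2
  rw [range_splitEquiv_inr, range_splitEquiv_inr, Finset.coe_inj, compl_inj_iff] at hS
  obtain rfl : S = S' := Subtype.ext hS
  have hee : e = e' := by
    rw [← hout e, ← hout e', Sum.inl_injective ((splitEquiv S).injective h3),
      Sum.inl_injective ((splitEquiv S).injective h4)]
  subst hee
  refine ⟨rfl, ?_, rfl⟩
  have key : ∀ G : SimpleGraph (Fin n), e ∈ spots G → ∀ x y, G.Adj x y ↔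
      (addBlock J c S G e).Adj (splitEquiv S (Sum.inl x)) (splitEquiv S (Sum.inl y)) ∨
        (s(x, y) = e ∧ x ≠ y) := by
    intro G he x y
    rw [addBlock_adj, insertBlock_inl_inl]
    constructor
    · intro hxy
      by_cases h : s(x, y) = e
      · exact Or.inr ⟨h, hxy.ne⟩
      · exact Or.inl ⟨hxy, h⟩
    · rintro (h | ⟨rfl, hne⟩)
      · exact h.1
      · rcases he with he | ⟨v, -, hv⟩
        · exact he
        · rw [Sym2.eq_iff] at hv
          exact absurd (by grind) hne
  ext x y
  rw [key G he, key G' he', h1]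

/-- Insertion of a block. -/
theorem mul_ncard_fewAttachments_le [NeZero h] (hc : H.Connected) (hp : IsPlanar H)
    (hd : ∀ i, d ≤ ndeg H i) (hD : ∀ i, (ndeg H i : ℤ) ≤ D) (hD0 : (ndeg H 0 : ℤ) + 1 ≤ D)
    (hD3 : 3 ≤ D) (hs : s = max 1 (ndeg H 0 - 1)) (n k : ℕ) :
    n * (n + (1 + s * h)).choose n * (fewAttachments H d D n k).ncard ≤
      2 * (k + (1 + s * h)) * (s + 2) ^ 2 *
        (fewAttachments H d D (n + (1 + s * h)) (k + (1 + s * h))).ncard := by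
  have hspider := exists_spider hc hp s
  have hqh : h < 1 + s * h := by
    have : 1 * h ≤ s * h := Nat.mul_le_mul_right h (by omega)
    omega
  generalize 1 + s * h = q at hspider hqh ⊢
  obtain ⟨J, c, hJp, hJc, hJd, hJu, hJε⟩ := hspider
  obtain ⟨ε, hε, hεc, hεJ, hεo, hε0⟩ := hJε (by omega)
  let A := fewAttachments H d D n k
  let A' := fewAttachments H d D (n + q) (k + q)
  let B : SimpleGraph (Fin n) → Set ({S : Finset (Fin (n + q)) // S.card = n} × Sym2 (Fin n)) :=
    fun G => Set.univ ×ˢ spots G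
  -- What is needed to undo an insertion: the centre, an attachment of degree at most `s + 2`, and
  -- the two possibly equal ends of `e` among its neighbours.
  let B' : SimpleGraph (Fin (n + q)) → Set (Fin (n + q) × Fin (n + q) × Fin (n + q)) := fun G =>
    {p | p.1 ∈ {x ∈ attachments H d G | ndeg G x ≤ s + 2} ∧
      p.2 ∈ G.neighborSet p.1 ×ˢ G.neighborSet p.1}
  have hlow := le_ncard_dependent_pairs A B (n * (n + q).choose n) 2 (fun G _ => by
    rw [Set.ncard_prod, Set.ncard_univ, Nat.card_eq_fintype_card, Fintype.card_finset_len,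
      Fintype.card_fin]
    have := card_le_two_mul_ncard_spots G
    rw [Nat.card_eq_fintype_card, Fintype.card_fin] at this
    calc _ ≤ 2 * (spots G).ncard * (n + q).choose n := Nat.mul_le_mul_right _ this
      _ = _ := by ring)
  have hupp := ncard_dependent_pairs_le A' B' ((k + q) * (s + 2) ^ 2) (fun G hG => by
    refine (ncard_dependent_pairs_le _ (fun x => G.neighborSet x ×ˢ G.neighborSet x)
      ((s + 2) ^ 2) fun x hx => ?_).trans ?_
    · rw [Set.ncard_prod, pow_two]
      exact Nat.mul_le_mul hx.2 hx.2
    · exact Nat.mul_le_mul_right _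
        ((Set.ncard_le_ncard (fun x hx => hx.1) (Set.toFinite _)).trans hG.2))
  -- On an edge the centre has degree `s + 2 ≥ ndeg H 0 + 1 > d`. On an isolated vertex it has only
  -- `s + 1`, but an isolated vertex forces `d ≤ 0`.
  have hcenter : ∀ G ∈ A, ∀ e ∈ spots G, d < ndeg (insertBlock G J e c) (Sum.inr c) ∧
      ndeg (insertBlock G J e c) (Sum.inr c) ≤ s + 2 := by
    intro G hG e he
    have h1 := ncard_mem_sym2 e
    rw [ndeg_insertBlock_center, hJd]
    refine ⟨?_, by omega⟩
    rcases he with he | ⟨v, hv, rfl⟩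
    · have h2 : {v | v ∈ e}.ncard = 2 := by
        induction e using Sym2.ind with | _ x y
        have : {v | v ∈ s(x, y)} = ({x, y} : Set _) := by ext; simp
        rw [this]
        exact Set.ncard_pair (SimpleGraph.Adj.ne he)
      have := hd 0
      omega
    · have h2 := (hG.1.2 v).1
      have h3 : ndeg G v = 0 := by
        rw [ndeg, Set.ncard_eq_zero]
        ext w
        simpa using hv w
      omega
  have hmem : ∀ G ∈ A, ∀ e ∈ spots G, ∀ S, addBlock J c S G e ∈ A' := by
    intro G hG e he S
    refine ⟨comap_mem_boundedPlanar (splitEquiv S).symm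
      ⟨hG.1.1.insertBlock hJp (mem_spots_cases he), ?_⟩, ?_⟩
    · rintro (v | u)
      · have h1 := hG.1.2 v
        rcases ndeg_insertBlock_inl (J := J) (c := c) (mem_spots_cases he) v with h | ⟨h, h'⟩
        · rw [h]; exact h1
        · rcases he with he | ⟨w, hw, he⟩
          · rw [h] at he
            exact absurd rfl (SimpleGraph.Adj.ne he)
          · rw [h] at he
            obtain rfl : v = w := by simpa using he
            have h3 : ndeg G v = 0 := by
              rw [ndeg, Set.ncard_eq_zero]
              ext w
              simpa using hw w
            rw [h']
            omega
      · by_cases hu : u = c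
        · rw [hu]
          have h1 := hcenter G hG e he
          have h2 := hD 0
          omega
        · rw [ndeg_insertBlock_inr_of_ne hu]
          rcases hJu u hu with ⟨i, hi⟩ | hi
          · rw [hi]; exact ⟨hd i, hD i⟩
          · rw [hi]
            have := hd 0
            push_cast
            omega
    · refine (Set.ncard_le_ncard (attachments_addBlock_subset S hJc hqh he) (Set.toFinite _)).trans
        ((Set.ncard_union_le _ _).trans (Nat.add_le_add ?_ ?_))
      · exact (Set.ncard_image_le (Set.toFinite _)).trans hG.2
      · rw [← Set.image_univ]
        refine (Set.ncard_image_le (Set.toFinite _)).trans ?_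
        rw [Set.ncard_univ, Nat.card_eq_fintype_card, Fintype.card_fin]
  have hinj : {p : SimpleGraph (Fin n) × _ | p.1 ∈ A ∧ p.2 ∈ B p.1}.ncard ≤
      {p : SimpleGraph (Fin (n + q)) × _ | p.1 ∈ A' ∧ p.2 ∈ B' p.1}.ncard := by
    refine Set.ncard_le_ncard_of_injOn (fun p => (addBlock J c p.2.1 p.1 p.2.2,
      splitEquiv p.2.1 (Sum.inr c), splitEquiv p.2.1 (Sum.inl (Quot.out p.2.2).1),
      splitEquiv p.2.1 (Sum.inl (Quot.out p.2.2).2))) ?_ ?_ (Set.toFinite _)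
    · rintro ⟨G, S, e⟩ ⟨hG, -, he⟩
      have h1 := hcenter G hG e he
      have hmem1 : (Quot.out e).1 ∈ e := Sym2.out_fst_mem e
      have hmem2 : (Quot.out e).2 ∈ e := Sym2.out_snd_mem e
      refine ⟨hmem G hG e he S, ⟨center_mem_attachments S hε hεc hεJ hεo ?_ h1.1, ?_⟩, ?_, ?_⟩
      · rw [hε0]
        have := hd 0
        push_cast
        omega
      · rw [ndeg_addBlock]
        exact h1.2
      · exact (addBlock_adj S (Sum.inr c) (Sum.inl _)).2 ⟨hmem1, rfl⟩
      · exact (addBlock_adj S (Sum.inr c) (Sum.inl _)).2 ⟨hmem2, rfl⟩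
    · rintro ⟨G, S, e⟩ ⟨hG, -, he⟩ ⟨G', S', e'⟩ ⟨hG', -, he'⟩ heq
      simp only [Prod.mk.injEq] at heq
      obtain ⟨h1, h2, h3, h4⟩ := heq
      obtain ⟨rfl, rfl, rfl⟩ := addBlock_injective hJc he he' h1 h2 h3 h4
      rfl
  calc n * (n + q).choose n * (fewAttachments H d D n k).ncard
      = A.ncard * (n * (n + q).choose n) := by rw [mul_comm]
    _ ≤ _ := hlow
    _ ≤ 2 * (A'.ncard * ((k + q) * (s + 2) ^ 2)) := Nat.mul_le_mul_left 2 (hinj.trans hupp)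
    _ = _ := by ring

end BlockAddition

end RandomPlanar
namespace RandomPlanar

/-! ### Growth rates of almost supermultiplicative sequences. -/

section Growth

theorem eventually_pow_le_mul_pow (k : ℕ) {θ κ : ℝ} (hθ : 1 < θ) (hκ : 0 < κ) :
    ∀ᶠ n : ℕ in atTop, (n : ℝ) ^ k ≤ κ * θ ^ n := by
  filter_upwards [(tendsto_pow_const_div_const_pow_of_one_lt k hθ).eventually (gt_mem_nhds hκ)]
    with n hn
  exact ((div_lt_iff₀ (pow_pos (by linarith) n)).1 hn).le

/-- The inequalities satisfied by the exponential counting sequences of a class `a` of graphs and of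
its connected members `c`. -/
structure GrowthPair (K : ℝ) (c a : ℕ → ℝ) : Prop where
  nonneg : ∀ n, 0 ≤ c n
  le : ∀ n, c n ≤ a n
  le_pow : ∀ n, a n ≤ K ^ n
  mul_le : ∀ m n : ℕ, c m * c n ≤ ((m + n : ℕ) : ℝ) ^ 6 * c (m + n)
  rec_le : ∀ n : ℕ, ((n + 1 : ℕ) : ℝ) * a (n + 1) ≤
    ∑ j ∈ Finset.range (n + 1), ((j + 1 : ℕ) : ℝ) * c (j + 1) * a (n - j)
  pos : ∀ᶠ n in atTop, 0 < c n

/-- The positive indices at which `c` is positive are closed under addition, and two coprime numbers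
generate all large integers. -/
theorem eventually_pos_of_coprime {c : ℕ → ℝ} {p q : ℕ}
    (hmul : ∀ m n : ℕ, c m * c n ≤ ((m + n : ℕ) : ℝ) ^ 6 * c (m + n)) (hpq : p.Coprime q)
    (hp : 0 < c p) (hq : 0 < c q) : ∀ᶠ n in atTop, 0 < c n := by
  obtain ⟨N, hN⟩ := Nat.exists_mem_closure_of_ge ({p, q} : Set ℕ)
  have hgcd : Nat.setGcd ({p, q} : Set ℕ) = 1 :=
    Nat.dvd_one.1 (hpq ▸ Nat.dvd_gcd (Nat.setGcd_dvd_of_mem (Set.mem_insert p {q}))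
      (Nat.setGcd_dvd_of_mem (Set.mem_insert_of_mem p (Set.mem_singleton q))))
  have hcl : ∀ n ∈ AddSubmonoid.closure ({p, q} : Set ℕ), n = 0 ∨ 0 < c n := by
    intro n hn
    induction hn using AddSubmonoid.closure_induction with
    | mem x hx =>
      rcases hx with rfl | rfl
      · exact Or.inr hp
      · exact Or.inr hq
    | zero => exact Or.inl rfl
    | add x y _ _ hx hy =>
      rcases hx with rfl | hx
      · rwa [zero_add]
      rcases hy with rfl | hy
      · exact Or.inr hx
      · exact Or.inr (pos_of_mul_pos_right ((mul_pos hx hy).trans_le (hmul x y)) (by positivity))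
  filter_upwards [eventually_ge_atTop (max N 1)] with n hn
  rcases hcl n (hN n ((le_max_left _ _).trans hn) (hgcd ▸ one_dvd n)) with h | h
  · have := (le_max_right N 1).trans hn
    omega
  · exact h

namespace GrowthPair

variable {K : ℝ} {c a : ℕ → ℝ}

/-- For comparable sizes the factor `(m + n) ^ 6` is absorbed by dividing by the 18th power: `m + n
≤ 3 m` and `(3 m) ^ 24 = 9 ^ 12 * m ^ 24 ≤ m ^ 36` as soon as `m ≥ 9`. -/
theorem div_mul_div_le (h : GrowthPair K c a) {m n : ℕ} (hm : 9 ≤ m) (hmn : m ≤ n)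
    (hnm : n ≤ 2 * m) :
    c m / (m : ℝ) ^ 18 * (c n / (n : ℝ) ^ 18) ≤ c (m + n) / ((m + n : ℕ) : ℝ) ^ 18 := by
  have hm0 : (0 : ℝ) < m := by exact_mod_cast (by omega : 0 < m)
  have hn0 : (0 : ℝ) < n := by exact_mod_cast (by omega : 0 < n)
  have hmn0 : (0 : ℝ) < (m + n : ℕ) := by exact_mod_cast (by omega : 0 < m + n)
  have key : ((m + n : ℕ) : ℝ) ^ 24 ≤ (m : ℝ) ^ 18 * (n : ℝ) ^ 18 := by
    have h1 : ((m + n : ℕ) : ℝ) ≤ 3 * m := by exact_mod_cast (by omega : m + n ≤ 3 * m)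
    have h2 : (m : ℝ) ≤ n := by exact_mod_cast hmn
    have h3 : (9 : ℝ) ≤ m := by exact_mod_cast hm
    calc ((m + n : ℕ) : ℝ) ^ 24 ≤ (3 * m) ^ 24 := pow_le_pow_left₀ hmn0.le h1 24
      _ = 9 ^ 12 * (m : ℝ) ^ 24 := by rw [mul_pow]; norm_num
      _ ≤ (m : ℝ) ^ 12 * (m : ℝ) ^ 24 := by gcongr
      _ = (m : ℝ) ^ 18 * (m : ℝ) ^ 18 := by ring
      _ ≤ _ := by gcongr
  rw [div_mul_div_comm, div_le_div_iff₀ (by positivity) (by positivity)]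
  calc c m * c n * ((m + n : ℕ) : ℝ) ^ 18
      ≤ ((m + n : ℕ) : ℝ) ^ 6 * c (m + n) * ((m + n : ℕ) : ℝ) ^ 18 := by
        exact mul_le_mul_of_nonneg_right (h.mul_le m n) (by positivity)
    _ = c (m + n) * ((m + n : ℕ) : ℝ) ^ 24 := by ring
    _ ≤ _ := mul_le_mul_of_nonneg_left key (h.nonneg _)

/-- Splitting `j` into `j / 2` and `j - j / 2` keeps the two sizes within a factor of two, as
`div_mul_div_le` demands. -/
theorem div_pow_le (h : GrowthPair K c a) {m : ℕ} (hm : 9 ≤ m) (j : ℕ) (hj : 1 ≤ j) :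
    (c m / (m : ℝ) ^ 18) ^ j ≤ c (j * m) / ((j * m : ℕ) : ℝ) ^ 18 := by
  induction j using Nat.strong_induction_on with
  | _ j ih =>
    rcases hj.eq_or_lt with rfl | hj
    · simp
    · have h1 := ih (j / 2) (by omega) (by omega)
      have h2 := ih (j - j / 2) (by omega) (by omega)
      have hb : 0 ≤ c m / (m : ℝ) ^ 18 := div_nonneg (h.nonneg m) (by positivity)
      have h3 : 1 * m ≤ j / 2 * m := Nat.mul_le_mul_right m (by omega)
      have h4 : (j - j / 2) * m ≤ 2 * (j / 2) * m := Nat.mul_le_mul_right m (by omega)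
      have h5 : j / 2 * m ≤ (j - j / 2) * m := Nat.mul_le_mul_right m (by omega)
      have h6 : j / 2 * m + (j - j / 2) * m = j * m := by
        rw [← add_mul]; congr 1; omega
      have h7 := h.div_mul_div_le (m := j / 2 * m) (n := (j - j / 2) * m) (by omega) h5
        (by rw [← mul_assoc]; exact h4)
      rw [h6] at h7
      calc (c m / (m : ℝ) ^ 18) ^ j
          = (c m / (m : ℝ) ^ 18) ^ (j / 2) * (c m / (m : ℝ) ^ 18) ^ (j - j / 2) := by
            rw [← pow_add]; congr 1; omega
        _ ≤ _ := mul_le_mul h1 h2 (by positivity) (h1.trans' (by positivity))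
        _ ≤ _ := h7

/-- If `c m` exceeds `m ^ 18 * β ^ m` for a single `m`, then `c` grows at least like `β ^ n`. -/
theorem eventually_pow_le (h : GrowthPair K c a) {m : ℕ} (hm : 9 ≤ m) {β θ : ℝ} (hβ : 0 < β)
    (hθ : 1 < θ) (hmβ : β ^ m ≤ c m / (m : ℝ) ^ 18) : ∀ᶠ n in atTop, (β / θ) ^ n ≤ c n := by
  obtain ⟨R, hR⟩ := eventually_atTop.1 h.pos
  -- An index `n` is written as `j * m + r` with `r` in the window `[R, R + m)`, where `c` is
  -- positive; this gives a positive minimum `κ`.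
  obtain ⟨r₀, hr₀, hmin⟩ := (Finset.Ico R (R + m)).exists_min_image (fun r => c r / β ^ r)
    ⟨R, Finset.mem_Ico.2 ⟨le_rfl, by omega⟩⟩
  have hκ : 0 < c r₀ / β ^ r₀ := div_pos (hR _ (Finset.mem_Ico.1 hr₀).1) (by positivity)
  set κ := c r₀ / β ^ r₀
  filter_upwards [eventually_pow_le_mul_pow 6 hθ hκ, eventually_ge_atTop (R + m)] with n hn hnR
  obtain ⟨j, r, hj, hr, hr', hjr⟩ : ∃ j r, 1 ≤ j ∧ R ≤ r ∧ r < R + m ∧ n = j * m + r := by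
    refine ⟨(n - R) / m, R + (n - R) % m, (Nat.one_le_div_iff (by omega)).2 (by omega), by omega,
      by have := Nat.mod_lt (n - R) (by omega : 0 < m); omega, ?_⟩
    have := Nat.div_add_mod' (n - R) m
    omega
  have hn0 : (0 : ℝ) < n := by exact_mod_cast (by omega : 0 < n)
  have hjm : (1 : ℝ) ≤ (j * m : ℕ) := by
    exact_mod_cast Nat.mul_pos (by omega : 0 < j) (by omega : 0 < m)
  have h1 : β ^ (j * m) ≤ c (j * m) := by
    calc β ^ (j * m) = (β ^ m) ^ j := by rw [mul_comm, pow_mul]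
      _ ≤ (c m / (m : ℝ) ^ 18) ^ j := pow_le_pow_left₀ (by positivity) hmβ j
      _ ≤ _ := h.div_pow_le hm j hj
      _ ≤ _ := div_le_self (h.nonneg _) (one_le_pow₀ hjm)
  have h2 : κ * β ^ r ≤ c r := by
    have := hmin r (Finset.mem_Ico.2 ⟨hr, hr'⟩)
    exact (le_div_iff₀ (by positivity)).1 this
  have h3 : κ * β ^ n ≤ (n : ℝ) ^ 6 * c n := by
    calc κ * β ^ n = β ^ (j * m) * (κ * β ^ r) := by rw [hjr, pow_add]; ring
      _ ≤ c (j * m) * c r := mul_le_mul h1 h2 (by positivity) (h.nonneg _)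
      _ ≤ _ := h.mul_le _ _
      _ = _ := by rw [hjr]
  rw [div_pow, div_le_iff₀ (by positivity)]
  refine le_of_mul_le_mul_left (a := κ) ?_ hκ
  calc κ * β ^ n ≤ (n : ℝ) ^ 6 * c n := h3
    _ ≤ κ * θ ^ n * c n := mul_le_mul_of_nonneg_right hn (h.nonneg n)
    _ = _ := by ring

/-- For `z` slightly above `γ` the series `∑ j * c j / z ^ j` converges to some `S`. Inserting `a ≤
B * z ^ n` into the recursion yields `(n + 1) * a (n + 1) ≤ S * B * z ^ (n + 1)`, so the bound
reproduces itself once `n + 1 ≥ S`; `B` takes care of the finitely many smaller indices. -/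
theorem eventually_le_pow (h : GrowthPair K c a) {γ θ : ℝ} (hγ : 0 < γ) (hθ : 1 < θ)
    (hc : ∀ᶠ n : ℕ in atTop, c n ≤ (n : ℝ) ^ 18 * γ ^ n) : ∀ᶠ n in atTop, a n ≤ (γ * θ) ^ n := by
  have ha : ∀ n, 0 ≤ a n := fun n => (h.nonneg n).trans (h.le n)
  obtain ⟨η, h1η, hηθ⟩ := exists_between hθ
  have hη0 : 0 < η := by linarith
  set z := γ * η with hz
  have hz0 : 0 < z := mul_pos hγ hη0
  have hsum : Summable fun j : ℕ => (j : ℝ) * c j / z ^ j := by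
    have hinv : ‖η⁻¹‖ < 1 := by
      rw [norm_inv, Real.norm_of_nonneg hη0.le]
      exact inv_lt_one_of_one_lt₀ h1η
    refine Summable.of_norm_bounded_eventually_nat
      (summable_pow_mul_geometric_of_norm_lt_one 19 hinv) ?_
    filter_upwards [hc] with n hn
    rw [Real.norm_of_nonneg (div_nonneg (mul_nonneg n.cast_nonneg (h.nonneg n)) (by positivity)),
      div_le_iff₀ (by positivity), hz, mul_pow, inv_pow]
    calc (n : ℝ) * c n ≤ n * ((n : ℝ) ^ 18 * γ ^ n) := by gcongr
      _ = (n : ℝ) ^ 19 * (η ^ n)⁻¹ * (γ ^ n * η ^ n) := by field_simp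
  set S := ∑' j : ℕ, (j : ℝ) * c j / z ^ j
  have hterm : ∀ j : ℕ, 0 ≤ (j : ℝ) * c j / z ^ j := fun j =>
    div_nonneg (mul_nonneg j.cast_nonneg (h.nonneg j)) (by positivity)
  obtain ⟨N, hN⟩ := exists_nat_ge S
  obtain ⟨B, hB0, hB⟩ : ∃ B : ℝ, 0 < B ∧ ∀ n < N + 1, a n ≤ B * z ^ n := by
    refine ⟨1 + ∑ n ∈ Finset.range (N + 1), a n / z ^ n,
      add_pos_of_pos_of_nonneg one_pos (Finset.sum_nonneg fun n _ => div_nonneg (ha n)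
        (by positivity)), fun n hn => ?_⟩
    rw [← div_le_iff₀ (by positivity)]
    have := Finset.single_le_sum (f := fun n => a n / z ^ n)
      (fun n _ => div_nonneg (ha n) (by positivity)) (Finset.mem_range.2 hn)
    linarith
  have hall : ∀ n, a n ≤ B * z ^ n := by
    intro n
    induction n using Nat.strong_induction_on with
    | _ n ih =>
      by_cases hnN : n < N + 1
      · exact hB n hnN
      obtain ⟨n, rfl⟩ := Nat.exists_eq_add_one_of_ne_zero (by omega : n ≠ 0)
      have hS : ∑ j ∈ Finset.range (n + 1), ((j + 1 : ℕ) : ℝ) * c (j + 1) / z ^ (j + 1) ≤ S := by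
        have := hsum.sum_le_tsum (Finset.range (n + 2)) fun j _ => hterm j
        rw [Finset.sum_range_succ'] at this
        simpa using this
      have hn0 : (0 : ℝ) < (n + 1 : ℕ) := by positivity
      refine le_of_mul_le_mul_left (a := ((n + 1 : ℕ) : ℝ)) ?_ hn0
      calc ((n + 1 : ℕ) : ℝ) * a (n + 1)
          ≤ ∑ j ∈ Finset.range (n + 1), ((j + 1 : ℕ) : ℝ) * c (j + 1) * a (n - j) := h.rec_le n
        _ ≤ ∑ j ∈ Finset.range (n + 1), B * z ^ (n + 1) *
            (((j + 1 : ℕ) : ℝ) * c (j + 1) / z ^ (j + 1)) := by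
          refine Finset.sum_le_sum fun j hj => ?_
          have hjn : j ≤ n := by have := Finset.mem_range.1 hj; omega
          calc ((j + 1 : ℕ) : ℝ) * c (j + 1) * a (n - j)
              ≤ ((j + 1 : ℕ) : ℝ) * c (j + 1) * (B * z ^ (n - j)) :=
                mul_le_mul_of_nonneg_left (ih _ (by omega))
                  (mul_nonneg (Nat.cast_nonneg _) (h.nonneg _))
            _ = B * (z ^ (n - j) * z ^ (j + 1)) * (((j + 1 : ℕ) : ℝ) * c (j + 1) / z ^ (j + 1)) := by
                field_simp
            _ = _ := by
                rw [← pow_add]; congr 3; omega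
        _ = B * z ^ (n + 1) *
            ∑ j ∈ Finset.range (n + 1), ((j + 1 : ℕ) : ℝ) * c (j + 1) / z ^ (j + 1) := by
          rw [Finset.mul_sum]
        _ ≤ B * z ^ (n + 1) * (n + 1 : ℕ) := by
          refine mul_le_mul_of_nonneg_left (hS.trans (hN.trans ?_)) (by positivity)
          exact_mod_cast (by omega : N ≤ n + 1)
        _ = _ := by ring
  filter_upwards [eventually_pow_le_mul_pow 0 ((one_lt_div hη0).2 hηθ) (inv_pos.2 hB0)] with n hn
  rw [pow_zero, ← div_eq_inv_mul, le_div_iff₀ hB0, one_mul, div_pow, le_div_iff₀ (by positivity)]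
    at hn
  calc a n ≤ B * z ^ n := hall n
    _ = γ ^ n * (B * η ^ n) := by rw [hz, mul_pow]; ring
    _ ≤ γ ^ n * θ ^ n := by gcongr
    _ = _ := (mul_pow _ _ _).symm

/-- The common growth rate of the two sequences. -/
theorem exists_rate (h : GrowthPair K c a) (hK : 1 ≤ K) : ∃ γ : ℝ, 0 < γ ∧ γ ≤ K ∧
    (∀ m : ℕ, 9 ≤ m → c m ≤ (m : ℝ) ^ 18 * γ ^ m) ∧
    ∀ θ : ℝ, 1 < θ → (∀ᶠ n in atTop, (γ / θ) ^ n ≤ c n) ∧ ∀ᶠ n in atTop, a n ≤ (γ * θ) ^ n := by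
  let b : ℕ → ℝ := fun m => c m / (m : ℝ) ^ 18
  have hb0 : ∀ m, 0 ≤ b m := fun m => div_nonneg (h.nonneg m) (by positivity)
  -- The rate `γ` is the supremum of the roots of the normalised sequence, bounded because `a n ≤ K
  -- ^ n`. Any root close to the supremum already forces growth at nearly that rate.
  let T : Set ℝ := {x | ∃ m, 9 ≤ m ∧ x = b m ^ ((m : ℝ)⁻¹)}
  have hTK : ∀ x ∈ T, x ≤ K := by
    rintro _ ⟨m, hm, rfl⟩
    have hm1 : (1 : ℝ) ≤ m := by exact_mod_cast (by omega : 1 ≤ m)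
    rw [Real.rpow_inv_le_iff_of_pos (hb0 m) (by linarith) (by linarith), Real.rpow_natCast]
    exact (div_le_self (h.nonneg m) (one_le_pow₀ hm1)).trans ((h.le m).trans (h.le_pow m))
  obtain ⟨m₀, hm₀, hpos⟩ := ((eventually_ge_atTop 9).and h.pos).exists
  have hbdd : BddAbove T := ⟨K, hTK⟩
  have hne : T.Nonempty := ⟨_, m₀, hm₀, rfl⟩
  set γ := sSup T
  have hγ : 0 < γ := by
    refine lt_of_lt_of_le (Real.rpow_pos_of_pos (div_pos hpos ?_) _) (le_csSup hbdd ⟨m₀, hm₀, rfl⟩)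
    have : (0 : ℝ) < m₀ := by exact_mod_cast (by omega : 0 < m₀)
    positivity
  have hup : ∀ m : ℕ, 9 ≤ m → c m ≤ (m : ℝ) ^ 18 * γ ^ m := by
    intro m hm
    have hm0 : (0 : ℝ) < m := by exact_mod_cast (by omega : 0 < m)
    have h1 : b m ^ ((m : ℝ)⁻¹) ≤ γ := le_csSup hbdd ⟨m, hm, rfl⟩
    rw [Real.rpow_inv_le_iff_of_pos (hb0 m) hγ.le hm0, Real.rpow_natCast] at h1
    rwa [mul_comm, ← div_le_iff₀ (by positivity)]
  refine ⟨γ, hγ, csSup_le hne hTK, hup, fun θ hθ => ⟨?_, h.eventually_le_pow hγ hθ ?_⟩⟩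
  · obtain ⟨η, h1η, hηθ⟩ := exists_between hθ
    have hη0 : 0 < η := by linarith
    obtain ⟨_, ⟨m, hm, rfl⟩, hlt⟩ := exists_lt_of_lt_csSup hne (div_lt_self hγ h1η)
    have hm0 : (0 : ℝ) < m := by exact_mod_cast (by omega : 0 < m)
    have h1 : (γ / η) ^ m ≤ b m := by
      rw [← Real.rpow_natCast]
      exact (Real.le_rpow_inv_iff_of_pos (by positivity) (hb0 m) hm0).1 hlt.le
    filter_upwards [h.eventually_pow_le hm (div_pos hγ hη0) ((one_lt_div hη0).2 hηθ) h1] with n hn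
    rwa [div_div, mul_div_cancel₀ _ hη0.ne'] at hn
  · filter_upwards [eventually_ge_atTop 9] with n hn
    exact hup n hn

theorem eventually_forall_le {γ η η' θ : ℝ} (hγ : 0 < γ) (hγK : γ ≤ K) (h1 : 1 ≤ η) (h1' : 1 ≤ η')
    (hθ : η * η' ≤ θ) (hc : ∀ᶠ n in atTop, (γ / η) ^ n ≤ c n)
    (ha : ∀ᶠ n in atTop, a n ≤ (γ * η') ^ n) :
    ∀ᶠ n : ℕ in atTop, 0 < c n ∧ ∀ m, n ≤ m → a m ≤ (K * θ) ^ (m - n) * (θ ^ n * c n) := by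
  filter_upwards [hc, eventually_forall_ge_atTop.2 ha] with n hn hn'
  have hθ' : η' ≤ θ := (le_mul_of_one_le_left (by linarith) h1).trans hθ
  have hθ0 : 0 ≤ θ := by linarith
  have hK0 : 0 ≤ K := hγ.le.trans hγK
  refine ⟨(by positivity : (0 : ℝ) < (γ / η) ^ n).trans_le hn, fun m hm => ?_⟩
  calc a m ≤ (γ * η') ^ m := hn' m hm
    _ = (γ * η') ^ (m - n) * ((η * η') ^ n * (γ / η) ^ n) := by
      rw [← mul_pow, show η * η' * (γ / η) = γ * η' by field_simp, ← pow_add, Nat.sub_add_cancel hm]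
    _ ≤ (K * θ) ^ (m - n) * (θ ^ n * c n) := by gcongr

/-- Uniformity in a parameter of which the beginnings of the sequences are eventually
independent. -/
theorem eventually_forall_family {c a : ℕ → ℕ → ℝ} (h : ∀ i, GrowthPair K (c i) (a i)) (hK : 1 ≤ K)
    (hc : ∀ i j n, i ≤ j → c i n ≤ c j n) (ha : ∀ i j n, i ≤ j → a i n ≤ a j n)
    (hc' : ∀ i j n, n ≤ i → n ≤ j → c i n = c j n) (ha' : ∀ i j n, n ≤ i → n ≤ j → a i n = a j n)
    {θ : ℝ} (hθ : 1 < θ) : ∀ᶠ n : ℕ in atTop, ∀ i, 0 < c i n ∧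
      ∀ m, n ≤ m → a i m ≤ (K * θ) ^ (m - n) * (θ ^ n * c i n) := by
  -- The diagonal sequences represent an infinite parameter; every relation involves finitely many
  -- indices and so is inherited from one sufficiently large parameter.
  have hlim : GrowthPair K (fun n => c n n) (fun n => a n n) :=
    { nonneg := fun n => (h n).nonneg n
      le := fun n => (h n).le n
      le_pow := fun n => (h n).le_pow n
      mul_le := fun m n => by
        rw [hc' m (m + n) m le_rfl (by omega), hc' n (m + n) n le_rfl (by omega)]
        exact (h (m + n)).mul_le m n
      rec_le := fun n => by
        refine ((h (n + 1)).rec_le n).trans (Finset.sum_le_sum fun j hj => ?_)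
        have := Finset.mem_range.1 hj
        rw [hc' (j + 1) (n + 1) (j + 1) le_rfl (by omega),
          ha' (n - j) (n + 1) (n - j) le_rfl (by omega)]
      pos := by
        filter_upwards [(h 0).pos] with n hn
        exact hn.trans_le (hc 0 n n n.zero_le) }
  obtain ⟨η, h1η, hηθ⟩ : ∃ η : ℝ, 1 < η ∧ η ^ 4 = θ := by
    refine ⟨√√θ, by simpa [Real.lt_sqrt] using hθ, ?_⟩
    rw [show √√θ ^ 4 = (√√θ ^ 2) ^ 2 by ring, Real.sq_sqrt (by positivity),
      Real.sq_sqrt (by linarith)]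
  have hη0 : 0 < η := by linarith
  have hηη : η * η ≤ θ := by
    rw [← hηθ, ← pow_two]
    exact pow_le_pow_right₀ h1η.le (by norm_num)
  obtain ⟨γ, hγ, hγK, -, hγθ⟩ := hlim.exists_rate hK
  -- At order `M` the parameter `M` agrees with the limit, and this single value already certifies
  -- that its rate is nearly `γ`. Parameters from `M` on lie between it and the limit; the finitely
  -- many below `M` are treated separately.
  obtain ⟨M, hM9, hMη, hMγ⟩ := ((eventually_ge_atTop 9).and
    ((eventually_pow_le_mul_pow 18 h1η one_pos).and (hγθ η h1η).1)).exists
  have hsmall : ∀ i ∈ Set.Iio M, ∀ᶠ n : ℕ in atTop, 0 < c i n ∧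
      ∀ m, n ≤ m → a i m ≤ (K * θ) ^ (m - n) * (θ ^ n * c i n) := by
    intro i _
    obtain ⟨γ', hγ', hγK', -, hγθ'⟩ := (h i).exists_rate hK
    exact eventually_forall_le hγ' hγK' h1η.le h1η.le hηη (hγθ' η h1η).1 (hγθ' η h1η).2
  have hlarge : ∀ᶠ n : ℕ in atTop, 0 < c M n ∧
      ∀ m, n ≤ m → a m m ≤ (K * θ) ^ (m - n) * (θ ^ n * c M n) := by
    obtain ⟨γ', hγ', -, hup, hγθ'⟩ := (h M).exists_rate hK
    -- Two factors `η` are lost in comparing the rates, one more in the lower bound and one in the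
    -- upper bound: hence `η ^ 4 = θ`.
    have hγγ : γ / η ≤ γ' * η := by
      refine le_of_pow_le_pow_left₀ (by omega : M ≠ 0) (by positivity) (hMγ.trans ?_)
      calc c M M ≤ (M : ℝ) ^ 18 * γ' ^ M := hup M hM9
        _ ≤ 1 * η ^ M * γ' ^ M := by gcongr
        _ = (γ' * η) ^ M := by rw [mul_pow]; ring
    refine eventually_forall_le (η := η ^ 3) hγ hγK (one_le_pow₀ h1η.le) h1η.le
      (by rw [← hηθ, ← pow_succ]) ?_ (hγθ η h1η).2
    filter_upwards [(hγθ' η h1η).1] with n hn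
    refine le_trans (pow_le_pow_left₀ (by positivity) ?_ n) hn
    rw [div_le_div_iff₀ (by positivity) hη0]
    rw [div_le_iff₀ hη0] at hγγ
    calc γ * η ≤ γ' * η * η * η := by gcongr
      _ = _ := by ring
  filter_upwards [(Set.finite_Iio M).eventually_all.2 hsmall, hlarge] with n h1 h2 i
  rcases lt_or_ge i M with hi | hi
  · exact h1 i hi
  · refine ⟨h2.1.trans_le (hc M i n hi), fun m hm => ?_⟩
    calc a i m ≤ a (max i m) m := ha _ _ _ (le_max_left _ _)
      _ = a m m := ha' _ _ _ (le_max_right _ _) le_rfl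
      _ ≤ (K * θ) ^ (m - n) * (θ ^ n * c M n) := h2.2 m hm
      _ ≤ _ := by
        have : 0 ≤ K * θ := by positivity
        gcongr
        exact hc M i n hi

end GrowthPair

end Growth

end RandomPlanar
namespace RandomPlanar

/-! ### Growth of the planar classes and the iterated insertion. -/

section Rate

/-- The exponential counting sequences of `boundedPlanar` and `connPlanar` form a growth pair. -/
theorem growthPair_planar {K : ℕ} (hK : ∀ n, (planarSet n).ncard ≤ K ^ n * n.factorial) {d D : ℤ}
    (hd : d < D) (hD : 3 ≤ D) {p q : ℕ} (hpq : p.Coprime q)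
    (hp : (connPlanar (Fin p) d D).Nonempty) (hq : (connPlanar (Fin q) d D).Nonempty) :
    GrowthPair K (fun n => ((connPlanar (Fin n) d D).ncard : ℝ) / n.factorial)
      (fun n => ((boundedPlanar (Fin n) d D).ncard : ℝ) / n.factorial) := by
  have hmul : ∀ m n : ℕ, ((connPlanar (Fin m) d D).ncard : ℝ) / m.factorial *
      (((connPlanar (Fin n) d D).ncard : ℝ) / n.factorial) ≤ ((m + n : ℕ) : ℝ) ^ 6 *
        (((connPlanar (Fin (m + n)) d D).ncard : ℝ) / (m + n).factorial) := by
    intro m n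
    have h1 : (((m + n).choose m * (connPlanar (Fin m) d D).ncard *
        (connPlanar (Fin n) d D).ncard : ℕ) : ℝ) ≤ _ :=
      Nat.cast_le.2 (choose_mul_ncard_connPlanar_le m n hd hD)
    have h2 : (((m + n).choose m * m.factorial * n.factorial : ℕ) : ℝ) = (m + n).factorial := by
      rw [Nat.choose_symm_add, Nat.add_choose_mul_factorial_mul_factorial]
    push_cast at h1 h2 ⊢
    have hm : (0 : ℝ) < m.factorial := by positivity
    have hn : (0 : ℝ) < n.factorial := by positivity
    rw [div_mul_div_comm, ← mul_div_assoc, div_le_div_iff₀ (by positivity) (by positivity), ← h2]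
    calc _ = ((m + n).choose m * (connPlanar (Fin m) d D).ncard * (connPlanar (Fin n) d D).ncard : ℝ) *
          (m.factorial * n.factorial) := by ring
      _ ≤ _ := mul_le_mul_of_nonneg_right h1 (by positivity)
  refine ⟨fun n => by positivity, fun n => ?_, fun n => ?_, hmul, fun n => ?_, ?_⟩
  · have : (connPlanar (Fin n) d D).ncard ≤ (boundedPlanar (Fin n) d D).ncard :=
      Set.ncard_le_ncard (fun G hG => hG.1) (Set.toFinite _)
    gcongr
  · have h1 : (boundedPlanar (Fin n) d D).ncard ≤ (planarSet n).ncard :=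
      Set.ncard_le_ncard (fun G hG => hG.1) (Set.toFinite _)
    rw [div_le_iff₀ (by positivity)]
    exact_mod_cast h1.trans (hK n)
  · have h1 := Nat.cast_le (α := ℝ).2 (ncard_boundedPlanar_succ_le n d D)
    have h0 : (0 : ℝ) < n.factorial := by positivity
    rw [Nat.cast_sum] at h1
    rw [Nat.factorial_succ, Nat.cast_mul, mul_div_assoc', mul_div_mul_left _ _
      (by positivity : ((n + 1 : ℕ) : ℝ) ≠ 0), div_le_iff₀ h0, Finset.sum_mul]
    refine h1.trans (Finset.sum_le_sum fun j hj => le_of_eq ?_)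
    have hjn : j ≤ n := by have := Finset.mem_range.1 hj; omega
    have h2 : ((n.choose j * j.factorial * (n - j).factorial : ℕ) : ℝ) = n.factorial := by
      rw [Nat.choose_mul_factorial_mul_factorial hjn]
    rw [← h2, Nat.factorial_succ]
    push_cast
    field_simp
  · have hpos : ∀ {p : ℕ}, (connPlanar (Fin p) d D).Nonempty →
        (0 : ℝ) < ((connPlanar (Fin p) d D).ncard : ℝ) / p.factorial := by
      intro p hp
      have : 0 < (connPlanar (Fin p) d D).ncard := (Set.ncard_pos (Set.toFinite _)).2 hp
      positivity
    exact eventually_pos_of_coprime hmul hpq (hpos hp) (hpos hq)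

variable {h : ℕ} [NeZero h] {H : SimpleGraph (Fin h)}

/-- Comparison of the numbers of planar graphs of different orders, uniformly in the degree
bounds. -/
theorem eventually_forall_ncard_boundedPlanar_le {K : ℕ} (hK1 : 1 ≤ K)
    (hK : ∀ n, (planarSet n).ncard ≤ K ^ n * n.factorial) (hc : H.Connected) (hp : IsPlanar H)
    {δ : ℕ} (hδ : ∀ i, δ ≤ ndeg H i) {D₀ : ℕ} (hD : ∀ i, ndeg H i ≤ D₀) (hD0 : ndeg H 0 + 1 ≤ D₀)
    (hD3 : 3 ≤ D₀) {θ : ℝ} (hθ : 1 < θ) :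
    ∀ᶠ n : ℕ in atTop, ∀ d D : ℤ, 0 ≤ d → d ≤ δ → D₀ ≤ D →
      0 < (boundedPlanar (Fin n) d D).ncard ∧
      ∀ m, n ≤ m → ((boundedPlanar (Fin m) d D).ncard : ℝ) / m.factorial ≤
        (K * θ) ^ (m - n) * (θ ^ n * (((boundedPlanar (Fin n) d D).ncard : ℝ) / n.factorial)) := by
  -- Only finitely many values of `d` occur, so uniformity has to be proved for `D` alone.
  have key : ∀ d ∈ Set.Icc (0 : ℤ) δ, ∀ᶠ n : ℕ in atTop, ∀ D : ℤ, D₀ ≤ D →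
      0 < (boundedPlanar (Fin n) d D).ncard ∧
      ∀ m, n ≤ m → ((boundedPlanar (Fin m) d D).ncard : ℝ) / m.factorial ≤
        (K * θ) ^ (m - n) * (θ ^ n * (((boundedPlanar (Fin n) d D).ncard : ℝ) / n.factorial)) := by
    rintro d ⟨-, hd⟩
    have hd' : ∀ i, d ≤ ndeg H i := fun i => hd.trans (by exact_mod_cast hδ i)
    have hg : ∀ i : ℕ, GrowthPair K
        (fun n => ((connPlanar (Fin n) d (D₀ + i : ℕ)).ncard : ℝ) / n.factorial)
        (fun n => ((boundedPlanar (Fin n) d (D₀ + i : ℕ)).ncard : ℝ) / n.factorial) := by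
      intro i
      have h1 := hd' 0
      refine growthPair_planar hK (by omega) (by omega) (p := h) (q := 1 + ndeg H 0 * h) (by simp)
        ⟨H, ⟨hp, fun v => ⟨hd' v, ?_⟩⟩, hc⟩ (spider_mem_connPlanar hc hp hd' (fun v => ?_) ?_)
      · have := hD v; omega
      · have := hD v; omega
      · omega
    have hfam := GrowthPair.eventually_forall_family hg (by exact_mod_cast hK1)
      (fun i j n hij => by
        have := Set.ncard_le_ncard (connPlanar_mono (V := Fin n) (d := d) (D := (D₀ + i : ℕ))
          (D' := (D₀ + j : ℕ)) (by omega)) (Set.toFinite _)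
        gcongr)
      (fun i j n hij => by
        have := Set.ncard_le_ncard (boundedPlanar_mono (V := Fin n) (d := d) (D := (D₀ + i : ℕ))
          (D' := (D₀ + j : ℕ)) (by omega)) (Set.toFinite _)
        gcongr)
      (fun i j n hi hj => by
        rw [connPlanar_eq_of_card_le (D' := (D₀ + j : ℕ))] <;> simp <;> omega)
      (fun i j n hi hj => by
        rw [boundedPlanar_eq_of_card_le (D' := (D₀ + j : ℕ))] <;> simp <;> omega) hθ
    filter_upwards [hfam] with n hn D hD
    obtain ⟨i, rfl⟩ : ∃ i : ℕ, D = (D₀ + i : ℕ) := ⟨(D - D₀).toNat, by omega⟩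
    have hle := (hg i).le n
    refine ⟨?_, fun m hm => ((hn i).2 m hm).trans ?_⟩
    · have := (hn i).1.trans_le hle
      by_contra h0
      rw [Nat.eq_zero_of_not_pos h0] at this
      simp at this
    · have : 0 < θ := by linarith
      have : (0 : ℝ) ≤ K := K.cast_nonneg
      gcongr
  filter_upwards [(Set.finite_Icc (0 : ℤ) δ).eventually_all.2 key] with n hn d D h1 h2 h3
  exact hn d ⟨h1, h2⟩ D h3

variable {s q : ℕ} {d D : ℤ}

theorem mul_ncard_fewAttachments_div_le (hc : H.Connected) (hp : IsPlanar H)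
    (hd : ∀ i, d ≤ ndeg H i) (hD : ∀ i, (ndeg H i : ℤ) ≤ D) (hD0 : (ndeg H 0 : ℤ) + 1 ≤ D)
    (hD3 : 3 ≤ D) (hs : s = max 1 (ndeg H 0 - 1)) (hq : q = 1 + s * h) (n k : ℕ) :
    n * (((fewAttachments H d D n k).ncard : ℝ) / n.factorial) ≤
      2 * q.factorial * (s + 2) ^ 2 * (k + q : ℕ) *
        (((fewAttachments H d D (n + q) (k + q)).ncard : ℝ) / (n + q).factorial) := by
  have h1 := Nat.cast_le (α := ℝ).2 (mul_ncard_fewAttachments_le hc hp hd hD hD0 hD3 hs n k)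
  rw [← hq] at h1
  have h2 : (((n + q).choose n * n.factorial * q.factorial : ℕ) : ℝ) = (n + q).factorial := by
    rw [Nat.choose_symm_add, Nat.add_choose_mul_factorial_mul_factorial]
  have hn : (0 : ℝ) < n.factorial := by positivity
  have hq0 : (0 : ℝ) < q.factorial := by positivity
  push_cast at h1 h2 ⊢
  rw [← mul_div_assoc, ← mul_div_assoc, div_le_div_iff₀ (by positivity) (by positivity), ← h2]
  calc _ = (n * (n + q).choose n * (fewAttachments H d D n k).ncard : ℝ) *
        (n.factorial * q.factorial) := by ring
    _ ≤ _ := mul_le_mul_of_nonneg_right h1 (by positivity)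
    _ = _ := by ring

/-- The bound `u` on the number of steps fixes one base `k + u * q` for all factors, so that the
induction produces a plain power. -/
theorem pow_mul_ncard_fewAttachments_div_le (hc : H.Connected) (hp : IsPlanar H)
    (hd : ∀ i, d ≤ ndeg H i) (hD : ∀ i, (ndeg H i : ℤ) ≤ D) (hD0 : (ndeg H 0 : ℤ) + 1 ≤ D)
    (hD3 : 3 ≤ D) (hs : s = max 1 (ndeg H 0 - 1)) (hq : q = 1 + s * h) (n k t u : ℕ)
    (ht : t ≤ u) :
    (n : ℝ) ^ t * (((fewAttachments H d D n k).ncard : ℝ) / n.factorial) ≤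
      (2 * q.factorial * (s + 2) ^ 2 * (k + u * q : ℕ)) ^ t *
        (((fewAttachments H d D (n + t * q) (k + t * q)).ncard : ℝ) / (n + t * q).factorial) := by
  induction t with
  | zero =>
    rw [zero_mul, pow_zero, pow_zero]
    exact le_rfl
  | succ t ih =>
    have h1 := mul_ncard_fewAttachments_div_le hc hp hd hD hD0 hD3 hs hq (n + t * q) (k + t * q)
    rw [show n + t * q + q = n + (t + 1) * q by ring, show k + t * q + q = k + (t + 1) * q by ring]
      at h1
    set B : ℝ := 2 * q.factorial * (s + 2) ^ 2
    have hB : 0 ≤ B := by positivity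
    have hle : ((k + (t + 1) * q : ℕ) : ℝ) ≤ (k + u * q : ℕ) :=
      Nat.cast_le.2 (Nat.add_le_add_left (Nat.mul_le_mul_right q ht) k)
    calc (n : ℝ) ^ (t + 1) * (((fewAttachments H d D n k).ncard : ℝ) / n.factorial)
        = n * ((n : ℝ) ^ t * (((fewAttachments H d D n k).ncard : ℝ) / n.factorial)) := by ring
      _ ≤ (n + t * q : ℕ) * ((B * (k + u * q : ℕ)) ^ t *
          (((fewAttachments H d D (n + t * q) (k + t * q)).ncard : ℝ) / (n + t * q).factorial)) := by
        refine mul_le_mul (Nat.cast_le.2 (Nat.le_add_right _ _)) (ih (by omega)) (by positivity)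
          (by positivity)
      _ = (B * (k + u * q : ℕ)) ^ t * ((n + t * q : ℕ) *
          (((fewAttachments H d D (n + t * q) (k + t * q)).ncard : ℝ) / (n + t * q).factorial)) := by
        ring
      _ ≤ (B * (k + u * q : ℕ)) ^ t * (B * (k + u * q : ℕ) *
          (((fewAttachments H d D (n + (t + 1) * q) (k + (t + 1) * q)).ncard : ℝ) /
            (n + (t + 1) * q).factorial)) := by
        refine mul_le_mul_of_nonneg_left (h1.trans ?_) (by positivity)
        gcongr
      _ = _ := by ring

/-- If `α` is small, then few graphs have few attachments. -/
theorem ncard_fewAttachments_lt {K : ℝ} (hK0 : 0 < K) (hc : H.Connected) (hp : IsPlanar H)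
    (hd : ∀ i, d ≤ ndeg H i) (hD : ∀ i, (ndeg H i : ℤ) ≤ D) (hD0 : (ndeg H 0 : ℤ) + 1 ≤ D)
    (hD3 : 3 ≤ D) (hs : s = max 1 (ndeg H 0 - 1)) (hq : q = 1 + s * h) {α : ℝ} (hα0 : 0 < α)
    (hα : 2 * q.factorial * (s + 2) ^ 2 * (1 + 2 * q) * K ^ q * Real.exp 2 * α < 1) {n : ℕ}
    (hn : 1 ≤ α * n) (hpos : 0 < (boundedPlanar (Fin n) d D).ncard)
    (hgrowth : ∀ m, n ≤ m → ((boundedPlanar (Fin m) d D).ncard : ℝ) / m.factorial ≤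
        K ^ (m - n) * (Real.exp (α * n) *
          (((boundedPlanar (Fin n) d D).ncard : ℝ) / n.factorial))) :
    ((fewAttachments H d D n ⌊α * n⌋₊).ncard : ℝ) <
      Real.exp (-α * n) * (boundedPlanar (Fin n) d D).ncard := by
  by_contra hcon
  rw [not_lt] at hcon
  have hn0 : (0 : ℝ) < n := by
    by_contra h0
    rw [le_antisymm (not_lt.1 h0) n.cast_nonneg] at hn
    linarith
  set k := ⌊α * n⌋₊
  -- The number of insertions is of order `α n`: at least `α n`, so that `exp (2 * α n) ≤ exp 2 ^
  -- t`, and at most `2 α n`, since `α n ≥ 1`.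
  set t := ⌈α * n⌉₊
  set B : ℝ := 2 * q.factorial * (s + 2) ^ 2
  have hB : 0 < B := by positivity
  have hk : (k : ℝ) ≤ α * n := Nat.floor_le (by positivity)
  have ht : α * n ≤ t := Nat.le_ceil _
  have ht' : (t : ℝ) ≤ 2 * (α * n) := by
    have := Nat.ceil_lt_add_one (by positivity : 0 ≤ α * n)
    linarith
  have ht0 : t ≠ 0 := by
    intro h0
    rw [h0, Nat.cast_zero] at ht
    linarith
  have h1 := pow_mul_ncard_fewAttachments_div_le hc hp hd hD hD0 hD3 hs hq n k t t le_rfl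
  have h2 := hgrowth (n + t * q) (Nat.le_add_right _ _)
  rw [Nat.add_sub_cancel_left] at h2
  have h3 : (fewAttachments H d D (n + t * q) (k + t * q)).ncard ≤
      (boundedPlanar (Fin (n + t * q)) d D).ncard :=
    Set.ncard_le_ncard (fun G hG => hG.1) (Set.toFinite _)
  set x : ℝ := ((boundedPlanar (Fin n) d D).ncard : ℝ) / n.factorial with hx
  have hx0 : 0 < x := by positivity
  have h4 : (n : ℝ) ^ t * (Real.exp (-α * n) * x) ≤
      (B * (k + t * q : ℕ)) ^ t * (K ^ (t * q) * (Real.exp (α * n) * x)) := by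
    calc (n : ℝ) ^ t * (Real.exp (-α * n) * x)
        ≤ (n : ℝ) ^ t * (((fewAttachments H d D n k).ncard : ℝ) / n.factorial) := by
          rw [hx, ← mul_div_assoc]
          gcongr
      _ ≤ _ := h1
      _ ≤ (B * (k + t * q : ℕ)) ^ t *
          (((boundedPlanar (Fin (n + t * q)) d D).ncard : ℝ) / (n + t * q).factorial) := by
        gcongr
      _ ≤ _ := mul_le_mul_of_nonneg_left h2 (by positivity)
  -- Cancelling the size of the class leaves two exponential factors, one from the assumed
  -- proportion and one from the growth estimate. They are absorbed into the `t`-th power, after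
  -- which a `t`-th root can be taken.
  have h5 : (n : ℝ) ^ t ≤ (B * (k + t * q : ℕ) * K ^ q * Real.exp 2) ^ t := by
    have h6 : Real.exp (2 * (α * n)) ≤ Real.exp 2 ^ t := by
      rw [← Real.exp_nat_mul, Real.exp_le_exp]
      linarith
    have h7 : 0 < Real.exp (-α * n) * x := by positivity
    refine le_of_mul_le_mul_right (h4.trans ?_) h7
    calc (B * (k + t * q : ℕ)) ^ t * (K ^ (t * q) * (Real.exp (α * n) * x))
        = (B * (k + t * q : ℕ)) ^ t * K ^ (t * q) * Real.exp (2 * (α * n)) *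
            (Real.exp (-α * n) * x) := by
          rw [show α * (n : ℝ) = 2 * (α * n) + -α * n by ring, Real.exp_add]
          ring_nf
      _ ≤ (B * (k + t * q : ℕ)) ^ t * K ^ (t * q) * Real.exp 2 ^ t * (Real.exp (-α * n) * x) := by
          gcongr
      _ = _ := by rw [mul_comm t q, pow_mul, ← mul_pow, ← mul_pow]
  have h6 := le_of_pow_le_pow_left₀ ht0 (by positivity) h5
  have h7 : ((k + t * q : ℕ) : ℝ) ≤ α * n * (1 + 2 * q) := by
    push_cast
    calc (k : ℝ) + t * q ≤ α * n + 2 * (α * n) * q := by gcongr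
      _ = _ := by ring
  have h8 : (n : ℝ) ≤ B * (1 + 2 * q) * K ^ q * Real.exp 2 * α * n := by
    calc (n : ℝ) ≤ _ := h6
      _ ≤ B * (α * n * (1 + 2 * q)) * K ^ q * Real.exp 2 := by gcongr
      _ = _ := by ring
  have h9 := mul_lt_mul_of_pos_right hα hn0
  linarith

end Rate

end RandomPlanar

/-! ### Choice of the constant and conclusion. -/

theorem mainTheorem5 (h : ℕ) [NeZero h] :
    ∃ α : ℝ, 0 < α ∧
      ∀ (H : SimpleGraph (Fin h)) [DecidableRel H.Adj],
        H.Connected → RandomPlanar.IsPlanar H →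
        ∀ d D : ℕ → ℤ,
          limsup (fun n => ((d n : ℝ) : EReal)) atTop ≤ ((H.minDegree : ℝ) : EReal) →
          ((max (max H.maxDegree (H.degree 0 + 1)) 3 : ℕ) : EReal) ≤
            liminf (fun n => ((D n : ℝ) : EReal)) atTop →
          ∀ᶠ n : ℕ in atTop,
            (RandomPlanar.planarGraphs n (d n) (D n)).Nonempty ∧
            RandomPlanar.prob n (d n) (D n)
                (fun G => (RandomPlanar.numCutableAppearances H (d n) G : ℝ) ≤ α * n) <
              Real.exp (-α * n) := by
  obtain ⟨K, hK1, hK⟩ := RandomPlanar.exists_ncard_planarSet_le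
  have hK1' : (1 : ℝ) ≤ K := by exact_mod_cast hK1
  -- Bounds in terms of `h` alone: `s ≤ h` gives `q ≤ Q`, and `α ≤ 1` gives `K * exp α ≤ K * exp 1`.
  -- Thus `α` does not depend on `H`, `d` or `D`.
  let Q : ℕ := 1 + h * h
  let X : ℝ := 2 * Q.factorial * (h + 2) ^ 2 * (1 + 2 * Q) * (K * Real.exp 1) ^ Q * Real.exp 2
  have hX : 1 ≤ X := by
    have h1 : (1 : ℝ) ≤ Q.factorial := by exact_mod_cast Q.factorial_pos
    have h2 : 1 ≤ Real.exp 1 := Real.one_le_exp zero_le_one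
    have h3 : 1 ≤ Real.exp 2 := Real.one_le_exp zero_le_two
    have h4 : (1 : ℝ) ≤ (h + 2) ^ 2 := one_le_pow₀ (by linarith [h.cast_nonneg (α := ℝ)])
    have h5 : (1 : ℝ) ≤ 1 + 2 * Q := by linarith [Q.cast_nonneg (α := ℝ)]
    have h6 : 1 ≤ (K * Real.exp 1) ^ Q := one_le_pow₀ (one_le_mul_of_one_le_of_one_le hK1' h2)
    have h7 : (1 : ℝ) ≤ 2 * Q.factorial := by linarith
    exact one_le_mul_of_one_le_of_one_le (one_le_mul_of_one_le_of_one_le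
      (one_le_mul_of_one_le_of_one_le (one_le_mul_of_one_le_of_one_le h7 h4) h5) h6) h3
  have hX0 : 0 < X := by linarith
  have hα0 : 0 < 1 / (2 * X) := by positivity
  have hα1 : 1 / (2 * X) ≤ 1 := (div_le_one (by positivity)).2 (by linarith)
  have hXα : X * (1 / (2 * X)) < 1 := by
    rw [mul_one_div, div_lt_one (by positivity)]
    linarith
  generalize 1 / (2 * X) = α at hα0 hα1 hXα
  refine ⟨α, hα0, fun H _ hc hp d D hd hD => ?_⟩
  have hdeg : ∀ v, RandomPlanar.ndeg H v = H.degree v := fun v => RandomPlanar.ndeg_eq_degree H v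
  have hdlt : ∀ᶠ n in atTop, d n ≤ H.minDegree := by
    have h1 : ((H.minDegree : ℝ) : EReal) < ((H.minDegree + 1 : ℝ) : EReal) :=
      EReal.coe_lt_coe_iff.2 (lt_add_one _)
    filter_upwards [eventually_lt_of_limsup_lt (hd.trans_lt h1)] with n hn
    have h2 : (d n : ℝ) < ((H.minDegree + 1 : ℤ) : ℝ) := by
      push_cast
      exact EReal.coe_lt_coe_iff.1 hn
    have := Int.cast_lt.1 h2
    omega
  have hDge : ∀ᶠ n in atTop, ((max (max H.maxDegree (H.degree 0 + 1)) 3 : ℕ) : ℤ) ≤ D n := by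
    generalize max (max H.maxDegree (H.degree 0 + 1)) 3 = D₀ at hD ⊢
    have h1 : ((D₀ - 1 : ℝ) : EReal) < (D₀ : EReal) := by
      rw [← EReal.coe_natCast]
      exact EReal.coe_lt_coe_iff.2 (sub_one_lt _)
    filter_upwards [eventually_lt_of_lt_liminf (h1.trans_le hD)] with n hn
    have h2 : ((D₀ - 1 : ℤ) : ℝ) < (D n : ℝ) := by
      push_cast
      exact EReal.coe_lt_coe_iff.1 hn
    have := Int.cast_lt.1 h2
    omega
  have hgrow := RandomPlanar.eventually_forall_ncard_boundedPlanar_le hK1 hK hc hp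
    (δ := H.minDegree) (fun i => (hdeg i).symm ▸ H.minDegree_le_degree i)
    (D₀ := max (max H.maxDegree (H.degree 0 + 1)) 3)
    (fun i => (hdeg i).symm ▸ (H.degree_le_maxDegree i).trans
      ((le_max_left _ _).trans (le_max_left _ _)))
    ((hdeg 0).symm ▸ (le_max_right _ _).trans (le_max_left _ _)) (le_max_right _ _)
    (Real.one_lt_exp_iff.2 hα0)
  have hlarge : ∀ᶠ n : ℕ in atTop, 1 ≤ α * n :=
    (tendsto_natCast_atTop_atTop.const_mul_atTop hα0).eventually_ge_atTop 1
  filter_upwards [hdlt, hDge, hgrow, hlarge] with n hdn hDn hgn hαn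
  -- Degrees are nonnegative, so a negative lower bound may be raised to 0, which leaves finitely
  -- many values. Being cut-able for the raised bound implies being cut-able for the original one,
  -- so no appearance is overcounted.
  have hclass : RandomPlanar.planarGraphs n (d n) (D n) =
      RandomPlanar.boundedPlanar (Fin n) (max (d n) 0) (D n) := by
    rw [RandomPlanar.planarGraphs_eq]
    ext G
    exact and_congr_right fun _ => forall_congr' fun v => and_congr_left fun _ => by
      rw [max_le_iff, and_iff_left (Int.natCast_nonneg _)]
  obtain ⟨hpos, hgn⟩ := hgn (max (d n) 0) (D n) (le_max_right _ _)
    (max_le hdn (Int.natCast_nonneg _)) hDn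
  have hd' : ∀ i, max (d n) 0 ≤ (RandomPlanar.ndeg H i : ℤ) := fun i => by
    have := H.minDegree_le_degree i
    rw [hdeg]
    omega
  have hD' : ∀ i, (RandomPlanar.ndeg H i : ℤ) ≤ D n := fun i => by
    have := H.degree_le_maxDegree i
    rw [hdeg]
    omega
  have hs : max 1 (RandomPlanar.ndeg H 0 - 1) ≤ h := by
    have h1 := RandomPlanar.ndeg_lt_card H 0
    have h2 : h ≠ 0 := NeZero.ne h
    rw [Nat.card_eq_fintype_card, Fintype.card_fin] at h1
    omega
  have hq : 1 + max 1 (RandomPlanar.ndeg H 0 - 1) * h ≤ Q :=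
    Nat.add_le_add_left (Nat.mul_le_mul_right h hs) 1
  have hlt := RandomPlanar.ncard_fewAttachments_lt (K := K * Real.exp α) (by positivity) hc hp hd'
    hD' (by rw [hdeg]; omega) (by omega) rfl rfl hα0 ?_ hαn hpos
    (fun m hm => by simpa only [← Real.exp_nat_mul, mul_comm] using hgn m hm)
  · rw [hclass, RandomPlanar.prob, hclass, div_lt_iff₀ (by exact_mod_cast hpos)]
    refine ⟨(Set.ncard_pos (Set.toFinite _)).1 hpos, lt_of_le_of_lt ?_ hlt⟩
    refine Nat.cast_le.2 (Set.ncard_le_ncard (fun G hG => ⟨hG.1, Nat.le_floor ?_⟩) (Set.toFinite _))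
    refine le_trans (Nat.cast_le.2 ((RandomPlanar.ncard_attachments_le H _ G).trans ?_)) hG.2
    refine Set.ncard_le_ncard ?_ (Set.toFinite _)
    rintro W ⟨r, v, h1, h2⟩
    exact ⟨r, v, h1, (le_max_left _ _).trans_lt h2⟩
  · refine lt_of_le_of_lt ?_ hXα
    generalize max 1 (RandomPlanar.ndeg H 0 - 1) = s at hs hq ⊢
    generalize 1 + s * h = q at hq ⊢
    have h1 : (s : ℝ) ≤ h := by exact_mod_cast hs
    have h2 : (q : ℝ) ≤ Q := by exact_mod_cast hq
    have h3 : (q.factorial : ℝ) ≤ Q.factorial := by exact_mod_cast Nat.factorial_le hq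
    have h4 : (K * Real.exp α) ^ q ≤ (K * Real.exp 1) ^ Q :=
      (pow_le_pow_left₀ (by positivity) (by gcongr) q).trans (pow_le_pow_right₀
        (one_le_mul_of_one_le_of_one_le hK1' (Real.one_le_exp zero_le_one)) hq)
    simp only [X]
    gcongr
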